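/- Let $G$ be a second countable locally compact Hausdorff groupoid with unit space $G^{(0)}$, range and source maps $r,s$, and Haar system $\{\lambda^u\}_{u\in G^{(0)}}$, and let $\lambda_u$ be the image of $\lambda^u$ under inversion. Assume that $G$ is proper, i.e. $\gamma\mapsto(r(\gamma),s(\gamma))$ is a proper map $G\to G^{(0)}\times G^{(0)}$. Let $(\mathscr A,G,\alpha)$ be a groupoid dynamical system: $\mathscr A$ is an upper semicontinuous $C^*$-bundle over $G^{(0)}$ with fibres $A(u)$ whose section algebra $A=\Gamma_0(G^{(0)},\mathscr A)$ is separable, and the $\alpha_\gamma:A(s(\gamma))\to A(r(\gamma))$ are $*$-isomorphisms with $\alpha_{\gamma\eta}=\alpha_\gamma\circ\alpha_\eta$ for composable $\gamma,\eta$, such that $(\gamma,a)\mapsto\alpha_\gamma(a)$ is continuous. Put $A_0=C_c(G^{(0)})\cdot A$. (1) The system is proper with respect to $A_0$. That is, $A_0$ is a dense $*$-subalgebra of $A$ and: (a) for $a,b\in A_0$ the section ${}_E\langle a,b\rangle(\gamma)=a(r(\gamma))\,\alpha_\gamma(b(s(\gamma))^*)$ of $r^*\mathscr A$ is integrable, i.e.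 $\gamma\mapsto\|{}_E\langle a,b\rangle(\gamma)\|$ is measurable and its integrals with respect to all $\lambda^u$ and $\lambda_u$ are bounded uniformly in $u$; (b) let $M(A_0)^\alpha$ be the set of $d\in M(A)$ with $A_0d\subset A_0$ and $\bar\alpha_\gamma(d(s(\gamma)))=d(r(\gamma))$ for all $\gamma\in G$, where $d(u)\in M(A(u))$ is the fibre of $d$ at $u$ and $\bar\alpha_\gamma$ is the extension of $\alpha_\gamma$ to multipliers; then for all $a,b\in A_0$ there is a unique $\langle a,b\rangle_D\in M(A_0)^\alpha$ such that $(c\cdot\langle a,b\rangle_D)(u)=\int_G c(r(\gamma))\,\alpha_\gamma((a^*b)(s(\gamma)))\,d\lambda^u(\gamma)$ for all $c\in A_0$ and $u\in G^{(0)}$, the integrals being convergent. (2) For $a\in A_0$ the averaging map $\lambda(a)(u)=\int_G\alpha_\gamma(a(s(\gamma)))\,d\lambda^u(\gamma)$ is well defined, and $\lambda(a)$ lies in the induced algebra $\mathrm{Ind}_G^{G^{(0)}}(\mathscr A,\alpha)$, the set of bounded continuous sections $f$ of $\mathscr A$ with $f(s(\gamma))=\alpha_\gamma^{-1}(f(r(\gamma)))$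 for all $\gamma$ and $[u]\mapsto\|f(u)\|$ vanishing at infinity on the orbit space $G\backslash G^{(0)}$. For $a,b\in A_0$, $\langle a,b\rangle_D$ is the multiplier given by pointwise multiplication by $\lambda(a^*b)$. (3) Let $\mathscr A\rtimes_{\alpha,r}G$ be the reduced crossed product, the completion of the convolution algebra $\Gamma_c(G,r^*\mathscr A)$ of continuous compactly supported sections in the norm $\|f\|_r=\sup_\pi\|\mathrm{Ind}\,\pi(f)\|$, where $\pi=\int^\oplus\pi_u\,d\mu(u)$ runs over the separable $C_0(G^{(0)})$-linear representations of $A$, disintegrated over a Borel Hilbert bundle $\{\mathcal H(u)\}$ and a finite Borel measure $\mu$ on $G^{(0)}$, and $\mathrm{Ind}\,\pi(f)h(\gamma)=\int_G\pi_{s(\gamma)}(\alpha_\gamma^{-1}(f(\eta)))\,h(\eta^{-1}\gamma)\,d\lambda^{r(\gamma)}(\eta)$ on the space of square integrable sections $h$, $h(\gamma)\in\mathcal H(s(\gamma))$, with respect to $\int\lambda_u\,d\mu(u)$. All these operators are well defined with $\|f\|_r<\infty$, each ${}_E\langle a,b\rangle$ with $a,b\in A_0$ defines an element of $\mathscr A\rtimes_{\alpha,r}G$,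 and $E=\overline{\mathrm{span}}\{{}_E\langle a,b\rangle:a,b\in A_0\}$ is a closed two-sided ideal of $\mathscr A\rtimes_{\alpha,r}G$. -/

import Mathlib

open Set Filter Topology MeasureTheory Bundle
open scoped ENNReal MultiplierAlgebra

/-- Transport of an element of a family of types along an equality of base points. -/
def fibreCast {X : Type*} {E : X → Type*} {x y : X} (h : x = y) (a : E x) : E y := h ▸ a

/-! ### Locally compact groupoids and Haar systems -/

/-- A topological groupoid with arrow space `G` and unit space `X`.  The unit space is a separate
type; `unit` identifies it with the subspace of units of `G` (it is a homeomorphism onto its image,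
with inverse the restriction of `r`). -/
structure TopGroupoid (G X : Type*) [TopologicalSpace G] [TopologicalSpace X] where
  /-- range -/
  r : G → X
  /-- source -/
  s : G → X
  unit : X → G
  /-- the product `γη` of a composable pair, `s γ = r η` -/
  mul : ∀ γ η : G, s γ = r η → G
  inv : G → G
  r_unit : ∀ x, r (unit x) = x
  s_unit : ∀ x, s (unit x) = x
  r_mul : ∀ γ η h, r (mul γ η h) = r γ
  s_mul : ∀ γ η h, s (mul γ η h) = s η
  r_inv : ∀ γ, r (inv γ) = s γ
  s_inv : ∀ γ, s (inv γ) = r γ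
  unit_mul : ∀ γ, mul (unit (r γ)) γ (s_unit (r γ)) = γ
  mul_unit : ∀ γ, mul γ (unit (s γ)) (r_unit (s γ)).symm = γ
  inv_mul : ∀ γ, mul (inv γ) γ (s_inv γ) = unit (s γ)
  mul_inv : ∀ γ, mul γ (inv γ) (r_inv γ).symm = unit (r γ)
  mul_assoc : ∀ (γ η ζ : G) (h₁ : s γ = r η) (h₂ : s η = r ζ),
    mul (mul γ η h₁) ζ ((s_mul γ η h₁).trans h₂) = mul γ (mul η ζ h₂) (h₁.trans (r_mul η ζ h₂).symm)
  continuous_r : Continuous r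
  continuous_s : Continuous s
  continuous_unit : Continuous unit
  continuous_inv : Continuous inv
  continuous_mul : Continuous fun p : {p : G × G // s p.1 = r p.2} => mul p.1.1 p.1.2 p.2

namespace TopGroupoid

variable {G X : Type*} [TopologicalSpace G] [TopologicalSpace X] (𝓖 : TopGroupoid G X)

/-- `G` is proper: the action `γ · s γ = r γ` on the unit space is proper, that is
`(γ, s γ) ↦ (γ · s γ, s γ)` is a proper map. -/
def IsProper : Prop := IsProperMap fun γ : G => (𝓖.r γ, 𝓖.s γ)

/-- The orbit equivalence relation on the unit space. -/
def orbitSetoid : Setoid X where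
  r u v := ∃ γ, 𝓖.r γ = u ∧ 𝓖.s γ = v
  iseqv :=
    { refl := fun x => ⟨𝓖.unit x, 𝓖.r_unit x, 𝓖.s_unit x⟩
      symm := fun {_ _} ⟨γ, hr, hs⟩ => ⟨𝓖.inv γ, (𝓖.r_inv γ).trans hs, (𝓖.s_inv γ).trans hr⟩
      trans := fun {_ _ _} ⟨γ, hr, hs⟩ ⟨η, hr', hs'⟩ =>
        ⟨𝓖.mul γ η (hs.trans hr'.symm), (𝓖.r_mul _ _ _).trans hr, (𝓖.s_mul _ _ _).trans hs'⟩ }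

/-- The orbit space, with the quotient topology. -/
abbrev OrbitSpace : Type _ := Quotient 𝓖.orbitSetoid

end TopGroupoid

/-- A (left) Haar system: Borel measures `μ u = λ^u` on `G`, finite on compact sets, with support
`{γ | r γ = u}`, continuous in `u` and left invariant. -/
structure HaarSystem {G X : Type*} [TopologicalSpace G] [TopologicalSpace X] [MeasurableSpace G]
    (𝓖 : TopGroupoid G X) where
  μ : X → Measure G
  finite_of_compact : ∀ (u : X) (K : Set G), IsCompact K → μ u K < ∞
  support_eq : ∀ u, (μ u).support = {γ | 𝓖.r γ = u}
  continuous_integral : ∀ f : G → ℝ, Continuous f → HasCompactSupport f →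
    Continuous fun u => ∫ γ, f γ ∂μ u
  left_invariant : ∀ (γ : G) (f : G → ℝ), Continuous f → HasCompactSupport f →
    (∫ η, (open Classical in if h : 𝓖.s γ = 𝓖.r η then f (𝓖.mul γ η h) else 0) ∂μ (𝓖.s γ)) =
      ∫ η, f η ∂μ (𝓖.r γ)

namespace HaarSystem

variable {G X : Type*} [TopologicalSpace G] [TopologicalSpace X] [MeasurableSpace G]
  {𝓖 : TopGroupoid G X} (haar : HaarSystem 𝓖)

/-- The measure `λ_u`, the image of `λ^u` under inversion. -/
noncomputable def coMeasure (u : X) : Measure G := (haar.μ u).map 𝓖.inv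

/-- The measure `ν⁻¹ = ∫ λ_u dμ(u)` on `G`. -/
noncomputable def nuInv [MeasurableSpace X] (μ : Measure X) : Measure G := μ.bind haar.coMeasure

end HaarSystem

/-! ### Upper semicontinuous C⋆-bundles and their section algebras -/

section Bundle

variable {X : Type*} [TopologicalSpace X]

/-- An upper semicontinuous C⋆-bundle over `X`, with fibres `A x` and total space
`TotalSpace ℂ A` (the argument `ℂ` of `TotalSpace` is a dummy). -/
class IsUSCCStarBundle (A : X → Type*) [∀ x, NonUnitalCStarAlgebra (A x)]
    [TopologicalSpace (TotalSpace ℂ A)] : Prop where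
  continuous_proj : Continuous (TotalSpace.proj : TotalSpace ℂ A → X)
  isOpenMap_proj : IsOpenMap (TotalSpace.proj : TotalSpace ℂ A → X)
  norm_usc : ∀ ε : ℝ, 0 < ε → IsOpen {a : TotalSpace ℂ A | ‖a.snd‖ < ε}
  continuous_add : Continuous
    fun p : {p : TotalSpace ℂ A × TotalSpace ℂ A // p.2.proj = p.1.proj} =>
      (⟨p.1.1.proj, p.1.1.snd + fibreCast p.2 p.1.2.snd⟩ : TotalSpace ℂ A)
  continuous_mul : Continuous
    fun p : {p : TotalSpace ℂ A × TotalSpace ℂ A // p.2.proj = p.1.proj} =>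
      (⟨p.1.1.proj, p.1.1.snd * fibreCast p.2 p.1.2.snd⟩ : TotalSpace ℂ A)
  continuous_smul : ∀ k : ℂ, Continuous
    fun a : TotalSpace ℂ A => (⟨a.proj, k • a.snd⟩ : TotalSpace ℂ A)
  continuous_star : Continuous
    fun a : TotalSpace ℂ A => (⟨a.proj, star a.snd⟩ : TotalSpace ℂ A)
  /-- If `p(a_i) → x` and `‖a_i‖ → 0`, then `a_i → 0_x`. -/
  tendsto_zero : ∀ x : X,
    comap (fun a : TotalSpace ℂ A => (a.proj, ‖a.snd‖)) (𝓝 (x, 0)) ≤ 𝓝 ⟨x, 0⟩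

variable (A : X → Type*) [∀ x, NonUnitalCStarAlgebra (A x)] [TopologicalSpace (TotalSpace ℂ A)]

/-- Continuity of a section of the bundle. -/
def IsContSection {A : X → Type*} [TopologicalSpace (TotalSpace ℂ A)] (a : ∀ x, A x) : Prop :=
  Continuous fun x => (⟨x, a x⟩ : TotalSpace ℂ A)

namespace IsContSection

variable {A} [IsUSCCStarBundle A] {a b : ∀ x, A x}

theorem add (ha : IsContSection a) (hb : IsContSection b) : IsContSection fun x => a x + b x := by
  let j : X → {p : TotalSpace ℂ A × TotalSpace ℂ A // p.2.proj = p.1.proj} :=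
    fun x => ⟨(⟨x, a x⟩, ⟨x, b x⟩), rfl⟩
  have hj : Continuous j := Continuous.subtype_mk (Continuous.prodMk ha hb) _
  exact (IsUSCCStarBundle.continuous_add (A := A)).comp hj

theorem mul (ha : IsContSection a) (hb : IsContSection b) : IsContSection fun x => a x * b x := by
  let j : X → {p : TotalSpace ℂ A × TotalSpace ℂ A // p.2.proj = p.1.proj} :=
    fun x => ⟨(⟨x, a x⟩, ⟨x, b x⟩), rfl⟩
  have hj : Continuous j := Continuous.subtype_mk (Continuous.prodMk ha hb) _
  exact (IsUSCCStarBundle.continuous_mul (A := A)).comp hj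

theorem smul (k : ℂ) (ha : IsContSection a) : IsContSection fun x => k • a x :=
  (IsUSCCStarBundle.continuous_smul (A := A) k).comp ha

theorem star (ha : IsContSection a) : IsContSection fun x => Star.star (a x) :=
  (IsUSCCStarBundle.continuous_star (A := A)).comp ha

theorem zero : IsContSection fun x => (0 : A x) := by
  refine continuous_iff_continuousAt.2 fun x => ?_
  refine Tendsto.mono_right ?_ (IsUSCCStarBundle.tendsto_zero (A := A) x)
  rw [tendsto_comap_iff]
  have : Continuous fun y : X => (y, (0 : ℝ)) := by fun_prop
  simpa [Function.comp_def] using this.tendsto x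

end IsContSection

variable [IsUSCCStarBundle A]

/-- `Γ₀(X, 𝒜)`: the continuous sections vanishing at infinity, with pointwise operations and the
supremum norm.  (Such sections are automatically bounded.) -/
def sectionsVanishing : NonUnitalStarSubalgebra ℂ (lp A ∞) where
  carrier := {a | IsContSection a ∧ Tendsto (fun x => ‖a x‖) (cocompact X) (𝓝 0)}
  zero_mem' := ⟨IsContSection.zero, by simpa using tendsto_const_nhds⟩
  add_mem' := fun {a b} ha hb => ⟨ha.1.add hb.1,
    squeeze_zero (fun _ => norm_nonneg _) (fun x => norm_add_le (a x) (b x))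
      (by simpa using ha.2.add hb.2)⟩
  mul_mem' := fun {a b} ha hb => ⟨ha.1.mul hb.1,
    squeeze_zero (fun _ => norm_nonneg _) (fun x => norm_mul_le (a x) (b x))
      (by simpa using ha.2.mul hb.2)⟩
  smul_mem' := fun c {a} ha => ⟨ha.1.smul c, by
    simpa [norm_smul] using ha.2.const_mul ‖c‖⟩
  star_mem' := fun {a} ha => ⟨ha.1.star, by simpa using ha.2⟩

/-- The section algebra `A = Γ₀(X, 𝒜)`. -/
abbrev SectionAlgebra : Type _ := sectionsVanishing A

instance : CoeFun (SectionAlgebra A) (fun _ => ∀ x, A x) := ⟨fun a => (a : lp A ∞)⟩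

/-- `A₀ = C_c(X) · A`, the set of products `f · a` with `f ∈ C_c(X)` and `a ∈ A`, as a
`⋆`-subalgebra of `A`. -/
def compactMulSubalgebra [T2Space X] [LocallyCompactSpace X] :
    NonUnitalStarSubalgebra ℂ (SectionAlgebra A) where
  carrier := {x | ∃ (f : X → ℂ) (a : SectionAlgebra A), Continuous f ∧ HasCompactSupport f ∧
    ∀ u, x u = f u • a u}
  zero_mem' := by
    refine ⟨0, 0, continuous_zero, HasCompactSupport.zero, fun u => ?_⟩
    exact (zero_smul ℂ ((0 : SectionAlgebra A) u)).symm
  add_mem' := by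
    rintro x y ⟨f, a, hf, hfc, hx⟩ ⟨g, b, hg, hgc, hy⟩
    obtain ⟨h, h1, -, hc, -⟩ := exists_continuous_one_zero_of_isCompact
      (hfc.isCompact.union hgc.isCompact) isClosed_empty (disjoint_empty _)
    have hcont : Continuous fun u => (h u : ℂ) := Complex.continuous_ofReal.comp h.continuous
    have hcs : HasCompactSupport fun u => (h u : ℂ) :=
      HasCompactSupport.comp_left (g := fun t : ℝ => (t : ℂ)) hc Complex.ofReal_zero
    refine ⟨fun u => (h u : ℂ), x + y, hcont, hcs, fun u => ?_⟩
    have h4 : (x + y) u = x u + y u := rfl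
    change (x + y) u = (h u : ℂ) • (x + y) u
    rw [h4]
    by_cases hu : u ∈ tsupport f ∪ tsupport g
    · have h5 : h u = 1 := h1 hu
      rw [h5, Complex.ofReal_one, one_smul]
    · simp only [Set.mem_union, not_or] at hu
      have h2 : x u = 0 := by rw [hx, image_eq_zero_of_notMem_tsupport hu.1, zero_smul]
      have h3 : y u = 0 := by rw [hy, image_eq_zero_of_notMem_tsupport hu.2, zero_smul]
      rw [h2, h3, add_zero, smul_zero]
  mul_mem' := by
    rintro x y ⟨f, a, hf, hfc, hx⟩ ⟨g, b, hg, hgc, hy⟩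
    refine ⟨f, a * y, hf, hfc, fun u => ?_⟩
    have h1 : (x * y) u = x u * y u := rfl
    have h2 : (a * y) u = a u * y u := rfl
    rw [h1, h2, hx, smul_mul_assoc]
  smul_mem' := by
    rintro c x ⟨f, a, hf, hfc, hx⟩
    refine ⟨f, c • a, hf, hfc, fun u => ?_⟩
    have h1 : (c • x) u = c • x u := rfl
    have h2 : (c • a) u = c • a u := rfl
    rw [h1, h2, hx, smul_comm]
  star_mem' := by
    rintro x ⟨f, a, hf, hfc, hx⟩
    refine ⟨fun u => star (f u), star a, hf.star, hfc.comp_left (star_zero ℂ), fun u => ?_⟩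
    have h1 : (star x) u = star (x u) := rfl
    have h2 : (star a) u = star (a u) := rfl
    rw [h1, h2, hx, star_smul]

variable {A}

/-- The section `u ↦ m u ∈ M(A(u))` gives the fibres of the multiplier `d` of `A`: `m u` is the
image of `d` under the extension to multipliers of the evaluation `A → A(u)`. -/
def IsFibresOf (d : 𝓜(ℂ, SectionAlgebra A)) (m : ∀ u, 𝓜(ℂ, A u)) : Prop :=
  ∀ (u : X) (a : SectionAlgebra A),
    (m u).fst (a u) = d.fst a u ∧ (m u).snd (a u) = d.snd a u

/-- The multiplier `d` of `A` is pointwise multiplication by the section `g`. -/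
def IsMultiplicationBy (g : ∀ u, A u) (d : 𝓜(ℂ, SectionAlgebra A)) : Prop :=
  ∀ (a : SectionAlgebra A) (u : X), d.fst a u = g u * a u ∧ d.snd a u = a u * g u

end Bundle

/-- The extension of an isomorphism of C⋆-algebras to the multiplier algebras. -/
noncomputable def multiplierMap {A B : Type*} [NonUnitalCStarAlgebra A] [NonUnitalCStarAlgebra B]
    (φ : A ≃⋆ₐ[ℂ] B) (m : 𝓜(ℂ, A)) : 𝓜(ℂ, B) :=
  let φ₁ : A →L[ℂ] B := ⟨(φ : A →ₗ[ℂ] B),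
    (NonUnitalStarAlgHom.instContinuousLinearMapClassComplex (F := A ≃⋆ₐ[ℂ] B)).map_continuous φ⟩
  let φ₂ : B →L[ℂ] A := ⟨(φ.symm : B →ₗ[ℂ] A),
    (NonUnitalStarAlgHom.instContinuousLinearMapClassComplex
      (F := B ≃⋆ₐ[ℂ] A)).map_continuous φ.symm⟩
  { fst := φ₁ ∘L m.fst ∘L φ₂
    snd := φ₁ ∘L m.snd ∘L φ₂
    central := fun x y => by
      have h := congrArg φ (m.central (φ.symm x) (φ.symm y))
      rw [map_mul, map_mul] at h
      have hx : φ (φ.symm x) = x := φ.apply_symm_apply x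
      have hy : φ (φ.symm y) = y := φ.apply_symm_apply y
      rw [hx, hy] at h
      exact h }

/-! ### Groupoid dynamical systems -/

/-- An action `α` of the groupoid on the bundle `𝒜` over its unit space. -/
structure GroupoidAction {G X : Type*} [TopologicalSpace G] [TopologicalSpace X]
    (𝓖 : TopGroupoid G X) (A : X → Type*) [∀ x, NonUnitalCStarAlgebra (A x)]
    [TopologicalSpace (TotalSpace ℂ A)] where
  α : ∀ γ : G, A (𝓖.s γ) ≃⋆ₐ[ℂ] A (𝓖.r γ)
  map_mul : ∀ (γ η : G) (h : 𝓖.s γ = 𝓖.r η) (a : A (𝓖.s η)),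
    α (𝓖.mul γ η h) (fibreCast (𝓖.s_mul γ η h).symm a) =
      fibreCast (𝓖.r_mul γ η h).symm (α γ (fibreCast h.symm (α η a)))
  continuous_act : Continuous fun p : {p : G × TotalSpace ℂ A // p.2.proj = 𝓖.s p.1} =>
    (⟨𝓖.r p.1.1, α p.1.1 (fibreCast p.2 p.1.2.snd)⟩ : TotalSpace ℂ A)

section System

variable {G X : Type*} [TopologicalSpace G] [TopologicalSpace X] {𝓖 : TopGroupoid G X}
  {A : X → Type*} [∀ x, NonUnitalCStarAlgebra (A x)] [TopologicalSpace (TotalSpace ℂ A)]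

/-- `f ∈ Γ_c(G, r^*𝒜)`: a continuous compactly supported section of the pullback bundle. -/
def IsCompactSection (𝓖 : TopGroupoid G X) (f : ∀ γ, A (𝓖.r γ)) : Prop :=
  (Continuous fun γ => (⟨𝓖.r γ, f γ⟩ : TotalSpace ℂ A)) ∧ IsCompact (closure {γ | f γ ≠ 0})

open Classical in
/-- A section `F` of `r^*𝒜`, restricted to the range fibre over `u` and extended by zero, as an
`A(u)`-valued function on `G`. -/
noncomputable def onFibre (𝓖 : TopGroupoid G X) (F : ∀ γ, A (𝓖.r γ)) (u : X) (γ : G) : A u :=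
  if h : 𝓖.r γ = u then fibreCast h (F γ) else 0

variable [MeasurableSpace G]

/-- The section `F` of `r^*𝒜` is integrable: its norm function is measurable and has finite
`I`-norm. -/
def IsIIntegrable (haar : HaarSystem 𝓖) (F : ∀ γ, A (𝓖.r γ)) : Prop :=
  Measurable (fun γ => ‖F γ‖) ∧
    max (⨆ u, ∫⁻ γ, ‖F γ‖ₑ ∂haar.coMeasure u) (⨆ u, ∫⁻ γ, ‖F γ‖ₑ ∂haar.μ u) < ∞

namespace GroupoidAction

variable (haar : HaarSystem 𝓖) (S : GroupoidAction 𝓖 A)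

/-- The averaging map `λ(a)(u) = ∫ α_γ(a(s γ)) dλ^u(γ)`. -/
noncomputable def averaging (a : ∀ x, A x) (u : X) : A u :=
  ∫ γ, onFibre 𝓖 (fun γ => S.α γ (a (𝓖.s γ))) u γ ∂haar.μ u

/-- `f ∈ Ind_G^{G⁰}(𝒜, α)`: a bounded continuous section with `f(u) = α_γ⁻¹(f(γ · u))` whose norm
vanishes at infinity on the orbit space. -/
def IsInduced (f : ∀ x, A x) : Prop :=
  IsContSection f ∧ (∃ C : ℝ, ∀ x, ‖f x‖ ≤ C) ∧
    (∀ γ, f (𝓖.s γ) = (S.α γ).symm (f (𝓖.r γ))) ∧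
    ∀ ε : ℝ, 0 < ε → ∃ K : Set 𝓖.OrbitSpace, IsCompact K ∧
      ∀ u : X, (Quotient.mk 𝓖.orbitSetoid u) ∉ K → ‖f u‖ < ε

variable [IsUSCCStarBundle A]

/-- `⟨a, b⟩_E (γ) = a(r γ) α_γ(b(s γ)^*)`, a section of `r^*𝒜`. -/
noncomputable def innerE (a b : SectionAlgebra A) (γ : G) : A (𝓖.r γ) :=
  a (𝓖.r γ) * S.α γ (star (b (𝓖.s γ)))

/-- `d` is `α`-invariant: `ᾱ_γ(d(s γ)) = d(r γ)` for all `γ`. -/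
def IsInvariant (d : 𝓜(ℂ, SectionAlgebra A)) : Prop :=
  ∃ m : ∀ u, 𝓜(ℂ, A u), IsFibresOf d m ∧ ∀ γ, multiplierMap (S.α γ) (m (𝓖.s γ)) = m (𝓖.r γ)

/-- `M(A₀)^α = {d ∈ M(A) : A₀ d ⊆ A₀, d is α-invariant}`. -/
def fixedMultipliers (A₀ : NonUnitalStarSubalgebra ℂ (SectionAlgebra A)) :
    Set 𝓜(ℂ, SectionAlgebra A) :=
  {d | (∀ c ∈ A₀, d.snd c ∈ A₀) ∧ S.IsInvariant d}

/-- `d` is an element of `M(A₀)^α` with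
`(c d)(u) = ∫ c(r γ) α_γ((a^* b)(s γ)) dλ^u(γ)` for all `c ∈ A₀` and all units `u`, the integrals
being convergent. -/
def IsInnerD (A₀ : NonUnitalStarSubalgebra ℂ (SectionAlgebra A)) (a b : SectionAlgebra A)
    (d : 𝓜(ℂ, SectionAlgebra A)) : Prop :=
  d ∈ S.fixedMultipliers A₀ ∧ ∀ c ∈ A₀, ∀ u,
    Integrable (onFibre 𝓖 (fun γ => c (𝓖.r γ) * S.α γ ((star a * b) (𝓖.s γ))) u) (haar.μ u) ∧
    d.snd c u =
      ∫ γ, onFibre 𝓖 (fun γ => c (𝓖.r γ) * S.α γ ((star a * b) (𝓖.s γ))) u γ ∂haar.μ u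

/-- The dynamical system is proper with respect to the dense `⋆`-subalgebra `A₀`. -/
structure IsProperWith (A₀ : NonUnitalStarSubalgebra ℂ (SectionAlgebra A)) : Prop where
  dense : Dense (A₀ : Set (SectionAlgebra A))
  integrable : ∀ a ∈ A₀, ∀ b ∈ A₀, IsIIntegrable haar (S.innerE a b)
  existsUnique_innerD : ∀ a ∈ A₀, ∀ b ∈ A₀, ∃! d, S.IsInnerD haar A₀ a b d

end GroupoidAction

end System

/-! ### Borel Hilbert bundles and their spaces of square integrable sections -/

/-- A Borel Hilbert bundle over `X`, given by its fibres and a fundamental sequence of sections,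
which determines the Borel structure. -/
structure BorelHilbertBundle (X : Type*) [MeasurableSpace X] where
  fibre : X → Type
  [normed : ∀ x, NormedAddCommGroup (fibre x)]
  [innerProduct : ∀ x, InnerProductSpace ℂ (fibre x)]
  [complete : ∀ x, CompleteSpace (fibre x)]
  seq : ℕ → ∀ x, fibre x
  measurable_inner_seq : ∀ n m, Measurable fun x => inner ℂ (seq n x) (seq m x)
  dense_span : ∀ x, Dense (Submodule.span ℂ (Set.range fun n => seq n x) : Set (fibre x))

attribute [instance] BorelHilbertBundle.normed BorelHilbertBundle.innerProduct
  BorelHilbertBundle.complete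

namespace BorelHilbertBundle

variable {X : Type*} [MeasurableSpace X] (H : BorelHilbertBundle X)

/-- Borel sections. -/
def IsBorelSection (h : ∀ x, H.fibre x) : Prop :=
  ∀ n, Measurable fun x => inner ℂ (H.seq n x) (h x)

/-- The pullback of a Borel Hilbert bundle along a Borel map. -/
def pullback {Y : Type*} [MeasurableSpace Y] (f : Y → X) (hf : Measurable f) :
    BorelHilbertBundle Y where
  fibre := fun y => H.fibre (f y)
  seq := fun n y => H.seq n (f y)
  measurable_inner_seq := fun n m => (H.measurable_inner_seq n m).comp hf
  dense_span := fun y => H.dense_span (f y)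

theorem IsBorelSection.add {h k : ∀ x, H.fibre x} (hh : H.IsBorelSection h)
    (hk : H.IsBorelSection k) : H.IsBorelSection fun x => h x + k x := fun n => by
  simp only [inner_add_right]
  exact (hh n).add (hk n)

theorem IsBorelSection.smul {h : ∀ x, H.fibre x} (c : ℂ) (hh : H.IsBorelSection h) :
    H.IsBorelSection fun x => c • h x := fun n => by
  simpa only [inner_smul_right] using (hh n).const_mul c

theorem isBorelSection_zero : H.IsBorelSection fun _ => 0 := fun n => by
  simpa only [inner_zero_right] using measurable_const

/-- Finite combinations of the fundamental sequence with rational complex coefficients. -/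
noncomputable def ratComb (c : ℕ →₀ (ℚ × ℚ)) (x : X) : H.fibre x :=
  c.sum fun i q => ((q.1 : ℂ) + (q.2 : ℂ) * Complex.I) • H.seq i x

theorem dense_ratComb (x : X) : Dense (Set.range fun c => H.ratComb c x) := by
  classical
  have hadd : ∀ c d, H.ratComb (c + d) x = H.ratComb c x + H.ratComb d x := fun c d => by
    unfold ratComb
    refine Finsupp.sum_add_index' (fun i => by simp) fun i p q => ?_
    rw [← add_smul]
    congr 1
    simp only [Prod.fst_add, Prod.snd_add]
    push_cast
    ring
  let S : AddSubmonoid (H.fibre x) :=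
    { carrier := Set.range fun c => H.ratComb c x
      zero_mem' := ⟨0, by simp [ratComb]⟩
      add_mem' := by
        rintro _ _ ⟨c, rfl⟩ ⟨d, rfl⟩
        exact ⟨c + d, hadd c d⟩ }
  have hq : Dense (Set.range fun q : ℚ × ℚ => ((q.1 : ℂ) + (q.2 : ℂ) * Complex.I)) := by
    have h1 : DenseRange fun q : ℚ × ℚ => (((q.1 : ℝ), (q.2 : ℝ)) : ℝ × ℝ) :=
      DenseRange.prodMap Rat.isDenseEmbedding_coe_real.dense Rat.isDenseEmbedding_coe_real.dense
    have h2 := Complex.equivRealProdCLM.symm.surjective.denseRange.comp h1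
      Complex.equivRealProdCLM.symm.continuous
    refine h2.mono ?_
    rintro _ ⟨q, rfl⟩
    exact ⟨q, by simp [Complex.ext_iff]⟩
  have hsm : ∀ (z : ℂ) (n : ℕ), z • H.seq n x ∈ S.topologicalClosure := fun z n => by
    refine map_mem_closure (f := fun z : ℂ => z • H.seq n x) (by fun_prop) (hq z) ?_
    rintro _ ⟨q, rfl⟩
    exact ⟨Finsupp.single n q, by simp [ratComb]⟩
  have hspan : ∀ v ∈ Submodule.span ℂ (Set.range fun n => H.seq n x),
      v ∈ S.topologicalClosure := by
    intro v hv
    obtain ⟨c, rfl⟩ := (Finsupp.mem_span_range_iff_exists_finsupp).1 hv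
    exact AddSubmonoid.sum_mem _ fun n _ => hsm _ n
  intro v
  exact closure_minimal hspan isClosed_closure (H.dense_span x v)

theorem IsBorelSection.norm {h : ∀ x, H.fibre x} (hh : H.IsBorelSection h) :
    Measurable fun x => ‖h x‖ := by
  have hb : ∀ c, H.IsBorelSection (H.ratComb c) := fun c n => by
    simp only [ratComb, Finsupp.sum, inner_sum, inner_smul_right]
    exact Finset.measurable_fun_sum _ fun i _ => (H.measurable_inner_seq n i).const_mul _
  have hin : ∀ (c) {k : ∀ x, H.fibre x}, H.IsBorelSection k →
      Measurable fun x => inner ℂ (H.ratComb c x) (k x) := fun c k hk => by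
    simp only [ratComb, Finsupp.sum, sum_inner, inner_smul_left]
    exact Finset.measurable_fun_sum _ fun i _ => (hk i).const_mul _
  have hn : ∀ c, Measurable fun x => ‖H.ratComb c x‖ := fun c => by
    have : (fun x => ‖H.ratComb c x‖) =
        fun x => Real.sqrt (RCLike.re (inner ℂ (H.ratComb c x) (H.ratComb c x))) := by
      funext x
      exact norm_eq_sqrt_re_inner _
    rw [this]
    exact (RCLike.measurable_re.comp (hin c (hb c))).sqrt
  have key : ∀ x, ENNReal.ofReal ‖h x‖ = ⨆ c, ENNReal.ofReal
      (‖(inner ℂ (H.ratComb c x) (h x) : ℂ)‖ / ‖H.ratComb c x‖) := by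
    intro x
    refine le_antisymm ?_ (iSup_le fun c => ENNReal.ofReal_le_ofReal ?_)
    · by_cases h0 : h x = 0
      · simp [h0]
      refine le_of_forall_lt fun t ht => ?_
      have hc : ContinuousAt (fun v : H.fibre x =>
          ENNReal.ofReal (‖(inner ℂ v (h x) : ℂ)‖ / ‖v‖)) (h x) := by
        refine ENNReal.continuous_ofReal.continuousAt.comp ?_
        refine ContinuousAt.div ?_ continuousAt_id.norm (norm_ne_zero_iff.2 h0)
        exact (continuousAt_id.inner continuousAt_const).norm
      have hv : ENNReal.ofReal (‖(inner ℂ (h x) (h x) : ℂ)‖ / ‖h x‖) = ENNReal.ofReal ‖h x‖ := by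
        rw [inner_self_eq_norm_sq_to_K, norm_pow, RCLike.norm_ofReal, abs_norm, sq,
          mul_div_cancel_right₀ _ (norm_ne_zero_iff.2 h0)]
      have hev := hc.eventually (lt_mem_nhds (hv.symm ▸ ht))
      obtain ⟨_, ⟨c, rfl⟩, hv⟩ := (H.dense_ratComb x).exists_mem_open isOpen_interior
        ⟨h x, mem_interior_iff_mem_nhds.2 hev⟩
      have hlt := interior_subset hv
      exact lt_of_lt_of_le hlt (le_iSup (fun c => ENNReal.ofReal
        (‖(inner ℂ (H.ratComb c x) (h x) : ℂ)‖ / ‖H.ratComb c x‖)) c)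
    · refine div_le_of_le_mul₀ (norm_nonneg _) (norm_nonneg _) ?_
      rw [mul_comm]
      exact norm_inner_le_norm _ _
  have hm : Measurable fun x => ENNReal.ofReal ‖h x‖ := by
    simp only [key]
    exact Measurable.iSup fun c => ((hin c hh).norm.div (hn c)).ennreal_ofReal
  simpa using hm.ennreal_toReal

theorem IsBorelSection.inner {h k : ∀ x, H.fibre x} (hh : H.IsBorelSection h)
    (hk : H.IsBorelSection k) : Measurable fun x => (Inner.inner ℂ (h x) (k x) : ℂ) := by
  have hN : ∀ c : ℂ, Measurable fun x => ‖h x + c • k x‖ := fun c =>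
    (hh.add H (hk.smul H c)).norm H
  have heq : (fun x => (Inner.inner ℂ (h x) (k x) : ℂ)) = fun x =>
      ((‖h x + (1 : ℂ) • k x‖ : ℂ) ^ 2 - (‖h x + (-1 : ℂ) • k x‖ : ℂ) ^ 2 +
        ((‖h x + (-Complex.I) • k x‖ : ℂ) ^ 2 - (‖h x + Complex.I • k x‖ : ℂ) ^ 2) * Complex.I) / 4 := by
    funext x
    rw [inner_eq_sum_norm_sq_div_four]
    simp [sub_eq_add_neg]
  rw [heq]
  have hC : ∀ c : ℂ, Measurable fun x => (‖h x + c • k x‖ : ℂ) ^ 2 := fun c =>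
    (Complex.measurable_ofReal.comp (hN c)).pow_const 2
  exact (((hC _).sub (hC _)).add (((hC _).sub (hC _)).mul_const _)).div_const _

/-- The square integrable Borel sections. -/
def sqIntegrable (μ : Measure X) : Submodule ℂ (∀ x, H.fibre x) where
  carrier := {h | H.IsBorelSection h ∧ ∫⁻ x, ‖h x‖ₑ ^ 2 ∂μ < ∞}
  zero_mem' := ⟨H.isBorelSection_zero, by simp⟩
  add_mem' := by
    rintro h k ⟨hh, hh2⟩ ⟨hk, hk2⟩
    refine ⟨hh.add H hk, ?_⟩
    have hm : ∀ {h : ∀ x, H.fibre x}, H.IsBorelSection h → Measurable fun x => ‖h x‖ₑ :=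
      fun {h} hh => by simpa only [ofReal_norm] using (hh.norm H).ennreal_ofReal
    have hle : ∀ x, ‖(h + k) x‖ₑ ^ 2 ≤ 2 * ‖h x‖ₑ ^ 2 + 2 * ‖k x‖ₑ ^ 2 := fun x => by
      have h1 : ‖(h + k) x‖ₑ ≤ ‖h x‖ₑ + ‖k x‖ₑ := enorm_add_le _ _
      refine (pow_le_pow_left' h1 2).trans ?_
      have h2 := ENNReal.rpow_add_le_mul_rpow_add_rpow ‖h x‖ₑ ‖k x‖ₑ (p := 2) (by norm_num)
      rw [← mul_add]
      norm_num at h2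
      exact h2
    refine (lintegral_mono hle).trans_lt ?_
    rw [lintegral_add_left (((hm hh).pow_const 2).const_mul 2),
      lintegral_const_mul _ ((hm hh).pow_const 2), lintegral_const_mul _ ((hm hk).pow_const 2)]
    exact ENNReal.add_lt_top.2 ⟨ENNReal.mul_lt_top (by simp) hh2, ENNReal.mul_lt_top (by simp) hk2⟩
  smul_mem' := by
    rintro c h ⟨hh, hh2⟩
    refine ⟨hh.smul H c, ?_⟩
    simp only [Pi.smul_apply, enorm_smul, mul_pow]
    rw [lintegral_const_mul' _ _ (by finiteness)]
    exact ENNReal.mul_lt_top (by finiteness) hh2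

/-- The space of square integrable Borel sections, carrying the `L²`-seminorm. -/
def PreL2 (μ : Measure X) : Type _ := H.sqIntegrable μ

namespace PreL2

variable {H} {μ : Measure X}

instance : AddCommGroup (H.PreL2 μ) := inferInstanceAs (AddCommGroup (H.sqIntegrable μ))

instance : Module ℂ (H.PreL2 μ) := inferInstanceAs (Module ℂ (H.sqIntegrable μ))

/-- The underlying section. -/
def toSection (h : H.PreL2 μ) : ∀ x, H.fibre x := Subtype.val h

theorem integrable_inner (h k : H.PreL2 μ) :
    Integrable (fun x => (inner ℂ (h.toSection x) (k.toSection x) : ℂ)) μ := by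
  have hm : ∀ h : H.PreL2 μ, MemLp (fun x => ‖h.toSection x‖) 2 μ := fun h => by
    have hh : Measurable fun x => ‖h.toSection x‖ := h.2.1.norm H
    refine ⟨hh.aestronglyMeasurable, ?_⟩
    rw [eLpNorm_lt_top_iff_lintegral_rpow_enorm_lt_top (by simp) (by simp)]
    simpa [toSection] using h.2.2
  exact ((hm h).integrable_mul (hm k)).mono' (h.2.1.inner H k.2.1).aestronglyMeasurable
    (ae_of_all _ fun x => norm_inner_le_norm _ _)

/-- The inner product `⟨h, k⟩ = ∫ ⟨h x, k x⟩ dμ(x)`. -/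
@[reducible] noncomputable def core : PreInnerProductSpace.Core ℂ (H.PreL2 μ) where
  inner h k := ∫ x, inner ℂ (h.toSection x) (k.toSection x) ∂μ
  conj_inner_symm h k := by
    rw [← integral_conj]
    simp only [inner_conj_symm]
  re_inner_nonneg h := by
    rw [← integral_re (integrable_inner h h)]
    exact integral_nonneg fun x => inner_self_nonneg
  add_left h k l := by
    rw [← integral_add (integrable_inner h l) (integrable_inner k l)]
    exact integral_congr_ae (ae_of_all _ fun x => inner_add_left _ _ _)
  smul_left h k c := by
    rw [← integral_const_mul]
    exact integral_congr_ae (ae_of_all _ fun x => inner_smul_left _ _ _)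

noncomputable instance : SeminormedAddCommGroup (H.PreL2 μ) :=
  InnerProductSpace.Core.toSeminormedAddCommGroup (c := core)

noncomputable instance : InnerProductSpace ℂ (H.PreL2 μ) := InnerProductSpace.ofCore core

end PreL2

/-- The Hilbert space `L²(X * ℌ, μ)`: square integrable Borel sections modulo almost everywhere
equality. -/
def L2 (μ : Measure X) : Type _ := SeparationQuotient (H.PreL2 μ)

namespace L2

variable {H} {μ : Measure X}

noncomputable instance : NormedAddCommGroup (H.L2 μ) :=
  inferInstanceAs (NormedAddCommGroup (SeparationQuotient (H.PreL2 μ)))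

noncomputable instance : InnerProductSpace ℂ (H.L2 μ) :=
  inferInstanceAs (InnerProductSpace ℂ (SeparationQuotient (H.PreL2 μ)))

/-- The class of a square integrable section. -/
noncomputable def mk (h : H.PreL2 μ) : H.L2 μ := SeparationQuotient.mk h

end L2

end BorelHilbertBundle

/-! ### Regular representations and the reduced crossed product -/

section CrossedProduct

variable {G X : Type*} [TopologicalSpace G] [TopologicalSpace X] [MeasurableSpace G] [BorelSpace G]
  [MeasurableSpace X] [BorelSpace X] {𝓖 : TopGroupoid G X}
  {A : X → Type*} [∀ x, NonUnitalCStarAlgebra (A x)] [TopologicalSpace (TotalSpace ℂ A)]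
  [IsUSCCStarBundle A]

variable (A) in
/-- A separable `C₀(X)`-linear representation `π = ∫ π_u dμ(u)` of the section algebra, in
disintegrated form: a Borel Hilbert bundle, a finite Borel measure on `X`, and a Borel family of
nondegenerate representations `π_u` of the fibres `A(u)`.  (Every separable `C₀(X)`-linear
representation is unitarily equivalent to one of this form.) -/
structure BundleRep where
  H : BorelHilbertBundle X
  μ : Measure X
  finite_measure : IsFiniteMeasure μ
  rep : ∀ u, A u →⋆ₙₐ[ℂ] (H.fibre u →L[ℂ] H.fibre u)
  borel : ∀ (a : SectionAlgebra A) (n m : ℕ),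
    Measurable fun u => inner ℂ (H.seq n u) (rep u (a u) (H.seq m u))
  nondegenerate : ∀ u,
    Dense (Submodule.span ℂ {ξ | ∃ a η, rep u a η = ξ} : Set (H.fibre u))

namespace BundleRep

variable (haar : HaarSystem 𝓖) (ρ : BundleRep A)

/-- The pullback Hilbert bundle along the source map, with fibres `H(s γ)`. -/
def sourceBundle (𝓖 : TopGroupoid G X) (ρ : BundleRep A) : BorelHilbertBundle G :=
  ρ.H.pullback 𝓖.s 𝓖.continuous_s.measurable

/-- The square integrable sections of the pullback bundle with respect to `ν⁻¹`. -/
abbrev Sections : Type _ := (ρ.sourceBundle 𝓖).PreL2 (haar.nuInv ρ.μ)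

/-- The Hilbert space `L²(G *_s ℌ, ν⁻¹)`. -/
abbrev L2 : Type _ := (ρ.sourceBundle 𝓖).L2 (haar.nuInv ρ.μ)

end BundleRep

/-- The C⋆-algebra of bounded families of operators on the spaces `L²(G *_s ℌ, ν⁻¹)` of all
regular representations, with the supremum of the operator norms. -/
abbrev RegularOperators (haar : HaarSystem 𝓖) (A : X → Type*) [∀ x, NonUnitalCStarAlgebra (A x)]
    [TopologicalSpace (TotalSpace ℂ A)] [IsUSCCStarBundle A] : Type _ :=
  lp (fun ρ : BundleRep A => ρ.L2 haar →L[ℂ] ρ.L2 haar) ∞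

namespace GroupoidAction

variable (haar : HaarSystem 𝓖) (S : GroupoidAction 𝓖 A)

open Classical in
/-- The integrand `π_{s γ}(α_γ⁻¹(f(η))) h(η⁻¹γ)`, for `η` with `r η = r γ`. -/
noncomputable def regularIntegrand (ρ : BundleRep A) (f : ∀ γ, A (𝓖.r γ))
    (h : ∀ γ, ρ.H.fibre (𝓖.s γ)) (γ η : G) : ρ.H.fibre (𝓖.s γ) :=
  if hη : 𝓖.r η = 𝓖.r γ then
    ρ.rep (𝓖.s γ) ((S.α γ).symm (fibreCast hη (f η)))
      (fibreCast (𝓖.s_mul (𝓖.inv η) γ ((𝓖.s_inv η).trans hη))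
        (h (𝓖.mul (𝓖.inv η) γ ((𝓖.s_inv η).trans hη))))
  else 0

/-- `T` is the operator `Ind π (f)`:
`(T h)(γ) = ∫ π_{s γ}(α_γ⁻¹(f(η))) h(η⁻¹γ) dλ^{r γ}(η)` for `ν⁻¹`-almost every `γ`. -/
def IsInducedOperator (ρ : BundleRep A) (f : ∀ γ, A (𝓖.r γ)) (T : ρ.L2 haar →L[ℂ] ρ.L2 haar) :
    Prop :=
  ∀ h : ρ.Sections haar, ∃ k : ρ.Sections haar,
    T (BorelHilbertBundle.L2.mk h) = BorelHilbertBundle.L2.mk k ∧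
    ∀ᵐ γ ∂haar.nuInv ρ.μ,
      Integrable (S.regularIntegrand ρ f h.toSection γ) (haar.μ (𝓖.r γ)) ∧
      k.toSection γ = ∫ η, S.regularIntegrand ρ f h.toSection γ η ∂haar.μ (𝓖.r γ)

/-- `T = (Ind π (f))_π` is the image of the section `f` under all regular representations; its
norm is the reduced norm `‖f‖_r`. -/
def IsRegularImage (f : ∀ γ, A (𝓖.r γ)) (T : RegularOperators haar A) : Prop :=
  ∀ ρ, S.IsInducedOperator haar ρ f (T ρ)

/-- The reduced crossed product `𝒜 ⋊_{α,r} G`: the completion of `Γ_c(G, r^*𝒜)` in the reduced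
norm, realized as the closure of its image under the product of all regular representations.
(These are representations of the convolution algebra, so the product of the completion is the
composition of operators.) -/
def reducedCrossedProduct : Set (RegularOperators haar A) :=
  closure {T | ∃ f, IsCompactSection 𝓖 f ∧ S.IsRegularImage haar f T}

/-- `E`, the closure of the linear span of the elements `⟨a, b⟩_E` with `a, b ∈ A₀`. -/
noncomputable def closedSpanInnerE (A₀ : NonUnitalStarSubalgebra ℂ (SectionAlgebra A)) :
    Submodule ℂ (RegularOperators haar A) :=
  (Submodule.span ℂ
    {T | ∃ a ∈ A₀, ∃ b ∈ A₀, S.IsRegularImage haar (S.innerE a b) T}).topologicalClosure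

end GroupoidAction

end CrossedProduct

/-!
The proof has three layers.

*Continuous sections.* No continuous sections are given with the bundle, only an open projection, so
they have to be produced first (`exists_sectionAlgebra_norm_sub_lt`). A section that runs inside a
thin open subset of the total space is continuous up to a small error; a partition of unity turns a
section that is continuous up to `ε` into one that is continuous up to `δ` and at most `ε` away
(`IsApproxContinuousAt.exists_improvement`), and the successive corrections converge uniformly on a
compact set. With enough sections, a compactly supported continuous section `f` of `r^*𝒜` is
uniformly close to finite sums `∑ φᵢ(γ) aᵢ(r γ)`, so `u ↦ ∫ f dλ^u` is a continuous section
(`isContSection_integral`).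

*Averages.* Properness of `G` makes `γ ↦ α_γ(a(s γ))` compactly supported over compact sets of units
when `a ∈ A₀`, and `⟨a, b⟩_E` compactly supported outright. Hence averages are continuous; they are
invariant by left invariance of the Haar system, and bounded and vanishing at infinity on the orbit
space because their norm is constant on orbits and zero off the orbits that meet the support of `a`
(`isInduced_averaging`). Multiplication by `λ(a^* b)` is then the multiplier `⟨a, b⟩_D`. It is
unique because the formula prescribes `c · ⟨a, b⟩_D` for all `c` in a dense set.

*The crossed product.* The substitution `η = γζ` writes `Ind π (f)` as
`h ↦ (γ ↦ ∫ π_u(α_γ⁻¹(f(γζ))) h(ζ⁻¹) dλ^u(ζ))` with `u = s γ`, which involves a single fibre of the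
Hilbert bundle. Schur's test over each unit bounds it by the `I`-norm of `f`
(`HaarSystem.lintegral_sq_convolution_le`), independently of `π`; this gives the operators and their
product over all `π` (`existsUnique_isRegularImage`). For `f = ⟨a, b⟩_E` the kernel splits as
`α_γ⁻¹(a(r γ)) α_ζ(b(s ζ)^*)`, so `Ind π (f)` has rank one over each unit, in the sense of
`regularSection_innerE`. It follows that
`f * ⟨a, b⟩_E = ⟨c, b⟩_E` with `c(u) = ∫ f(η) α_η(a(s η)) dλ^u(η)` and, by Fubini's theorem,
`⟨a, b⟩_E * f = ⟨a, c⟩_E` with `c(u)^* = ∫ α_ζ(b(s ζ)^* f(ζ⁻¹)) dλ^u(ζ)`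
(`exists_mul_innerE`, `exists_innerE_mul`). Both sections `c` are again in `A₀`, so
multiplication by the image of `Γ_c(G, r^*𝒜)` preserves the span of the `⟨a, b⟩_E`, and passing to
closures shows that `E` is an ideal.

Equalities of fibres over equal base points are handled by `toFibre`, which moves an element to
another fibre and is zero unless the base points agree, and by the total operations `cmul`
and `act`, which agree with the product and the action where these are defined.
-/

set_option linter.unusedSectionVars false

/-! ### Topology of upper semicontinuous bundles -/

section BundleTopology

variable {X Y : Type*} [TopologicalSpace X] {A : X → Type*} [∀ x, NonUnitalCStarAlgebra (A x)]
  [TopologicalSpace (TotalSpace ℂ A)]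

theorem mk_fibreCast {X : Type*} {E : X → Type*} {x y : X} (h : x = y) (a : E x) :
    (⟨y, fibreCast h a⟩ : TotalSpace ℂ E) = ⟨x, a⟩ := by
  subst h; rfl

theorem mk_injective {X : Type*} {E : X → Type*} {x : X} {a b : E x}
    (h : (⟨x, a⟩ : TotalSpace ℂ E) = ⟨x, b⟩) : a = b := by
  cases h; rfl

variable [IsUSCCStarBundle A] {l : Filter Y} {q : Y → X} {B C : ∀ y, A (q y)} {x : X} {b c : A x}

theorem Bundle.tendsto_proj_of_mk
    (h : Tendsto (fun y => (⟨q y, B y⟩ : TotalSpace ℂ A)) l (𝓝 ⟨x, b⟩)) : Tendsto q l (𝓝 x) :=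
  ((IsUSCCStarBundle.continuous_proj (A := A)).tendsto _).comp h

theorem Bundle.tendsto_add (hB : Tendsto (fun y => (⟨q y, B y⟩ : TotalSpace ℂ A)) l (𝓝 ⟨x, b⟩))
    (hC : Tendsto (fun y => (⟨q y, C y⟩ : TotalSpace ℂ A)) l (𝓝 ⟨x, c⟩)) :
    Tendsto (fun y => (⟨q y, B y + C y⟩ : TotalSpace ℂ A)) l (𝓝 ⟨x, b + c⟩) := by
  refine ((IsUSCCStarBundle.continuous_add (A := A)).tendsto ⟨(⟨x, b⟩, ⟨x, c⟩), rfl⟩).comp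
    (f := fun y => ⟨(⟨q y, B y⟩, ⟨q y, C y⟩), rfl⟩) ?_
  rw [nhds_subtype_eq_comap, tendsto_comap_iff]
  exact hB.prodMk_nhds hC

theorem Bundle.tendsto_mul (hB : Tendsto (fun y => (⟨q y, B y⟩ : TotalSpace ℂ A)) l (𝓝 ⟨x, b⟩))
    (hC : Tendsto (fun y => (⟨q y, C y⟩ : TotalSpace ℂ A)) l (𝓝 ⟨x, c⟩)) :
    Tendsto (fun y => (⟨q y, B y * C y⟩ : TotalSpace ℂ A)) l (𝓝 ⟨x, b * c⟩) := by
  refine ((IsUSCCStarBundle.continuous_mul (A := A)).tendsto ⟨(⟨x, b⟩, ⟨x, c⟩), rfl⟩).comp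
    (f := fun y => ⟨(⟨q y, B y⟩, ⟨q y, C y⟩), rfl⟩) ?_
  rw [nhds_subtype_eq_comap, tendsto_comap_iff]
  exact hB.prodMk_nhds hC

theorem Bundle.tendsto_const_smul (k : ℂ)
    (hB : Tendsto (fun y => (⟨q y, B y⟩ : TotalSpace ℂ A)) l (𝓝 ⟨x, b⟩)) :
    Tendsto (fun y => (⟨q y, k • B y⟩ : TotalSpace ℂ A)) l (𝓝 ⟨x, k • b⟩) :=
  ((IsUSCCStarBundle.continuous_smul (A := A) k).tendsto ⟨x, b⟩).comp hB

theorem Bundle.tendsto_sub (hB : Tendsto (fun y => (⟨q y, B y⟩ : TotalSpace ℂ A)) l (𝓝 ⟨x, b⟩))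
    (hC : Tendsto (fun y => (⟨q y, C y⟩ : TotalSpace ℂ A)) l (𝓝 ⟨x, c⟩)) :
    Tendsto (fun y => (⟨q y, B y - C y⟩ : TotalSpace ℂ A)) l (𝓝 ⟨x, b - c⟩) := by
  have h := tendsto_add hB (tendsto_const_smul (-1) hC)
  simpa [sub_eq_add_neg] using h

/-- A net of fibre elements whose base points converge and whose norms tend to zero converges to
the zero of the limit fibre. -/
theorem Bundle.tendsto_zero (hq : Tendsto q l (𝓝 x)) (hB : Tendsto (fun y => ‖B y‖) l (𝓝 0)) :
    Tendsto (fun y => (⟨q y, B y⟩ : TotalSpace ℂ A)) l (𝓝 ⟨x, 0⟩) := by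
  refine Tendsto.mono_right ?_ (IsUSCCStarBundle.tendsto_zero (A := A) x)
  rw [tendsto_comap_iff]
  exact hq.prodMk_nhds hB

/-- Upper semicontinuity of the norm along a convergent family. -/
theorem Bundle.eventually_norm_lt
    (hB : Tendsto (fun y => (⟨q y, B y⟩ : TotalSpace ℂ A)) l (𝓝 ⟨x, b⟩)) {ε : ℝ} (h : ‖b‖ < ε) :
    ∀ᶠ y in l, ‖B y‖ < ε :=
  hB.eventually ((IsUSCCStarBundle.norm_usc (A := A) ε
    ((norm_nonneg b).trans_lt h)).mem_nhds (show ‖b‖ < ε from h))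

/-- Scalar multiplication on the total space is jointly continuous. -/
theorem Bundle.tendsto_smul {φ : Y → ℂ} {k : ℂ} (hφ : Tendsto φ l (𝓝 k))
    (hB : Tendsto (fun y => (⟨q y, B y⟩ : TotalSpace ℂ A)) l (𝓝 ⟨x, b⟩)) :
    Tendsto (fun y => (⟨q y, φ y • B y⟩ : TotalSpace ℂ A)) l (𝓝 ⟨x, k • b⟩) := by
  have h0 : Tendsto (fun y => (⟨q y, (φ y - k) • B y⟩ : TotalSpace ℂ A)) l (𝓝 ⟨x, 0⟩) := by
    refine tendsto_zero (tendsto_proj_of_mk hB) ?_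
    have h1 : Tendsto (fun y => ‖φ y - k‖ * (‖b‖ + 1)) l (𝓝 0) := by
      have : Tendsto (fun y => φ y - k) l (𝓝 0) := by simpa using hφ.sub_const k
      simpa using this.norm.mul_const (‖b‖ + 1)
    refine squeeze_zero' (Eventually.of_forall fun _ => norm_nonneg _) ?_ h1
    filter_upwards [eventually_norm_lt hB (lt_add_one ‖b‖)] with y hy
    rw [norm_smul]
    gcongr
  have h := tendsto_add (tendsto_const_smul k hB) h0
  simpa [← add_smul] using h

theorem Bundle.tendsto_sum {ι : Type*} (t : Finset ι) {B : ι → ∀ y, A (q y)} {b : ι → A x}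
    (hq : Tendsto q l (𝓝 x))
    (hB : ∀ i ∈ t, Tendsto (fun y => (⟨q y, B i y⟩ : TotalSpace ℂ A)) l (𝓝 ⟨x, b i⟩)) :
    Tendsto (fun y => (⟨q y, ∑ i ∈ t, B i y⟩ : TotalSpace ℂ A)) l (𝓝 ⟨x, ∑ i ∈ t, b i⟩) := by
  classical
  induction t using Finset.induction_on with
  | empty =>
    simpa using tendsto_zero (B := fun y => (0 : A (q y))) hq (by simp [tendsto_const_nhds])
  | insert i t hi ih =>
    simp only [Finset.sum_insert hi]
    exact tendsto_add (hB i (Finset.mem_insert_self _ _))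
      (ih fun j hj => hB j (Finset.mem_insert_of_mem hj))

/-- The topology that the total space induces on a fibre is the norm topology. -/
theorem Bundle.tendsto_fibre_iff {f : Y → A x} :
    Tendsto (fun y => (⟨x, f y⟩ : TotalSpace ℂ A)) l (𝓝 ⟨x, b⟩) ↔ Tendsto f l (𝓝 b) := by
  constructor
  · intro h
    have hc : Tendsto (fun _ : Y => (⟨x, b⟩ : TotalSpace ℂ A)) l (𝓝 ⟨x, b⟩) := tendsto_const_nhds
    have h1 := tendsto_sub h hc
    rw [tendsto_iff_norm_sub_tendsto_zero, Metric.tendsto_nhds]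
    intro ε hε
    filter_upwards [eventually_norm_lt h1 (ε := ε) (by simpa using hε)] with y hy
    simpa using hy
  · intro h
    have h1 : Tendsto (fun y => (⟨x, f y - b⟩ : TotalSpace ℂ A)) l (𝓝 ⟨x, 0⟩) :=
      tendsto_zero tendsto_const_nhds (tendsto_iff_norm_sub_tendsto_zero.1 h)
    have hc : Tendsto (fun _ : Y => (⟨x, b⟩ : TotalSpace ℂ A)) l (𝓝 ⟨x, b⟩) := tendsto_const_nhds
    simpa using tendsto_add h1 hc

/-- Every neighbourhood of a point of the total space contains a smaller neighbourhood together
with all fibre elements that are uniformly close to it. -/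
theorem Bundle.exists_nhds_thickening {W : Set (TotalSpace ℂ A)}
    (hW : W ∈ 𝓝 (⟨x, b⟩ : TotalSpace ℂ A)) :
    ∃ W' ∈ 𝓝 (⟨x, b⟩ : TotalSpace ℂ A), ∃ δ > 0, ∀ (y : X) (c d : A y),
      (⟨y, c⟩ : TotalSpace ℂ A) ∈ W' → ‖d - c‖ < δ → (⟨y, d⟩ : TotalSpace ℂ A) ∈ W := by
  let p : (Σ y, A y × A y) → X := fun z => z.1
  let l : Filter (Σ y, A y × A y) :=
    comap (fun z => (⟨z.1, z.2.1⟩ : TotalSpace ℂ A)) (𝓝 ⟨x, b⟩) ⊓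
      comap (fun z => ‖z.2.2 - z.2.1‖) (𝓝 0)
  have h1 : Tendsto (fun z : Σ y, A y × A y => (⟨p z, z.2.1⟩ : TotalSpace ℂ A)) l (𝓝 ⟨x, b⟩) :=
    tendsto_comap.mono_left inf_le_left
  have h2 : Tendsto (fun z : Σ y, A y × A y => (⟨p z, z.2.2 - z.2.1⟩ : TotalSpace ℂ A)) l
      (𝓝 ⟨x, 0⟩) :=
    tendsto_zero (tendsto_proj_of_mk h1) (tendsto_comap.mono_left inf_le_right)
  have h3 := tendsto_add h1 h2
  simp only [add_sub_cancel, add_zero] at h3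
  obtain ⟨s, hs, t, ht, hst⟩ := mem_inf_iff_superset.1 (h3 hW)
  obtain ⟨W', hW', hs⟩ := mem_comap.1 hs
  obtain ⟨t', ht', ht⟩ := mem_comap.1 ht
  obtain ⟨δ, hδ, hball⟩ := Metric.mem_nhds_iff.1 ht'
  refine ⟨W', hW', δ, hδ, fun y c d hc hd => ?_⟩
  exact hst ⟨hs (show (⟨y, c⟩ : TotalSpace ℂ A) ∈ W' from hc), ht (hball (by simpa using hd))⟩
    (a := ⟨y, c, d⟩)

/-- Points of the total space have arbitrarily thin open neighbourhoods. -/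
theorem Bundle.exists_thin_nhds (b : A x) {ε : ℝ} (hε : 0 < ε) :
    ∃ U : Set (TotalSpace ℂ A), IsOpen U ∧ (⟨x, b⟩ : TotalSpace ℂ A) ∈ U ∧ ∀ (y : X) (c d : A y),
      (⟨y, c⟩ : TotalSpace ℂ A) ∈ U → (⟨y, d⟩ : TotalSpace ℂ A) ∈ U → ‖c - d‖ < ε := by
  let p : (Σ y, A y × A y) → X := fun z => z.1
  let l : Filter (Σ y, A y × A y) :=
    comap (fun z => (⟨z.1, z.2.1⟩ : TotalSpace ℂ A)) (𝓝 ⟨x, b⟩) ⊓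
      comap (fun z => (⟨z.1, z.2.2⟩ : TotalSpace ℂ A)) (𝓝 ⟨x, b⟩)
  have h1 : Tendsto (fun z : Σ y, A y × A y => (⟨p z, z.2.1⟩ : TotalSpace ℂ A)) l (𝓝 ⟨x, b⟩) :=
    tendsto_comap.mono_left inf_le_left
  have h2 : Tendsto (fun z : Σ y, A y × A y => (⟨p z, z.2.2⟩ : TotalSpace ℂ A)) l (𝓝 ⟨x, b⟩) :=
    tendsto_comap.mono_left inf_le_right
  have h3 := eventually_norm_lt (tendsto_sub h1 h2) (ε := ε) (by simpa using hε)
  obtain ⟨s, hs, t, ht, hst⟩ := mem_inf_iff_superset.1 h3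
  obtain ⟨s', hs', hs⟩ := mem_comap.1 hs
  obtain ⟨t', ht', ht⟩ := mem_comap.1 ht
  obtain ⟨U, hU, hUo, hxU⟩ := mem_nhds_iff.1 (inter_mem hs' ht')
  exact ⟨U, hUo, hxU, fun y c d hc hd => hst ⟨hs (hU hc).1, ht (hU hd).2⟩ (a := ⟨y, c, d⟩)⟩

/-- A uniform limit of continuous families is continuous. -/
theorem Bundle.tendsto_of_uniform
    (h : ∀ ε > 0, ∃ (C : ∀ y, A (q y)) (c : A x),
      Tendsto (fun y => (⟨q y, C y⟩ : TotalSpace ℂ A)) l (𝓝 ⟨x, c⟩) ∧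
        (∀ᶠ y in l, ‖B y - C y‖ < ε) ∧ ‖b - c‖ < ε) :
    Tendsto (fun y => (⟨q y, B y⟩ : TotalSpace ℂ A)) l (𝓝 ⟨x, b⟩) := by
  intro W hW
  obtain ⟨W', hW', δ, hδ, hd⟩ := exists_nhds_thickening hW
  have hfib : Tendsto (fun c : A x => (⟨x, c⟩ : TotalSpace ℂ A)) (𝓝 b) (𝓝 ⟨x, b⟩) :=
    tendsto_fibre_iff.2 tendsto_id
  obtain ⟨W'', hW''sub, hW''o, hbW''⟩ := mem_nhds_iff.1 hW'
  obtain ⟨η, hη, hball⟩ := Metric.mem_nhds_iff.1 (hfib (hW''o.mem_nhds hbW''))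
  obtain ⟨C, c, hC, hBC, hbc⟩ := h (min δ η) (lt_min hδ hη)
  have hc : (⟨x, c⟩ : TotalSpace ℂ A) ∈ W'' :=
    hball (show c ∈ Metric.ball b η by
      rw [Metric.mem_ball, dist_eq_norm, norm_sub_rev]; exact hbc.trans_le (min_le_right _ _))
  rw [mem_map]
  filter_upwards [hC (hW''o.mem_nhds hc), hBC] with y hy hy'
  exact hd _ _ _ (hW''sub hy) (hy'.trans_le (min_le_left _ _))

end BundleTopology

/-! ### Existence of continuous sections -/

section EnoughSections

variable {X : Type*} [TopologicalSpace X] {A : X → Type*} [∀ x, NonUnitalCStarAlgebra (A x)]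
  [TopologicalSpace (TotalSpace ℂ A)]

/-- A section `f` is continuous at `x` up to the error `e`: near `x` every neighbourhood of `f x` in
the total space comes within `e y` of `f y`. -/
def IsApproxContinuousAt (f : ∀ x, A x) (e : X → ℝ) (x : X) : Prop :=
  ∀ W ∈ 𝓝 (⟨x, f x⟩ : TotalSpace ℂ A),
    ∀ᶠ y in 𝓝 x, ∃ c : A y, (⟨y, c⟩ : TotalSpace ℂ A) ∈ W ∧ ‖f y - c‖ ≤ e y

namespace IsApproxContinuousAt

variable {f g : ∀ x, A x} {e e' : X → ℝ} {x : X}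

theorem mono (hf : IsApproxContinuousAt f e x) (h : ∀ y, e y ≤ e' y) :
    IsApproxContinuousAt f e' x := fun W hW =>
  (hf W hW).mono fun y ⟨c, hc, hle⟩ => ⟨c, hc, hle.trans (h y)⟩

variable [IsUSCCStarBundle A]

theorem add (hf : IsApproxContinuousAt f e x) (hg : IsApproxContinuousAt g e' x) :
    IsApproxContinuousAt (fun y => f y + g y) (fun y => e y + e' y) x := by
  intro W hW
  let p : (Σ y, A y × A y) → X := fun z => z.1
  let l : Filter (Σ y, A y × A y) :=
    comap (fun z => (⟨z.1, z.2.1⟩ : TotalSpace ℂ A)) (𝓝 ⟨x, f x⟩) ⊓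
      comap (fun z => (⟨z.1, z.2.2⟩ : TotalSpace ℂ A)) (𝓝 ⟨x, g x⟩)
  have h1 : Tendsto (fun z : Σ y, A y × A y => (⟨p z, z.2.1⟩ : TotalSpace ℂ A)) l (𝓝 ⟨x, f x⟩) :=
    tendsto_comap.mono_left inf_le_left
  have h2 : Tendsto (fun z : Σ y, A y × A y => (⟨p z, z.2.2⟩ : TotalSpace ℂ A)) l (𝓝 ⟨x, g x⟩) :=
    tendsto_comap.mono_left inf_le_right
  obtain ⟨s, hs, t, ht, hst⟩ := mem_inf_iff_superset.1 (Bundle.tendsto_add h1 h2 hW)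
  obtain ⟨s', hs', hs⟩ := mem_comap.1 hs
  obtain ⟨t', ht', ht⟩ := mem_comap.1 ht
  filter_upwards [hf s' hs', hg t' ht'] with y ⟨c, hc, hc'⟩ ⟨d, hd, hd'⟩
  refine ⟨c + d, hst ⟨hs hc, ht hd⟩ (a := ⟨y, c, d⟩), ?_⟩
  calc ‖f y + g y - (c + d)‖ = ‖(f y - c) + (g y - d)‖ := by congr 1; abel
    _ ≤ _ := (norm_add_le _ _).trans (add_le_add hc' hd')

theorem smul {φ : X → ℝ} (hφ : Continuous φ) (h0 : ∀ y, 0 ≤ φ y)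
    (hf : IsApproxContinuousAt f e x) :
    IsApproxContinuousAt (fun y => (φ y : ℂ) • f y) (fun y => φ y * e y) x := by
  intro W hW
  have h1 : Tendsto (fun z : TotalSpace ℂ A => (⟨z.proj, (φ z.proj : ℂ) • z.snd⟩ : TotalSpace ℂ A))
      (𝓝 ⟨x, f x⟩) (𝓝 ⟨x, (φ x : ℂ) • f x⟩) := by
    refine Bundle.tendsto_smul ?_ tendsto_id
    exact ((Complex.continuous_ofReal.comp hφ).comp
      (IsUSCCStarBundle.continuous_proj (A := A))).tendsto _
  filter_upwards [hf _ (h1 hW)] with y ⟨c, hc, hc'⟩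
  refine ⟨(φ y : ℂ) • c, hc, ?_⟩
  rw [← smul_sub, norm_smul, Complex.norm_real, Real.norm_of_nonneg (h0 y)]
  exact mul_le_mul_of_nonneg_left hc' (h0 y)

theorem of_eventually_eq_zero (hf : ∀ᶠ y in 𝓝 x, f y = 0) (he : ∀ y, 0 ≤ e y) :
    IsApproxContinuousAt f e x := by
  intro W hW
  rw [hf.self_of_nhds] at hW
  have : Tendsto (fun y => (⟨y, 0⟩ : TotalSpace ℂ A)) (𝓝 x) (𝓝 ⟨x, 0⟩) :=
    Bundle.tendsto_zero tendsto_id (by simp)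
  filter_upwards [hf, this hW] with y hy hyW
  exact ⟨0, hyW, by simpa [hy] using he y⟩

theorem sum {ι : Type*} (t : Finset ι) {f : ι → ∀ x, A x} {e : ι → X → ℝ}
    (hf : ∀ i ∈ t, IsApproxContinuousAt (f i) (e i) x) :
    IsApproxContinuousAt (fun y => ∑ i ∈ t, f i y) (fun y => ∑ i ∈ t, e i y) x := by
  classical
  induction t using Finset.induction_on with
  | empty => exact of_eventually_eq_zero (by simp) (by simp)
  | insert i t hi ih =>
    simp only [Finset.sum_insert hi]
    exact (hf i (Finset.mem_insert_self _ _)).add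
      (ih fun j hj => hf j (Finset.mem_insert_of_mem hj))

/-- A section running inside an `ε`-thin open set over a neighbourhood of `x` is continuous at `x`
up to `ε`. -/
theorem of_thin {U : Set (TotalSpace ℂ A)} (hU : IsOpen U) {ε : ℝ}
    (hthin : ∀ (y : X) (c d : A y), (⟨y, c⟩ : TotalSpace ℂ A) ∈ U →
      (⟨y, d⟩ : TotalSpace ℂ A) ∈ U → ‖c - d‖ < ε)
    (hf : ∀ᶠ y in 𝓝 x, (⟨y, f y⟩ : TotalSpace ℂ A) ∈ U) :
    IsApproxContinuousAt f (fun _ => ε) x := by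
  intro W hW
  have h1 : TotalSpace.proj '' (W ∩ U) ∈ 𝓝 x :=
    (IsUSCCStarBundle.isOpenMap_proj (A := A)).image_mem_nhds
      (inter_mem hW (hU.mem_nhds hf.self_of_nhds))
  filter_upwards [h1, hf] with y hy hyU
  obtain ⟨⟨y', c⟩, ⟨hcW, hcU⟩, rfl⟩ := hy
  exact ⟨c, hcW, (hthin _ _ _ hyU hcU).le⟩

/-- A section that is continuous up to `ε` can be corrected by at most `ε`, over a compact set, to a
section that is continuous up to `δ`. -/
theorem exists_improvement [T2Space X] [LocallyCompactSpace X] {ε δ : ℝ} (hδ : 0 < δ)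
    (hf : ∀ x, IsApproxContinuousAt f (fun _ => ε) x) {K : Set X} (hK : IsCompact K) :
    ∃ g : ∀ x, A x, (∀ x, IsApproxContinuousAt g (fun _ => δ) x) ∧ ∀ x ∈ K, ‖g x - f x‖ ≤ ε := by
  classical
  have hloc : ∀ x : X, ∃ (V : Set X) (g : ∀ y, A y), IsOpen V ∧ x ∈ V ∧
      ∀ y ∈ V, IsApproxContinuousAt g (fun _ => δ) y ∧ ‖f y - g y‖ ≤ ε := by
    intro x
    obtain ⟨U, hU, hxU, hthin⟩ := Bundle.exists_thin_nhds (f x) hδ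
    obtain ⟨V, hV, hVo, hxV⟩ := mem_nhds_iff.1 (hf x U (hU.mem_nhds hxU))
    choose! c hcU hc using hV
    refine ⟨V, c, hVo, hxV, fun y hy => ⟨?_, hc hy⟩⟩
    exact of_thin hU hthin (by filter_upwards [hVo.mem_nhds hy] with z hz using hcU hz)
  choose V g hVo hxV hg using hloc
  obtain ⟨t, ht⟩ := hK.elim_finite_subcover V hVo fun x _ => mem_iUnion.2 ⟨x, hxV x⟩
  obtain ⟨ρ, hρ, -⟩ := PartitionOfUnity.exists_isSubordinate_of_locallyFinite_t2space hK
    (fun i : t => V i) (fun i => hVo i) (locallyFinite_of_finite _)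
    (by simpa [iUnion_subtype] using ht)
  have hsum : ∀ y, ∑ᶠ i, ρ i y = ∑ i, ρ i y := fun y => finsum_eq_sum_of_fintype _
  refine ⟨fun y => ∑ i, (ρ i y : ℂ) • g i y, fun x => ?_, fun x hx => ?_⟩
  · have h1 : IsApproxContinuousAt (fun y => ∑ i, (ρ i y : ℂ) • g i y)
        (fun y => ∑ i, ρ i y * δ) x := by
      refine sum _ fun i _ => ?_
      by_cases hx : x ∈ tsupport (ρ i)
      · exact smul (ρ i).continuous (fun y => ρ.nonneg i y) (hg i x (hρ i hx)).1
      · refine of_eventually_eq_zero ?_ fun y => mul_nonneg (ρ.nonneg i y) hδ.le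
        filter_upwards [(isClosed_tsupport _).isOpen_compl.mem_nhds hx] with y hy
        simp [image_eq_zero_of_notMem_tsupport hy]
    refine h1.mono fun y => ?_
    rw [← Finset.sum_mul, ← hsum]
    exact mul_le_of_le_one_left hδ.le (ρ.sum_le_one y)
  · have h1 : ∑ i, ρ i x = 1 := by rw [← hsum, ρ.sum_eq_one hx]
    have h2 : f x = ∑ i, (ρ i x : ℂ) • f x := by
      rw [← Finset.sum_smul, ← Complex.ofReal_sum, h1, Complex.ofReal_one, one_smul]
    have h3 : ∑ i, (ρ i x : ℂ) • g i x - f x = ∑ i, (ρ i x : ℂ) • (g i x - f x) := by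
      simp_rw [smul_sub, Finset.sum_sub_distrib]
      rw [← h2]
    rw [h3]
    calc _ ≤ ∑ i, ρ i x * ε := by
          refine norm_sum_le_of_le _ fun i _ => ?_
          rw [norm_smul, Complex.norm_real, Real.norm_of_nonneg (ρ.nonneg i x)]
          by_cases hx : ρ i x = 0
          · simp [hx]
          · refine mul_le_mul_of_nonneg_left ?_ (ρ.nonneg i x)
            rw [norm_sub_rev]
            exact (hg i x (hρ i (subset_tsupport _ hx))).2
      _ = ε := by rw [← Finset.sum_mul, h1, one_mul]

end IsApproxContinuousAt

end EnoughSections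

/-! ### Compactly supported and dense families of sections -/

section SectionAlgebra

variable {X : Type*} [TopologicalSpace X] {A : X → Type*} [∀ x, NonUnitalCStarAlgebra (A x)]
  [TopologicalSpace (TotalSpace ℂ A)] [IsUSCCStarBundle A]

/-- A continuous section along a map is bounded in norm on compact sets. -/
theorem Bundle.exists_norm_le_of_isCompact {Y : Type*} [TopologicalSpace Y] {q : Y → X}
    {B : ∀ y, A (q y)} (hB : Continuous fun y => (⟨q y, B y⟩ : TotalSpace ℂ A)) {K : Set Y}
    (hK : IsCompact K) : ∃ M : ℝ, 0 ≤ M ∧ ∀ y ∈ K, ‖B y‖ ≤ M := by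
  have hev : ∀ y ∈ K, ∀ᶠ z in 𝓝 y, ‖B z‖ < ‖B y‖ + 1 := fun y _ =>
    eventually_norm_lt (hB.tendsto y) (lt_add_one _)
  obtain ⟨t, ht⟩ := hK.elim_nhds_subcover' (fun y _ => {z | ‖B z‖ < ‖B y‖ + 1}) hev
  refine ⟨∑ y ∈ t, (‖B y‖ + 1), by positivity, fun z hz => ?_⟩
  obtain ⟨y, hy, hzy⟩ := mem_iUnion₂.1 (ht hz)
  exact (show ‖B z‖ < ‖B y‖ + 1 from hzy).le.trans
    (Finset.single_le_sum (f := fun y : K => ‖B y‖ + 1) (fun _ _ => by positivity) hy)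

/-- A continuous section with compact support is an element of the section algebra. -/
theorem exists_sectionAlgebra_eq [T2Space X] {a : ∀ x, A x} (ha : IsContSection a) {K : Set X}
    (hK : IsCompact K) (h0 : ∀ x ∉ K, a x = 0) : ∃ b : SectionAlgebra A, ∀ x, b x = a x := by
  obtain ⟨M, hM, hle⟩ := Bundle.exists_norm_le_of_isCompact ha hK
  have hbd : ∀ x, ‖a x‖ ≤ M := fun x => by
    by_cases hx : x ∈ K
    · exact hle x hx
    · simpa [h0 x hx] using hM
  have hmem : Memℓp a ∞ := memℓp_infty ⟨M, by rintro _ ⟨x, rfl⟩; exact hbd x⟩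
  refine ⟨⟨⟨a, hmem⟩, ha, ?_⟩, fun x => rfl⟩
  refine tendsto_const_nhds.congr' ?_
  filter_upwards [hK.compl_mem_cocompact] with x hx
  exact (by simpa using h0 x hx : ‖a x‖ = 0).symm

/-- A continuous section with compact support belongs to `C_c(X) · A`. -/
theorem exists_mem_compactMulSubalgebra [T2Space X] [LocallyCompactSpace X] {a : ∀ x, A x}
    (ha : IsContSection a) {K : Set X} (hK : IsCompact K) (h0 : ∀ x ∉ K, a x = 0) :
    ∃ b ∈ compactMulSubalgebra A, ∀ x, b x = a x := by
  obtain ⟨b, hb⟩ := exists_sectionAlgebra_eq ha hK h0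
  obtain ⟨h, h1, -, hc, -⟩ := exists_continuous_one_zero_of_isCompact
    hK isClosed_empty (disjoint_empty _)
  refine ⟨b, ⟨fun u => (h u : ℂ), b, Complex.continuous_ofReal.comp h.continuous,
    HasCompactSupport.comp_left (g := fun t : ℝ => (t : ℂ)) hc Complex.ofReal_zero,
    fun u => ?_⟩, hb⟩
  by_cases hu : u ∈ K
  · have h5 : h u = 1 := h1 hu
    change b u = (h u : ℂ) • b u
    rw [h5, Complex.ofReal_one, one_smul]
  · change b u = (h u : ℂ) • b u
    rw [hb, h0 u hu, smul_zero]

/-- Elements of `C_c(X) · A` vanish off a compact set. -/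
theorem exists_isCompact_of_mem_compactMulSubalgebra [T2Space X] [LocallyCompactSpace X]
    {a : SectionAlgebra A} (ha : a ∈ compactMulSubalgebra A) :
    ∃ K : Set X, IsCompact K ∧ ∀ x ∉ K, a x = 0 := by
  obtain ⟨f, b, -, hc, h⟩ := ha
  exact ⟨tsupport f, hc, fun x hx => by rw [h, image_eq_zero_of_notMem_tsupport hx, zero_smul]⟩

theorem SectionAlgebra.isContSection (a : SectionAlgebra A) : IsContSection a := a.2.1

theorem SectionAlgebra.norm_apply_le (a : SectionAlgebra A) (x : X) : ‖a x‖ ≤ ‖a‖ :=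
  lp.norm_apply_le_norm (by simp) (a : lp A ∞) x

/-- Through every point of the total space there passes, up to an arbitrarily small error, a
continuous section vanishing at infinity. -/
theorem exists_sectionAlgebra_norm_sub_lt [T2Space X] [LocallyCompactSpace X] (x₀ : X) (b : A x₀)
    {ε : ℝ} (hε : 0 < ε) : ∃ a : SectionAlgebra A, ‖a x₀ - b‖ < ε := by
  classical
  set η : ℕ → ℝ := fun n => (ε / 4) * (1 / 2) ^ n with hη
  have hηpos : ∀ n, 0 < η n := fun n => by positivity
  obtain ⟨K, hK, hxK⟩ := exists_compact_mem_nhds x₀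
  -- a section through `b` that is continuous up to `η 0`
  obtain ⟨f₀, hf₀, hf₀b⟩ : ∃ f : ∀ x, A x,
      (∀ x, IsApproxContinuousAt f (fun _ => η 0) x) ∧ f x₀ = b := by
    obtain ⟨U, hU, hxU, hthin⟩ := Bundle.exists_thin_nhds b (hηpos 0)
    have hV : IsOpen (TotalSpace.proj '' U) := IsUSCCStarBundle.isOpenMap_proj (A := A) U hU
    have hsec : ∃ f : ∀ x, A x, f x₀ = b ∧
        ∀ y ∈ TotalSpace.proj '' U, (⟨y, f y⟩ : TotalSpace ℂ A) ∈ U := by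
      have : ∀ y ∈ TotalSpace.proj '' U, ∃ c : A y, (⟨y, c⟩ : TotalSpace ℂ A) ∈ U := by
        rintro _ ⟨⟨y, c⟩, hc, rfl⟩
        exact ⟨c, hc⟩
      choose! f hf using this
      refine ⟨Function.update f x₀ b, by simp, fun y hy => ?_⟩
      by_cases h : y = x₀
      · subst h; simpa using hxU
      · simpa [h] using hf y hy
    obtain ⟨f, hfb, hf⟩ := hsec
    obtain ⟨φ, h1, -, hφU, h01⟩ := exists_continuousMap_one_of_isCompact_subset_isOpen
      (isCompact_singleton (x := x₀)) hV (singleton_subset_iff.2 ⟨⟨x₀, b⟩, hxU, rfl⟩)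
    refine ⟨fun y => (φ y : ℂ) • f y, fun x => ?_, ?_⟩
    · by_cases hx : x ∈ tsupport φ
      · have hfx : IsApproxContinuousAt f (fun _ => η 0) x :=
          IsApproxContinuousAt.of_thin hU hthin
            (by filter_upwards [hV.mem_nhds (hφU hx)] with y hy using hf y hy)
        exact (hfx.smul φ.continuous fun y => (h01 y).1).mono fun y =>
          mul_le_of_le_one_left (hηpos 0).le (h01 y).2
      · refine IsApproxContinuousAt.of_eventually_eq_zero ?_ fun _ => (hηpos 0).le
        filter_upwards [(isClosed_tsupport _).isOpen_compl.mem_nhds hx] with y hy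
        rw [image_eq_zero_of_notMem_tsupport hy, Complex.ofReal_zero, zero_smul]
    · have : φ x₀ = 1 := h1 rfl
      simp [this, hfb]
  -- successive corrections converge uniformly on `K`
  have step : ∀ (n : ℕ) (f : ∀ x, A x), (∀ x, IsApproxContinuousAt f (fun _ => η n) x) →
      ∃ g : ∀ x, A x, (∀ x, IsApproxContinuousAt g (fun _ => η (n + 1)) x) ∧
        ∀ x ∈ K, ‖g x - f x‖ ≤ η n :=
    fun n f hf => IsApproxContinuousAt.exists_improvement (hηpos (n + 1)) hf hK
  choose! next hnext hdist using step
  let F : ℕ → ∀ x, A x := fun n => Nat.rec f₀ (fun n f => next n f) n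
  have hF : ∀ n x, IsApproxContinuousAt (F n) (fun _ => η n) x := fun n => by
    induction n with
    | zero => exact hf₀
    | succ n ih => exact hnext n _ ih
  have hFd : ∀ x ∈ K, ∀ n, dist (F n x) (F (n + 1) x) ≤ (ε / 4) * (1 / 2) ^ n := fun x hx n => by
    rw [dist_comm, dist_eq_norm]
    exact hdist n _ (hF n) x hx
  have hlim : ∀ x, ∃ c : A x, x ∈ K → Tendsto (fun n => F n x) atTop (𝓝 c) := fun x => by
    by_cases hx : x ∈ K
    · obtain ⟨c, hc⟩ := cauchySeq_tendsto_of_complete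
        (cauchySeq_of_le_geometric (1 / 2) (ε / 4) (by norm_num) (hFd x hx))
      exact ⟨c, fun _ => hc⟩
    · exact ⟨0, fun h => absurd h hx⟩
  choose f hf using hlim
  have hfF : ∀ x ∈ K, ∀ n, ‖f x - F n x‖ ≤ 2 * η n := fun x hx n => by
    have := dist_le_of_le_geometric_of_tendsto (1 / 2) (ε / 4) (by norm_num) (hFd x hx)
      (hf x hx) n
    rw [dist_comm, dist_eq_norm] at this
    refine this.trans (le_of_eq ?_)
    simp only [hη]; ring
  have hη0 : Tendsto η atTop (𝓝 0) := by
    simpa [hη] using (tendsto_pow_atTop_nhds_zero_of_lt_one (r := (1 / 2 : ℝ)) (by norm_num)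
      (by norm_num)).const_mul (ε / 4)
  have hcont : ∀ x ∈ interior K, Tendsto (fun y => (⟨y, f y⟩ : TotalSpace ℂ A)) (𝓝 x)
      (𝓝 ⟨x, f x⟩) := by
    intro x hx W hW
    obtain ⟨W', hW', δ, hδ, hd⟩ := Bundle.exists_nhds_thickening hW
    obtain ⟨W'', hW''sub, hW''o, hxW''⟩ := mem_nhds_iff.1 hW'
    have h1 : ∀ᶠ n in atTop, (⟨x, F n x⟩ : TotalSpace ℂ A) ∈ W'' :=
      (Bundle.tendsto_fibre_iff.2 (hf x (interior_subset hx))) (hW''o.mem_nhds hxW'')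
    have h2 : ∀ᶠ n in atTop, 3 * η n < δ := by
      have := hη0.const_mul 3
      rw [mul_zero] at this
      exact this.eventually_lt_const hδ
    obtain ⟨n, hn1, hn2⟩ := (h1.and h2).exists
    rw [mem_map]
    filter_upwards [hF n x W'' (hW''o.mem_nhds hn1), isOpen_interior.mem_nhds hx]
      with y ⟨c, hcW, hc⟩ hy
    refine hd _ _ _ (hW''sub hcW) ?_
    calc ‖f y - c‖ = ‖(f y - F n y) + (F n y - c)‖ := by congr 1; abel
      _ ≤ 2 * η n + η n := (norm_add_le _ _).trans
        (add_le_add (hfF y (interior_subset hy) n) hc)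
      _ < δ := by linarith
  obtain ⟨φ, h1, -, hφK, -⟩ := exists_continuousMap_one_of_isCompact_subset_isOpen
    (isCompact_singleton (x := x₀)) isOpen_interior
    (by simpa using mem_interior_iff_mem_nhds.2 hxK)
  have hsec : IsContSection fun x => (φ x : ℂ) • f x := by
    refine continuous_iff_continuousAt.2 fun x => ?_
    by_cases hx : x ∈ tsupport φ
    · exact Bundle.tendsto_smul ((Complex.continuous_ofReal.comp φ.continuous).tendsto x)
        (hcont x (hφK hx))
    · have h0 : ContinuousAt (fun y => (⟨y, 0⟩ : TotalSpace ℂ A)) x :=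
        (IsContSection.zero (A := A)).continuousAt
      refine h0.congr ?_
      filter_upwards [(isClosed_tsupport _).isOpen_compl.mem_nhds hx] with y hy
      rw [image_eq_zero_of_notMem_tsupport hy, Complex.ofReal_zero, zero_smul]
  obtain ⟨a, ha⟩ := exists_sectionAlgebra_eq hsec hK fun x hx => by
    have : x ∉ tsupport φ := fun h => hx (interior_subset (hφK h))
    rw [image_eq_zero_of_notMem_tsupport this, Complex.ofReal_zero, zero_smul]
  refine ⟨a, ?_⟩
  have h1' : φ x₀ = 1 := h1 rfl
  rw [ha, h1', Complex.ofReal_one, one_smul]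
  have := hfF x₀ (mem_of_mem_nhds hxK) 0
  rw [show F 0 x₀ = b from hf₀b] at this
  refine this.trans_lt ?_
  simp only [hη, pow_zero]
  linarith

variable (A) in
/-- In a separable section algebra there is a sequence of sections whose values are dense in every
fibre. -/
theorem exists_seq_sectionAlgebra_dense [T2Space X] [LocallyCompactSpace X]
    [TopologicalSpace.SeparableSpace (SectionAlgebra A)] :
    ∃ a : ℕ → SectionAlgebra A, ∀ (x : X) (b : A x) (ε : ℝ), 0 < ε → ∃ n, ‖b - a n x‖ < ε := by
  refine ⟨TopologicalSpace.denseSeq _, fun x b ε hε => ?_⟩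
  obtain ⟨c, hc⟩ := exists_sectionAlgebra_norm_sub_lt x b (half_pos hε)
  obtain ⟨n, hn⟩ := (TopologicalSpace.denseRange_denseSeq (SectionAlgebra A)).exists_dist_lt c
    (half_pos hε)
  refine ⟨n, ?_⟩
  have h1 : ‖c x - TopologicalSpace.denseSeq (SectionAlgebra A) n x‖ ≤ dist c
      (TopologicalSpace.denseSeq (SectionAlgebra A) n) := by
    rw [dist_eq_norm]
    exact (c - TopologicalSpace.denseSeq (SectionAlgebra A) n).norm_apply_le x
  calc _ = ‖(b - c x) + (c x - TopologicalSpace.denseSeq (SectionAlgebra A) n x)‖ := by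
        congr 1; abel
    _ < ε / 2 + ε / 2 := (norm_add_le _ _).trans_lt
        (add_lt_add (by rwa [norm_sub_rev]) (h1.trans_lt hn))
    _ = ε := add_halves ε

/-- The norm of a continuous section along a map is Borel. -/
theorem Bundle.measurable_norm {Y : Type*} [TopologicalSpace Y] [MeasurableSpace Y]
    [OpensMeasurableSpace Y] {q : Y → X} {B : ∀ y, A (q y)}
    (hB : Continuous fun y => (⟨q y, B y⟩ : TotalSpace ℂ A)) : Measurable fun y => ‖B y‖ := by
  refine measurable_of_Iio fun ε => ?_
  rcases le_or_gt ε 0 with hε | hε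
  · convert MeasurableSet.empty
    ext y
    simpa using hε.trans (norm_nonneg _)
  · exact ((IsUSCCStarBundle.norm_usc (A := A) ε hε).preimage hB).measurableSet

end SectionAlgebra

/-! ### Groupoid calculus with total operations -/

section ToFibre

variable {X : Type*} {E : X → Type*}

open Classical in
/-- The element `e` of the fibre over `x`, regarded as an element of the fibre over `u`; it is zero
unless `x = u`. -/
noncomputable def toFibre [∀ x, Zero (E x)] (u : X) {x : X} (e : E x) : E u :=
  if h : x = u then fibreCast h e else 0

theorem fibreCast_eq_toFibre [∀ x, Zero (E x)] {u x : X} (h : x = u) (e : E x) :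
    fibreCast h e = toFibre u e := by
  subst h; simp [toFibre]

@[simp] theorem toFibre_self [∀ x, Zero (E x)] {u : X} (e : E u) : toFibre u e = e :=
  (fibreCast_eq_toFibre rfl e).symm

theorem toFibre_of_ne [∀ x, Zero (E x)] {u x : X} (h : x ≠ u) (e : E x) : toFibre u e = 0 :=
  dif_neg h

theorem mk_toFibre [∀ x, Zero (E x)] {u x : X} (h : x = u) (e : E x) :
    (⟨u, toFibre u e⟩ : TotalSpace ℂ E) = ⟨x, e⟩ := by
  subst h; simp

theorem toFibre_zero [∀ x, Zero (E x)] (u : X) {x : X} : toFibre u (0 : E x) = 0 := by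
  by_cases h : x = u
  · subst h; simp
  · exact toFibre_of_ne h _

theorem toFibre_add [∀ x, AddMonoid (E x)] (u : X) {x : X} (a b : E x) :
    toFibre u (a + b) = toFibre u a + toFibre u b := by
  by_cases h : x = u
  · subst h; simp
  · simp [toFibre_of_ne h]

theorem toFibre_smul [∀ x, AddMonoid (E x)] [∀ x, DistribMulAction ℂ (E x)] (u : X) {x : X} (c : ℂ)
    (a : E x) : toFibre u (c • a) = c • toFibre u a := by
  by_cases h : x = u
  · subst h; simp
  · simp [toFibre_of_ne h]

theorem toFibre_mul [∀ x, NonUnitalSemiring (E x)] (u : X) {x : X} (a b : E x) :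
    toFibre u (a * b) = toFibre u a * toFibre u b := by
  by_cases h : x = u
  · subst h; simp
  · simp [toFibre_of_ne h]

theorem norm_toFibre [∀ x, NormedAddCommGroup (E x)] {u x : X} (h : x = u) (a : E x) :
    ‖toFibre u a‖ = ‖a‖ := by
  subst h; simp

end ToFibre

namespace TopGroupoid

variable {G X : Type*} [TopologicalSpace G] [TopologicalSpace X] (𝓖 : TopGroupoid G X)

open Classical in
/-- The product `γη`, with the dummy value `γ` where it is not defined. -/
noncomputable def cmul (γ η : G) : G := if h : 𝓖.s γ = 𝓖.r η then 𝓖.mul γ η h else γ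

variable {𝓖} {γ η ζ : G}

theorem cmul_eq (h : 𝓖.s γ = 𝓖.r η) : 𝓖.cmul γ η = 𝓖.mul γ η h := dif_pos h

@[simp] theorem r_cmul : 𝓖.r (𝓖.cmul γ η) = 𝓖.r γ := by
  unfold cmul
  split_ifs with h
  · exact 𝓖.r_mul _ _ h
  · rfl

theorem s_cmul (h : 𝓖.s γ = 𝓖.r η) : 𝓖.s (𝓖.cmul γ η) = 𝓖.s η := by
  rw [cmul_eq h, 𝓖.s_mul]

theorem cmul_assoc (h₁ : 𝓖.s γ = 𝓖.r η) (h₂ : 𝓖.s η = 𝓖.r ζ) :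
    𝓖.cmul (𝓖.cmul γ η) ζ = 𝓖.cmul γ (𝓖.cmul η ζ) := by
  rw [cmul_eq (γ := 𝓖.cmul γ η) ((s_cmul h₁).trans h₂), cmul_eq (η := 𝓖.cmul η ζ) (by simpa)]
  simp only [cmul_eq h₁, cmul_eq h₂]
  exact 𝓖.mul_assoc γ η ζ h₁ h₂

theorem unit_cmul : 𝓖.cmul (𝓖.unit (𝓖.r γ)) γ = γ := by
  rw [cmul_eq (𝓖.s_unit _), 𝓖.unit_mul]

theorem cmul_unit : 𝓖.cmul γ (𝓖.unit (𝓖.s γ)) = γ := by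
  rw [cmul_eq (𝓖.r_unit _).symm, 𝓖.mul_unit]

theorem inv_cmul_self : 𝓖.cmul (𝓖.inv γ) γ = 𝓖.unit (𝓖.s γ) := by
  rw [cmul_eq (𝓖.s_inv _), 𝓖.inv_mul]

theorem cmul_inv_self : 𝓖.cmul γ (𝓖.inv γ) = 𝓖.unit (𝓖.r γ) := by
  rw [cmul_eq (𝓖.r_inv _).symm, 𝓖.mul_inv]

theorem inv_cmul_cmul (h : 𝓖.s γ = 𝓖.r η) : 𝓖.cmul (𝓖.inv γ) (𝓖.cmul γ η) = η := by
  rw [← cmul_assoc (𝓖.s_inv γ) h, inv_cmul_self, h, unit_cmul]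

theorem cmul_inv_cmul (h : 𝓖.r γ = 𝓖.r η) : 𝓖.cmul γ (𝓖.cmul (𝓖.inv γ) η) = η := by
  rw [← cmul_assoc (𝓖.r_inv γ).symm ((𝓖.s_inv γ).trans h), cmul_inv_self, h, unit_cmul]

@[simp] theorem inv_inv : 𝓖.inv (𝓖.inv γ) = γ := by
  have h1 : 𝓖.cmul (𝓖.cmul (𝓖.inv (𝓖.inv γ)) (𝓖.inv γ)) γ =
      𝓖.cmul (𝓖.inv (𝓖.inv γ)) (𝓖.cmul (𝓖.inv γ) γ) := cmul_assoc (by simp [𝓖.s_inv]) (𝓖.s_inv _)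
  rw [inv_cmul_self, inv_cmul_self, 𝓖.s_inv, unit_cmul] at h1
  have h2 : 𝓖.s γ = 𝓖.s (𝓖.inv (𝓖.inv γ)) := by simp [𝓖.s_inv, 𝓖.r_inv]
  rw [h2, cmul_unit] at h1
  exact h1.symm

/-- `(γη)⁻¹γ = η⁻¹`. -/
theorem inv_cmul_left (h : 𝓖.s γ = 𝓖.r η) : 𝓖.cmul (𝓖.inv (𝓖.cmul γ η)) γ = 𝓖.inv η := by
  have h1 : 𝓖.cmul (𝓖.cmul γ η) (𝓖.inv η) = γ := by
    rw [cmul_assoc h (𝓖.r_inv _).symm, cmul_inv_self, ← h, cmul_unit]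
  have h2 : 𝓖.s (𝓖.cmul γ η) = 𝓖.r (𝓖.inv η) := by rw [s_cmul h, 𝓖.r_inv]
  conv_lhs => rw [← h1]
  rw [h1]
  have := inv_cmul_cmul h2
  rwa [h1] at this

theorem continuousOn_cmul :
    ContinuousOn (fun p : G × G => 𝓖.cmul p.1 p.2) {p | 𝓖.s p.1 = 𝓖.r p.2} := by
  rw [continuousOn_iff_continuous_domRestrict]
  exact 𝓖.continuous_mul.congr fun p => (cmul_eq p.2).symm

theorem continuous_cmul {Y : Type*} [TopologicalSpace Y] {f g : Y → G} (hf : Continuous f)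
    (hg : Continuous g) (h : ∀ y, 𝓖.s (f y) = 𝓖.r (g y)) :
    Continuous fun y => 𝓖.cmul (f y) (g y) :=
  continuousOn_cmul.comp_continuous (hf.prodMk hg) h

theorem isClosed_composable [T2Space X] : IsClosed {p : G × G | 𝓖.s p.1 = 𝓖.r p.2} :=
  isClosed_eq (𝓖.continuous_s.comp continuous_fst) (𝓖.continuous_r.comp continuous_snd)

theorem measurable_cmul [T2Space X] [SecondCountableTopology G] [MeasurableSpace G] [BorelSpace G] :
    Measurable fun p : G × G => 𝓖.cmul p.1 p.2 := by
  classical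
  have h1 : Measurable fun p : {p : G × G | 𝓖.s p.1 = 𝓖.r p.2} => 𝓖.mul p.1.1 p.1.2 p.2 :=
    𝓖.continuous_mul.measurable
  have h2 : Measurable fun p : ({p : G × G | 𝓖.s p.1 = 𝓖.r p.2}ᶜ : Set (G × G)) => p.1.1 :=
    measurable_fst.comp measurable_subtype_coe
  have := Measurable.dite h1 h2 isClosed_composable.measurableSet
  convert this using 2 with p
  unfold cmul
  congr

end TopGroupoid

namespace GroupoidAction

variable {G X : Type*} [TopologicalSpace G] [TopologicalSpace X] {𝓖 : TopGroupoid G X}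
  {A : X → Type*} [∀ x, NonUnitalCStarAlgebra (A x)] [TopologicalSpace (TotalSpace ℂ A)]
  (S : GroupoidAction 𝓖 A)

/-- The action of an arrow on the total space; points outside the source fibre are sent to zero. -/
noncomputable def act (γ : G) (p : TotalSpace ℂ A) : TotalSpace ℂ A :=
  ⟨𝓖.r γ, S.α γ (toFibre (𝓖.s γ) p.snd)⟩

variable {S} {γ η : G} {p : TotalSpace ℂ A}

@[simp] theorem proj_act : (S.act γ p).proj = 𝓖.r γ := rfl

theorem act_mk (a : A (𝓖.s γ)) : S.act γ ⟨𝓖.s γ, a⟩ = ⟨𝓖.r γ, S.α γ a⟩ := by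
  simp [act]

theorem act_cmul (h : 𝓖.s γ = 𝓖.r η) (hp : p.proj = 𝓖.s η) :
    S.act (𝓖.cmul γ η) p = S.act γ (S.act η p) := by
  obtain ⟨x, a⟩ := p
  obtain rfl : x = 𝓖.s η := hp
  have h1 := S.map_mul γ η h a
  rw [TopGroupoid.cmul_eq h, act_mk]
  have h2 := congrArg (fun b => (⟨_, b⟩ : TotalSpace ℂ A)) h1
  simp only [fibreCast_eq_toFibre] at h2
  rw [mk_toFibre (𝓖.r_mul _ _ _).symm] at h2
  exact h2

theorem act_unit {u : X} (hp : p.proj = u) : S.act (𝓖.unit u) p = p := by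
  have hs : p.proj = 𝓖.s (𝓖.unit u) := hp.trans (𝓖.s_unit _).symm
  have hc : 𝓖.s (𝓖.unit u) = 𝓖.r (𝓖.unit u) := by rw [𝓖.s_unit, 𝓖.r_unit]
  have h1 := act_cmul (S := S) hc hs
  have h2 : 𝓖.cmul (𝓖.unit u) (𝓖.unit u) = 𝓖.unit u := by
    have := TopGroupoid.unit_cmul (𝓖 := 𝓖) (γ := 𝓖.unit u)
    rwa [𝓖.r_unit] at this
  rw [h2] at h1
  have h3 : ∀ p' : TotalSpace ℂ A, p'.proj = 𝓖.s (𝓖.unit u) →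
      S.act (𝓖.unit u) p = S.act (𝓖.unit u) p' → p = p' := by
    rintro ⟨x', a'⟩ rfl h
    obtain ⟨x, a⟩ := p
    obtain rfl : x = 𝓖.s (𝓖.unit u) := hs
    rw [act_mk, act_mk] at h
    rw [(S.α _).injective (mk_injective h)]
  exact (h3 _ (by rw [proj_act, hc]) h1).symm

theorem act_inv_act (hp : p.proj = 𝓖.s γ) : S.act (𝓖.inv γ) (S.act γ p) = p := by
  rw [← act_cmul (𝓖.s_inv γ) hp, TopGroupoid.inv_cmul_self, act_unit hp]

theorem mk_symm (b : A (𝓖.r γ)) :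
    (⟨𝓖.s γ, (S.α γ).symm b⟩ : TotalSpace ℂ A) = S.act (𝓖.inv γ) ⟨𝓖.r γ, b⟩ := by
  have h : S.act γ ⟨𝓖.s γ, (S.α γ).symm b⟩ = ⟨𝓖.r γ, b⟩ := by
    rw [act_mk]
    congr 1
    exact (S.α γ).apply_symm_apply b
  rw [← h, act_inv_act rfl]

theorem symm_eq_toFibre (b : A (𝓖.r γ)) :
    (S.α γ).symm b = toFibre (𝓖.s γ) (S.act (𝓖.inv γ) ⟨𝓖.r γ, b⟩).snd := by
  rw [← mk_symm, toFibre_self]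

theorem norm_map (a : A (𝓖.s γ)) : ‖S.α γ a‖ = ‖a‖ :=
  NonUnitalStarAlgHom.norm_map (S.α γ) (S.α γ).injective a

theorem norm_act (hp : p.proj = 𝓖.s γ) : ‖(S.act γ p).snd‖ = ‖p.snd‖ := by
  obtain ⟨x, a⟩ := p
  obtain rfl : x = 𝓖.s γ := hp
  rw [act_mk]
  exact norm_map a

theorem continuous_act' {Y : Type*} [TopologicalSpace Y] {g : Y → G} {P : Y → TotalSpace ℂ A}
    (hg : Continuous g) (hP : Continuous P) (h : ∀ y, (P y).proj = 𝓖.s (g y)) :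
    Continuous fun y => S.act (g y) (P y) := by
  have := S.continuous_act.comp ((hg.prodMk hP).subtype_mk h)
  convert this using 2 with y
  simp [act, fibreCast_eq_toFibre]

/-- A continuous section along the source map, moved to the range fibres by the action. -/
theorem continuous_map {a : ∀ x, A x} (ha : IsContSection a) :
    Continuous fun γ => (⟨𝓖.r γ, S.α γ (a (𝓖.s γ))⟩ : TotalSpace ℂ A) := by
  have := continuous_act' (S := S) continuous_id (ha.comp 𝓖.continuous_s) fun _ => rfl
  convert this using 2 with γ
  exact (act_mk _).symm

end GroupoidAction

/-! ### Haar systems: Borel dependence and translation invariance -/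

namespace HaarSystem

variable {G X : Type*} [TopologicalSpace G] [T2Space G] [LocallyCompactSpace G]
  [SecondCountableTopology G] [MeasurableSpace G] [BorelSpace G] [TopologicalSpace X]
  {𝓖 : TopGroupoid G X} (haar : HaarSystem 𝓖)

instance (u : X) : IsFiniteMeasureOnCompacts (haar.μ u) :=
  ⟨fun K hK => haar.finite_of_compact u K hK⟩

theorem ae_range_eq (u : X) : ∀ᵐ γ ∂haar.μ u, 𝓖.r γ = u := by
  have h := Measure.support_mem_ae (μ := haar.μ u)
  rwa [haar.support_eq] at h

theorem lintegral_coMeasure (u : X) {f : G → ℝ≥0∞} (hf : Measurable f) :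
    ∫⁻ γ, f γ ∂haar.coMeasure u = ∫⁻ γ, f (𝓖.inv γ) ∂haar.μ u :=
  lintegral_map hf 𝓖.continuous_inv.measurable

/-- The measures `λ^u` of a fixed compact set are bounded uniformly in `u`. -/
theorem exists_measure_le [T2Space X] {K : Set G} (hK : IsCompact K) :
    ∃ M : ℝ, 0 ≤ M ∧ ∀ u, haar.μ u K ≤ ENNReal.ofReal M := by
  obtain ⟨f, h1, -, hc, h01⟩ := exists_continuous_one_zero_of_isCompact hK isClosed_empty
    (disjoint_empty _)
  have hcont := haar.continuous_integral f f.continuous hc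
  obtain ⟨M, hM⟩ := ((hc.isCompact.image 𝓖.continuous_r).image hcont).bddAbove
  have hle : ∀ u, haar.μ u K ≤ ENNReal.ofReal (∫ γ, f γ ∂haar.μ u) := fun u => by
    rw [ofReal_integral_eq_lintegral_ofReal (f.continuous.integrable_of_hasCompactSupport hc)
      (ae_of_all _ fun γ => (h01 γ).1), ← lintegral_indicator_one hK.measurableSet]
    refine lintegral_mono fun γ => ?_
    by_cases hγ : γ ∈ K
    · simp [hγ, show f γ = 1 from h1 hγ]
    · simp [hγ]
  refine ⟨max M 0, le_max_right _ _, fun u => (hle u).trans (ENNReal.ofReal_le_ofReal ?_)⟩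
  by_cases hu : u ∈ 𝓖.r '' tsupport f
  · exact (hM (mem_image_of_mem _ hu)).trans (le_max_left _ _)
  · rw [integral_eq_zero_of_ae]
    · exact le_max_right _ _
    · filter_upwards [haar.ae_range_eq u] with γ hγ
      exact image_eq_zero_of_notMem_tsupport fun h => hu ⟨γ, h, hγ⟩

/-- Open sets have lower semicontinuous measure, by inner approximation with compactly supported
functions. -/
theorem lowerSemicontinuous_measure [T2Space X] {O : Set G} (hO : IsOpen O) :
    LowerSemicontinuous fun u => haar.μ u O := by
  intro u c hc
  obtain ⟨K, hKO, hK, hcK⟩ := hO.exists_lt_isCompact hc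
  obtain ⟨f, h1, hfc, hfO, h01⟩ := exists_continuousMap_one_of_isCompact_subset_isOpen hK hO hKO
  have hint : ∀ v, Integrable f (haar.μ v) := fun v =>
    f.continuous.integrable_of_hasCompactSupport hfc
  have hle : haar.μ u K ≤ ENNReal.ofReal (∫ γ, f γ ∂haar.μ u) := by
    rw [ofReal_integral_eq_lintegral_ofReal (hint u)
      (ae_of_all _ fun γ => (h01 γ).1), ← lintegral_indicator_one hK.measurableSet]
    refine lintegral_mono fun γ => ?_
    by_cases hγ : γ ∈ K
    · simp [hγ, show f γ = 1 from h1 hγ]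
    · simp [hγ]
  have hcont : Continuous fun v => ENNReal.ofReal (∫ γ, f γ ∂haar.μ v) :=
    ENNReal.continuous_ofReal.comp (haar.continuous_integral f f.continuous hfc)
  filter_upwards [hcont.continuousAt.eventually_const_lt (hcK.trans_le hle)] with v hv
  refine hv.trans_le ?_
  rw [ofReal_integral_eq_lintegral_ofReal (hint v) (ae_of_all _ fun γ => (h01 γ).1),
    ← lintegral_indicator_one hO.measurableSet]
  refine lintegral_mono fun γ => ?_
  by_cases hγ : γ ∈ O
  · simpa [hγ] using (h01 γ).2
  · have : f γ = 0 := image_eq_zero_of_notMem_tsupport fun h => hγ (hfO h)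
    simp [this]

section Kernel

variable [MeasurableSpace X] [BorelSpace X]

/-- `u ↦ λ^u(B)` is Borel for every Borel set `B`: it is lower semicontinuous for open `B`. -/
theorem measurable_μ [T2Space X] : Measurable haar.μ := by
  let K := CompactExhaustion.choice G
  have h1 : ∀ n, Measurable fun u => (haar.μ u).restrict (interior (K n)) := fun n => by
    have hfin : ∀ u, IsFiniteMeasure ((haar.μ u).restrict (interior (K n))) := fun u =>
      ⟨by
        rw [Measure.restrict_apply_univ]
        exact (measure_mono interior_subset).trans_lt (haar.finite_of_compact u _ (K.isCompact n))⟩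
    have hopen : ∀ O : Set G, IsOpen O →
        Measurable fun u => (haar.μ u).restrict (interior (K n)) O := fun O hO => by
      simp_rw [Measure.restrict_apply hO.measurableSet]
      exact (haar.lowerSemicontinuous_measure (hO.inter isOpen_interior)).measurable
    exact Measurable.measure_of_isPiSystem (S := {s | IsOpen s}) BorelSpace.measurable_eq
      isPiSystem_isOpen hopen (hopen _ isOpen_univ)
  refine Measure.measurable_of_measurable_coe _ fun s hs => ?_
  have h2 : ∀ u, haar.μ u s = ⨆ n, (haar.μ u).restrict (interior (K n)) s := fun u => by
    simp_rw [Measure.restrict_apply hs]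
    have hU : ⋃ n, interior (K n) = univ := eq_univ_of_forall fun x => by
      obtain ⟨n, hn⟩ := K.exists_mem x
      exact mem_iUnion.2 ⟨n + 1, K.subset_interior_succ n hn⟩
    have hmono : Monotone fun n => s ∩ interior (K n) := fun i j hij =>
      inter_subset_inter_right _ (interior_mono (K.subset hij))
    rw [← hmono.measure_iUnion, ← inter_iUnion, hU, inter_univ]
  simp_rw [h2]
  exact Measurable.iSup fun n => (Measure.measurable_coe hs).comp (h1 n)

/-- The Haar system as a kernel from the unit space to the arrow space. -/
noncomputable def kernel [T2Space X] : ProbabilityTheory.Kernel X G := ⟨haar.μ, haar.measurable_μ⟩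

instance [T2Space X] : ProbabilityTheory.IsSFiniteKernel haar.kernel := by
  let K := CompactExhaustion.choice G
  have hm : ∀ n, MeasurableSet (disjointed K n) :=
    MeasurableSet.disjointed fun n => (K.isCompact n).measurableSet
  refine ⟨fun n => haar.kernel.restrict (hm n), fun n => ?_, ?_⟩
  · obtain ⟨M, -, hM⟩ := haar.exists_measure_le (K.isCompact n)
    refine ⟨⟨ENNReal.ofReal M, ENNReal.ofReal_lt_top, fun u => ?_⟩⟩
    rw [ProbabilityTheory.Kernel.restrict_apply, Measure.restrict_apply_univ]
    exact (measure_mono (disjointed_subset _ _)).trans (hM u)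
  · refine ProbabilityTheory.Kernel.ext fun u => ?_
    rw [ProbabilityTheory.Kernel.sum_apply]
    simp_rw [ProbabilityTheory.Kernel.restrict_apply]
    rw [← Measure.restrict_iUnion (disjoint_disjointed _) hm, iUnion_disjointed, K.iUnion_eq,
      Measure.restrict_univ]

instance [T2Space X] (u : X) : SFinite (haar.μ u) := inferInstanceAs (SFinite (haar.kernel u))

theorem measurable_coMeasure [T2Space X] : Measurable haar.coMeasure :=
  (Measure.measurable_map _ 𝓖.continuous_inv.measurable).comp haar.measurable_μ

theorem lintegral_nuInv [T2Space X] (μ : Measure X) {f : G → ℝ≥0∞} (hf : Measurable f) :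
    ∫⁻ γ, f γ ∂haar.nuInv μ = ∫⁻ u, ∫⁻ γ, f (𝓖.inv γ) ∂haar.μ u ∂μ := by
  rw [nuInv, Measure.lintegral_bind haar.measurable_coMeasure.aemeasurable hf.aemeasurable]
  simp_rw [haar.lintegral_coMeasure _ hf]

theorem ae_nuInv_of_ae [T2Space X] {μ : Measure X} {p : X → Prop} (h : ∀ᵐ u ∂μ, p u) :
    ∀ᵐ γ ∂haar.nuInv μ, p (𝓖.s γ) := by
  obtain ⟨N, hN, hNm, hN0⟩ := exists_measurable_superset_of_null (ae_iff.1 h)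
  refine ae_iff.2 (measure_mono_null (t := 𝓖.s ⁻¹' N) (fun γ hγ => hN hγ) ?_)
  have hm : MeasurableSet (𝓖.s ⁻¹' N) := 𝓖.continuous_s.measurable hNm
  rw [← lintegral_indicator_one hm, haar.lintegral_nuInv μ (measurable_one.indicator hm)]
  refine lintegral_eq_zero_of_ae_eq_zero ?_
  have : ∀ᵐ u ∂μ, u ∉ N := measure_eq_zero_iff_ae_notMem.1 hN0
  filter_upwards [this] with u hu
  refine lintegral_eq_zero_of_ae_eq_zero ?_
  filter_upwards [haar.ae_range_eq u] with γ hγ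
  simp [𝓖.s_inv, hγ, hu]

end Kernel

theorem measurable_cmul_left [T2Space X] (γ : G) : Measurable fun η => 𝓖.cmul γ η :=
  TopGroupoid.measurable_cmul.comp measurable_prodMk_left

/-- Left translation by `γ` carries `λ^{s γ}` to `λ^{r γ}`. -/
theorem map_cmul [T2Space X] (γ : G) :
    (haar.μ (𝓖.s γ)).map (fun η => 𝓖.cmul γ η) = haar.μ (𝓖.r γ) := by
  classical
  have hm := measurable_cmul_left (𝓖 := 𝓖) γ
  -- the image measure is Radon, so it is determined by integrals of compactly supported functions
  have hfin : IsFiniteMeasureOnCompacts ((haar.μ (𝓖.s γ)).map (fun η => 𝓖.cmul γ η)) := by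
    refine ⟨fun K hK => ?_⟩
    rw [Measure.map_apply hm hK.measurableSet]
    have hK' : IsCompact (K ∩ {η | 𝓖.r γ = 𝓖.r η}) :=
      hK.inter_right (isClosed_eq continuous_const 𝓖.continuous_r)
    have himg : IsCompact ((fun η => 𝓖.cmul (𝓖.inv γ) η) '' (K ∩ {η | 𝓖.r γ = 𝓖.r η})) := by
      refine hK'.image_of_continuousOn ?_
      exact TopGroupoid.continuousOn_cmul.comp (f := fun η => (𝓖.inv γ, η))
        (Continuous.prodMk_right _).continuousOn fun η hη => (𝓖.s_inv γ).trans hη.2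
    refine lt_of_le_of_lt (measure_mono_ae ?_) (haar.finite_of_compact (𝓖.s γ) _ himg)
    filter_upwards [haar.ae_range_eq (𝓖.s γ)] with η hη hηK
    exact ⟨_, ⟨hηK, by simp⟩, TopGroupoid.inv_cmul_cmul hη.symm⟩
  refine Measure.ext_of_integral_eq_on_compactlySupported fun f => ?_
  rw [integral_map (f := fun x => f x) hm.aemeasurable f.continuous.aestronglyMeasurable,
    ← haar.left_invariant γ f f.continuous f.hasCompactSupport]
  refine integral_congr_ae ?_
  filter_upwards [haar.ae_range_eq (𝓖.s γ)] with η hη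
  rw [dif_pos hη.symm, TopGroupoid.cmul_eq hη.symm]

theorem lintegral_cmul [T2Space X] (γ : G) {f : G → ℝ≥0∞} (hf : Measurable f) :
    ∫⁻ η, f (𝓖.cmul γ η) ∂haar.μ (𝓖.s γ) = ∫⁻ η, f η ∂haar.μ (𝓖.r γ) := by
  rw [← haar.map_cmul γ, lintegral_map hf (measurable_cmul_left γ)]

section Bochner

variable {F : Type*} [NormedAddCommGroup F] [T2Space X]

theorem map_inv_cmul (γ : G) :
    (haar.μ (𝓖.r γ)).map (fun η => 𝓖.cmul (𝓖.inv γ) η) = haar.μ (𝓖.s γ) := by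
  have := haar.map_cmul (𝓖.inv γ)
  rwa [𝓖.s_inv, 𝓖.r_inv] at this

/-- Two functions matched by left translation have the same integrability. -/
theorem integrable_translate {γ : G} {f g : G → F}
    (hf : AEStronglyMeasurable f (haar.μ (𝓖.s γ)))
    (h : ∀ η, 𝓖.r η = 𝓖.s γ → g (𝓖.cmul γ η) = f η) :
    Integrable g (haar.μ (𝓖.r γ)) ↔ Integrable f (haar.μ (𝓖.s γ)) := by
  rw [← haar.map_inv_cmul γ] at hf ⊢
  rw [integrable_map_measure hf (measurable_cmul_left _).aemeasurable]
  refine integrable_congr ?_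
  filter_upwards [haar.ae_range_eq (𝓖.r γ)] with η hη
  rw [Function.comp_apply, ← h _ (by rw [TopGroupoid.r_cmul, 𝓖.r_inv]),
    TopGroupoid.cmul_inv_cmul hη.symm]

/-- Two functions matched by left translation have the same integral. -/
theorem integral_translate [NormedSpace ℝ F] {γ : G} {f g : G → F}
    (hf : AEStronglyMeasurable f (haar.μ (𝓖.s γ)))
    (h : ∀ η, 𝓖.r η = 𝓖.s γ → g (𝓖.cmul γ η) = f η) :
    ∫ η, g η ∂haar.μ (𝓖.r γ) = ∫ η, f η ∂haar.μ (𝓖.s γ) := by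
  rw [← haar.map_inv_cmul γ] at hf ⊢
  rw [integral_map (measurable_cmul_left _).aemeasurable hf]
  refine integral_congr_ae ?_
  filter_upwards [haar.ae_range_eq (𝓖.r γ)] with η hη
  rw [← h _ (by rw [TopGroupoid.r_cmul, 𝓖.r_inv]), TopGroupoid.cmul_inv_cmul hη.symm]

end Bochner

end HaarSystem

/-! ### Integration of sections along the range fibres -/

section FibreIntegration

variable {X : Type*} [TopologicalSpace X] {A : X → Type*} [∀ x, NonUnitalCStarAlgebra (A x)]
  [TopologicalSpace (TotalSpace ℂ A)] [IsUSCCStarBundle A]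

theorem Bundle.continuousOn_toFibre {Y : Type*} [TopologicalSpace Y] {q : Y → X} {B : ∀ y, A (q y)}
    (hB : Continuous fun y => (⟨q y, B y⟩ : TotalSpace ℂ A)) (u : X) :
    ContinuousOn (fun y => toFibre u (B y)) {y | q y = u} := by
  intro y hy
  refine tendsto_fibre_iff.1 ?_
  rw [mk_toFibre (show q y = u from hy)]
  refine ((hB.tendsto y).mono_left nhdsWithin_le_nhds).congr' ?_
  filter_upwards [self_mem_nhdsWithin] with z hz
  exact (mk_toFibre hz _).symm

theorem Bundle.aestronglyMeasurable_toFibre [T1Space X] {Y : Type*} [TopologicalSpace Y]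
    [SecondCountableTopology Y] [MeasurableSpace Y] [OpensMeasurableSpace Y] {q : Y → X}
    {B : ∀ y, A (q y)} (hB : Continuous fun y => (⟨q y, B y⟩ : TotalSpace ℂ A)) {u : X}
    {m : Measure Y} (hm : ∀ᵐ y ∂m, q y = u) :
    AEStronglyMeasurable (fun y => toFibre u (B y)) m := by
  have hq : Continuous q := (IsUSCCStarBundle.continuous_proj (A := A)).comp hB
  have hs : MeasurableSet {y | q y = u} := (isClosed_singleton.preimage hq).measurableSet
  have := (continuousOn_toFibre hB u).aestronglyMeasurable (μ := m) hs
  rwa [Measure.restrict_eq_self_of_ae_mem (s := {y | q y = u}) hm] at this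

variable {G : Type*} [TopologicalSpace G] {𝓖 : TopGroupoid G X}

theorem onFibre_eq (F : ∀ γ, A (𝓖.r γ)) (u : X) (γ : G) : onFibre 𝓖 F u γ = toFibre u (F γ) := rfl

theorem IsCompactSection.eq_zero {f : ∀ γ, A (𝓖.r γ)} {γ : G}
    (hγ : γ ∉ closure {γ | f γ ≠ 0}) : f γ = 0 := by
  by_contra h
  exact hγ (subset_closure h)

theorem isCompactSection_of_isCompact [T2Space G] {f : ∀ γ, A (𝓖.r γ)}
    (hf : Continuous fun γ => (⟨𝓖.r γ, f γ⟩ : TotalSpace ℂ A)) {K : Set G} (hK : IsCompact K)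
    (h0 : ∀ γ ∉ K, f γ = 0) : IsCompactSection 𝓖 f :=
  ⟨hf, hK.of_isClosed_subset isClosed_closure (closure_minimal
    (fun γ hγ => by by_contra h; exact hγ (h0 γ h)) hK.isClosed)⟩

variable [T2Space G] [LocallyCompactSpace G]
  [SecondCountableTopology G] [MeasurableSpace G] [BorelSpace G] (haar : HaarSystem 𝓖)

theorem integrable_onFibre [T1Space X] {f : ∀ γ, A (𝓖.r γ)}
    (hf : Continuous fun γ => (⟨𝓖.r γ, f γ⟩ : TotalSpace ℂ A)) {K : Set G} (hK : IsCompact K)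
    {u : X} (h0 : ∀ γ ∉ K, 𝓖.r γ = u → f γ = 0) : Integrable (onFibre 𝓖 f u) (haar.μ u) := by
  obtain ⟨M, hM, hle⟩ := Bundle.exists_norm_le_of_isCompact hf hK
  have hint : Integrable (K.indicator fun _ => M) (haar.μ u) :=
    (integrable_indicator_iff hK.measurableSet).2
      (integrableOn_const (haar.finite_of_compact u K hK).ne)
  refine hint.mono' (Bundle.aestronglyMeasurable_toFibre hf (haar.ae_range_eq u)) ?_
  filter_upwards [haar.ae_range_eq u] with γ hγ
  rw [onFibre_eq, norm_toFibre hγ]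
  by_cases h : γ ∈ K
  · simpa [h] using hle γ h
  · simp [h, h0 γ h hγ]

/-- Compactly supported continuous sections of `r^*𝒜` are integrable. -/
theorem IsCompactSection.isIIntegrable [T2Space X] {f : ∀ γ, A (𝓖.r γ)}
    (hf : IsCompactSection 𝓖 f) : IsIIntegrable haar f := by
  set K := closure {γ | f γ ≠ 0} with hKdef
  have hK : IsCompact K := hf.2
  have hm := Bundle.measurable_norm hf.1
  refine ⟨hm, ?_⟩
  obtain ⟨C, hC, hle⟩ := Bundle.exists_norm_le_of_isCompact hf.1 hK
  have hbound : ∀ γ, ‖f γ‖ₑ ≤ K.indicator (fun _ => ENNReal.ofReal C) γ := fun γ => by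
    by_cases h : γ ∈ K
    · rw [indicator_of_mem h, ← ofReal_norm]
      exact ENNReal.ofReal_le_ofReal (hle γ h)
    · simp [h, IsCompactSection.eq_zero h]
  have hlt : ∀ m : X → Measure G, (∃ M : ℝ, 0 ≤ M ∧ ∀ u, m u K ≤ ENNReal.ofReal M) →
      ⨆ u, ∫⁻ γ, ‖f γ‖ₑ ∂m u < ∞ := by
    rintro m ⟨M, -, hM⟩
    refine (iSup_le (a := ENNReal.ofReal C * ENNReal.ofReal M) fun u => ?_).trans_lt
      (ENNReal.mul_lt_top ENNReal.ofReal_lt_top ENNReal.ofReal_lt_top)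
    calc ∫⁻ γ, ‖f γ‖ₑ ∂m u ≤ ∫⁻ γ, K.indicator (fun _ => ENNReal.ofReal C) γ ∂m u :=
          lintegral_mono hbound
      _ = ENNReal.ofReal C * m u K := lintegral_indicator_const hK.measurableSet _
      _ ≤ _ := by gcongr; exact hM u
  refine max_lt (hlt _ ?_) (hlt _ (haar.exists_measure_le hK))
  have hK' : IsCompact (𝓖.inv '' K) := hK.image 𝓖.continuous_inv
  obtain ⟨M, hM0, hM⟩ := haar.exists_measure_le hK'
  refine ⟨M, hM0, fun u => (le_of_eq ?_).trans (hM u)⟩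
  rw [HaarSystem.coMeasure, Measure.map_apply 𝓖.continuous_inv.measurable hK.measurableSet]
  congr 1
  ext γ
  exact ⟨fun h => ⟨𝓖.inv γ, h, by simp⟩, by rintro ⟨η, hη, rfl⟩; simpa using hη⟩

/-- Integration along the range fibres carries compactly supported continuous sections of `r^*𝒜` to
continuous sections of `𝒜`. -/
theorem isContSection_integral [T2Space X] [LocallyCompactSpace X] {f : ∀ γ, A (𝓖.r γ)}
    (hf : IsCompactSection 𝓖 f) :
    IsContSection fun u => ∫ γ, onFibre 𝓖 f u γ ∂haar.μ u := by
  set K := closure {γ | f γ ≠ 0} with hKdef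
  have hK : IsCompact K := hf.2
  obtain ⟨K', hK', hKK'⟩ := exists_compact_superset hK
  obtain ⟨M, hM0, hM⟩ := haar.exists_measure_le hK'
  -- `f` is uniformly close to combinations `∑ φᵢ(γ) aᵢ(r γ)`, whose integrals are `∑ λ(φᵢ) aᵢ`
  have key : ∀ ε > 0, ∃ C : ∀ x, A x, IsContSection C ∧
      ∀ u, ‖∫ γ, onFibre 𝓖 f u γ ∂haar.μ u - C u‖ ≤ ε * M := by
    intro ε hε
    have hloc : ∀ γ : G, ∃ a : ∀ x, A x, IsContSection a ∧ ‖a (𝓖.r γ) - f γ‖ < ε := fun γ => by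
      obtain ⟨a, ha⟩ := exists_sectionAlgebra_norm_sub_lt (𝓖.r γ) (f γ) hε
      exact ⟨a, a.isContSection, ha⟩
    choose a hac ha using hloc
    have hcont : ∀ γ, Continuous fun η => (⟨𝓖.r η, a γ (𝓖.r η) - f η⟩ : TotalSpace ℂ A) :=
      fun γ => continuous_iff_continuousAt.2 fun η => Bundle.tendsto_sub
        (((hac γ).comp 𝓖.continuous_r).tendsto η) (hf.1.tendsto η)
    let U : G → Set G := fun γ => {η | ‖a γ (𝓖.r η) - f η‖ < ε} ∩ interior K'
    have hUo : ∀ γ, IsOpen (U γ) := fun γ =>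
      ((IsUSCCStarBundle.norm_usc (A := A) ε hε).preimage (hcont γ)).inter isOpen_interior
    obtain ⟨t, ht⟩ := hK.elim_finite_subcover U hUo fun γ hγ => mem_iUnion.2 ⟨γ, ha γ, hKK' hγ⟩
    obtain ⟨ρ, hρ, hρc⟩ := PartitionOfUnity.exists_isSubordinate_of_locallyFinite_t2space hK
      (fun i : t => U i) (fun i => hUo i) (locallyFinite_of_finite _)
      (by simpa [iUnion_subtype] using ht)
    have hsum : ∀ y, ∑ᶠ i, ρ i y = ∑ i, ρ i y := fun y => finsum_eq_sum_of_fintype _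
    have hint : ∀ i u, Integrable (fun γ => (ρ i γ : ℂ) • a i u) (haar.μ u) := fun i u =>
      (((ρ i).continuous.integrable_of_hasCompactSupport (hρc i)).ofReal).smul_const _
    refine ⟨fun u => ∑ i, ((∫ γ, ρ i γ ∂haar.μ u : ℝ) : ℂ) • a i u, ?_, fun u => ?_⟩
    · refine continuous_iff_continuousAt.2 fun u => ?_
      refine Bundle.tendsto_sum _ tendsto_id fun i _ => Bundle.tendsto_smul ?_
        ((hac i).tendsto u)
      exact (Complex.continuous_ofReal.comp
        (haar.continuous_integral _ (ρ i).continuous (hρc i))).tendsto u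
    · beta_reduce
      have h1 : ∑ i, ((∫ γ, ρ i γ ∂haar.μ u : ℝ) : ℂ) • a i u =
          ∫ γ, ∑ i, (ρ i γ : ℂ) • a i u ∂haar.μ u := by
        rw [integral_finsetSum _ fun i _ => hint i u]
        refine Finset.sum_congr rfl fun i _ => ?_
        rw [integral_smul_const]
        congr 1
        exact integral_ofReal.symm
      rw [h1, ← integral_sub (integrable_onFibre haar hf.1 hK
        fun γ hγ _ => IsCompactSection.eq_zero hγ) (integrable_finsetSum _ fun i _ => hint i u)]
      have hintK : Integrable (K'.indicator fun _ => ε) (haar.μ u) :=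
        (integrable_indicator_iff hK'.measurableSet).2
          (integrableOn_const (haar.finite_of_compact u K' hK').ne)
      refine (norm_integral_le_of_norm_le hintK ?_).trans ?_
      · filter_upwards [haar.ae_range_eq u] with γ hγ
        subst hγ
        rw [onFibre_eq, toFibre_self]
        have h2 : f γ = ∑ i, (ρ i γ : ℂ) • f γ := by
          by_cases hγ : γ ∈ K
          · rw [← Finset.sum_smul, ← Complex.ofReal_sum, ← hsum, ρ.sum_eq_one hγ,
              Complex.ofReal_one, one_smul]
          · simp [IsCompactSection.eq_zero hγ]
        have h3 : f γ - ∑ i, (ρ i γ : ℂ) • a i (𝓖.r γ) =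
            ∑ i, (ρ i γ : ℂ) • (f γ - a i (𝓖.r γ)) := by
          simp_rw [smul_sub, Finset.sum_sub_distrib]
          rw [← h2]
        have hterm : ∀ i, ‖(ρ i γ : ℂ) • (f γ - a i (𝓖.r γ))‖ ≤ ρ i γ * ε := fun i => by
          rw [norm_smul, Complex.norm_real, Real.norm_of_nonneg (ρ.nonneg i γ)]
          by_cases hx : ρ i γ = 0
          · simp [hx]
          · refine mul_le_mul_of_nonneg_left ?_ (ρ.nonneg i γ)
            rw [norm_sub_rev]
            exact (hρ i (subset_tsupport _ hx)).1.le
        rw [h3]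
        by_cases hγ : γ ∈ K'
        · rw [indicator_of_mem hγ]
          refine (norm_sum_le_of_le _ fun i _ => hterm i).trans ?_
          rw [← Finset.sum_mul, ← hsum]
          exact mul_le_of_le_one_left hε.le (ρ.sum_le_one γ)
        · rw [indicator_of_notMem hγ]
          refine le_of_eq (norm_eq_zero.2 (Finset.sum_eq_zero fun i _ => ?_))
          have : ρ i γ = 0 := by
            by_contra hx
            exact hγ (interior_subset (hρ i (subset_tsupport _ hx)).2)
          simp [this]
      · rw [integral_indicator_const _ hK'.measurableSet, smul_eq_mul, mul_comm]
        exact mul_le_mul_of_nonneg_left (ENNReal.toReal_le_of_le_ofReal hM0 (hM u)) hε.le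
  refine continuous_iff_continuousAt.2 fun u => Bundle.tendsto_of_uniform fun ε hε => ?_
  obtain ⟨C, hC, hle⟩ := key (ε / (M + 1)) (by positivity)
  have hlt : ε / (M + 1) * M < ε := by
    rw [div_mul_eq_mul_div, div_lt_iff₀ (by positivity)]
    exact mul_lt_mul_of_pos_left (lt_add_one M) hε
  exact ⟨C, C u, hC.tendsto u, Eventually.of_forall fun v => (hle v).trans_lt hlt,
    (hle u).trans_lt hlt⟩

end FibreIntegration

/-! ### The averaging map -/

section Averaging

variable {G X : Type*} [TopologicalSpace G] [TopologicalSpace X] {𝓖 : TopGroupoid G X}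
  {A : X → Type*} [∀ x, NonUnitalCStarAlgebra (A x)] [TopologicalSpace (TotalSpace ℂ A)]
  (S : GroupoidAction 𝓖 A)

namespace GroupoidAction

/-- The isomorphism `α_γ` as a continuous linear map. -/
noncomputable def clm (γ : G) : A (𝓖.s γ) →L[ℂ] A (𝓖.r γ) :=
  LinearMap.mkContinuous (S.α γ : A (𝓖.s γ) →ₗ[ℂ] A (𝓖.r γ)) 1 fun a => by
    rw [one_mul]; exact (norm_map a).le

@[simp] theorem clm_apply (γ : G) (a : A (𝓖.s γ)) : S.clm γ a = S.α γ a := rfl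

theorem toFibre_act (γ : G) (p : TotalSpace ℂ A) :
    toFibre (𝓖.r γ) (S.act γ p).snd = S.α γ (toFibre (𝓖.s γ) p.snd) :=
  toFibre_self _

/-- Translation of a section of the form `γ ↦ α_γ(a(s γ))` in the source variable. -/
theorem toFibre_map_cmul {γ η : G} (h : 𝓖.s γ = 𝓖.r η) (a : ∀ x, A x) :
    toFibre (𝓖.r γ) (S.α (𝓖.cmul γ η) (a (𝓖.s (𝓖.cmul γ η)))) =
      S.α γ (toFibre (𝓖.s γ) (S.α η (a (𝓖.s η)))) := by
  have h1 : (⟨_, S.α (𝓖.cmul γ η) (a (𝓖.s (𝓖.cmul γ η)))⟩ : TotalSpace ℂ A) =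
      S.act γ ⟨_, S.α η (a (𝓖.s η))⟩ := by
    rw [← act_mk, ← act_mk, TopGroupoid.s_cmul h, act_cmul h rfl]
  rw [← toFibre_act S γ ⟨_, S.α η (a (𝓖.s η))⟩, ← h1]

variable [IsUSCCStarBundle A] [T2Space G] [LocallyCompactSpace G]
  [SecondCountableTopology G] [MeasurableSpace G] [BorelSpace G] (haar : HaarSystem 𝓖)
  [T2Space X] {S}

theorem isCompact_preimage_of_isProper (hG : 𝓖.IsProper) {K L : Set X} (hK : IsCompact K)
    (hL : IsCompact L) : IsCompact {γ | 𝓖.r γ ∈ K ∧ 𝓖.s γ ∈ L} :=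
  hG.isCompact_preimage (hK.prod hL)

theorem integrable_averaging (hG : 𝓖.IsProper) {a : ∀ x, A x} (ha : IsContSection a) {K : Set X}
    (hK : IsCompact K) (h0 : ∀ x ∉ K, a x = 0) (u : X) :
    Integrable (onFibre 𝓖 (fun γ => S.α γ (a (𝓖.s γ))) u) (haar.μ u) := by
  refine integrable_onFibre haar (continuous_map ha)
    (isCompact_preimage_of_isProper hG (isCompact_singleton (x := u)) hK) fun γ hγ hu => ?_
  rw [h0 _ fun h => hγ ⟨hu, h⟩, map_zero]

/-- Averages are continuous sections: properness of `G` makes the averaged section compactly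
supported over compact sets of units. -/
theorem isContSection_averaging [LocallyCompactSpace X] (hG : 𝓖.IsProper) {a : ∀ x, A x}
    (ha : IsContSection a) {K : Set X} (hK : IsCompact K) (h0 : ∀ x ∉ K, a x = 0) :
    IsContSection (S.averaging haar a) := by
  refine continuous_iff_continuousAt.2 fun u => ?_
  obtain ⟨V, hV, huV⟩ := exists_compact_mem_nhds u
  obtain ⟨φ, h1, -, hφc, -⟩ := exists_continuous_one_zero_of_isCompact hV isClosed_empty
    (disjoint_empty _)
  -- near `u` the integrand may be cut off to have compact support
  have hf : IsCompactSection 𝓖 fun γ => (φ (𝓖.r γ) : ℂ) • S.α γ (a (𝓖.s γ)) := by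
    refine isCompactSection_of_isCompact ?_ (isCompact_preimage_of_isProper hG hφc hK) ?_
    · exact continuous_iff_continuousAt.2 fun γ => Bundle.tendsto_smul
        ((Complex.continuous_ofReal.comp (φ.continuous.comp 𝓖.continuous_r)).tendsto γ)
        ((continuous_map (S := S) ha).tendsto γ)
    · intro γ hγ
      by_cases h : 𝓖.s γ ∈ K
      · have : φ (𝓖.r γ) = 0 := image_eq_zero_of_notMem_tsupport fun h' => hγ ⟨h', h⟩
        rw [this, Complex.ofReal_zero, zero_smul]
      · rw [h0 _ h, map_zero, smul_zero]
  refine ((isContSection_integral haar hf).continuousAt (x := u)).congr ?_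
  filter_upwards [huV] with v hv
  congr 1
  refine integral_congr_ae ?_
  filter_upwards [haar.ae_range_eq v] with γ hγ
  have : φ (𝓖.r γ) = 1 := by rw [hγ]; exact h1 hv
  rw [onFibre_eq, onFibre_eq, this, Complex.ofReal_one, one_smul]

/-- Averages are invariant, by left invariance of the Haar system. -/
theorem averaging_range (hG : 𝓖.IsProper) {a : ∀ x, A x}
    (ha : IsContSection a) {K : Set X} (hK : IsCompact K) (h0 : ∀ x ∉ K, a x = 0) (γ : G) :
    S.averaging haar a (𝓖.r γ) = S.α γ (S.averaging haar a (𝓖.s γ)) := by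
  have hint := integrable_averaging (S := S) haar hG ha hK h0 (𝓖.s γ)
  rw [averaging, averaging, ← clm_apply, ← ContinuousLinearMap.integral_comp_comm _ hint]
  refine haar.integral_translate
    ((S.clm γ).continuous.comp_aestronglyMeasurable hint.aestronglyMeasurable) fun η hη => ?_
  exact S.toFibre_map_cmul hη.symm a

theorem averaging_eq_zero {a : ∀ x, A x} {K : Set X} (h0 : ∀ x ∉ K, a x = 0) {u : X}
    (hu : ∀ γ, 𝓖.r γ = u → 𝓖.s γ ∉ K) : S.averaging haar a u = 0 := by
  refine integral_eq_zero_of_ae ?_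
  filter_upwards [haar.ae_range_eq u] with γ hγ
  rw [onFibre_eq, h0 _ (hu γ hγ), map_zero, toFibre_zero]
  rfl

theorem isInduced_averaging [LocallyCompactSpace X] (hG : 𝓖.IsProper) {a : ∀ x, A x}
    (ha : IsContSection a) {K : Set X} (hK : IsCompact K) (h0 : ∀ x ∉ K, a x = 0) :
    S.IsInduced (S.averaging haar a) := by
  have hc := isContSection_averaging (S := S) haar hG ha hK h0
  have hinv := averaging_range (S := S) haar hG ha hK h0
  have hnorm : ∀ γ, ‖S.averaging haar a (𝓖.r γ)‖ = ‖S.averaging haar a (𝓖.s γ)‖ := fun γ => by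
    rw [hinv, norm_map]
  refine ⟨hc, ?_, fun γ => ?_, fun ε hε => ?_⟩
  · -- the norm is constant on orbits, and only orbits meeting `K` contribute
    obtain ⟨M, hM, hle⟩ := Bundle.exists_norm_le_of_isCompact hc hK
    refine ⟨M, fun u => ?_⟩
    by_cases hu : ∀ γ, 𝓖.r γ = u → 𝓖.s γ ∉ K
    · rw [averaging_eq_zero haar h0 hu, norm_zero]
      exact hM
    · push Not at hu
      obtain ⟨γ, rfl, hγ⟩ := hu
      rw [hnorm]
      exact hle _ hγ
  · rw [hinv]
    exact ((S.α γ).symm_apply_apply _).symm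
  · refine ⟨Quotient.mk 𝓖.orbitSetoid '' K, hK.image continuous_quot_mk, fun u hu => ?_⟩
    rw [averaging_eq_zero haar h0, norm_zero]
    · exact hε
    · rintro γ rfl hγ
      exact hu ⟨_, hγ, Quotient.sound ⟨𝓖.inv γ, 𝓖.r_inv γ, 𝓖.s_inv γ⟩⟩

end GroupoidAction

end Averaging

/-! ### Multipliers given by bounded continuous sections -/

section Multipliers

variable {X : Type*} [TopologicalSpace X] {A : X → Type*} [∀ x, NonUnitalCStarAlgebra (A x)]
  [TopologicalSpace (TotalSpace ℂ A)] [IsUSCCStarBundle A]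

theorem SectionAlgebra.ext {a b : SectionAlgebra A} (h : ∀ x, a x = b x) : a = b :=
  Subtype.ext (lp.ext (funext h))

theorem SectionAlgebra.norm_le {a : SectionAlgebra A} {C : ℝ} (hC : 0 ≤ C) (h : ∀ x, ‖a x‖ ≤ C) :
    ‖a‖ ≤ C :=
  lp.norm_le_of_forall_le (f := (a : lp A ∞)) hC h

/-- Fibrewise application of uniformly bounded linear maps that preserve continuity of sections. -/
theorem exists_clm_sectionAlgebra (T : ∀ x, A x →ₗ[ℂ] A x) {C : ℝ}
    (hT : ∀ x a, ‖T x a‖ ≤ C * ‖a‖)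
    (hc : ∀ a : ∀ x, A x, IsContSection a → IsContSection fun x => T x (a x)) :
    ∃ L : SectionAlgebra A →L[ℂ] SectionAlgebra A, ∀ a x, L a x = T x (a x) := by
  have hC : ∀ x a, ‖T x a‖ ≤ |C| * ‖a‖ := fun x a => (hT x a).trans (by gcongr; exact le_abs_self C)
  have hbd : ∀ (a : SectionAlgebra A) x, ‖T x (a x)‖ ≤ |C| * ‖a‖ := fun a x =>
    (hC x _).trans (by gcongr; exact a.norm_apply_le x)
  let L : SectionAlgebra A → SectionAlgebra A := fun a =>
    ⟨⟨fun x => T x (a x), memℓp_infty ⟨|C| * ‖a‖, by rintro _ ⟨x, rfl⟩; exact hbd a x⟩⟩,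
      hc _ a.isContSection, by
        refine squeeze_zero (fun _ => norm_nonneg _) (fun x => hC x _) ?_
        simpa using a.2.2.const_mul |C|⟩
  refine ⟨LinearMap.mkContinuous
    { toFun := L
      map_add' := fun a b => SectionAlgebra.ext fun x => (T x).map_add (a x) (b x)
      map_smul' := fun c a => SectionAlgebra.ext fun x => (T x).map_smul c (a x) } |C|
    fun a => SectionAlgebra.norm_le (by positivity) (hbd a), fun a x => rfl⟩

/-- Pointwise multiplication by a bounded continuous section is a multiplier. -/
theorem exists_isMultiplicationBy {g : ∀ x, A x} (hg : IsContSection g) {C : ℝ}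
    (hC : ∀ x, ‖g x‖ ≤ C) : ∃ d : 𝓜(ℂ, SectionAlgebra A), IsMultiplicationBy g d := by
  obtain ⟨L, hL⟩ := exists_clm_sectionAlgebra (fun x => LinearMap.mulLeft ℂ (g x)) (C := C)
    (fun x a => (norm_mul_le _ _).trans (by gcongr; exact hC x)) fun a ha => hg.mul ha
  obtain ⟨R, hR⟩ := exists_clm_sectionAlgebra (fun x => LinearMap.mulRight ℂ (g x)) (C := C)
    (fun x a => (norm_mul_le _ _).trans
      (by rw [mul_comm]; gcongr; exact hC x)) fun a ha => ha.mul hg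
  refine ⟨⟨(L, R), fun a b => SectionAlgebra.ext fun x => ?_⟩, fun a x => ⟨hL a x, hR a x⟩⟩
  change R a x * b x = a x * L b x
  rw [hL, hR]
  exact mul_assoc _ _ _

/-- A multiplier is determined by the right multiplications of a dense set of elements. -/
theorem multiplier_eq_of_snd_eq {D : Set (SectionAlgebra A)} (hD : Dense D)
    {d d' : 𝓜(ℂ, SectionAlgebra A)} (h : ∀ c ∈ D, d.snd c = d'.snd c) : d = d' := by
  have hsnd : d.snd = d'.snd := ContinuousLinearMap.ext fun c =>
    congrFun (Continuous.ext_on hD d.snd.continuous d'.snd.continuous h) c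
  refine DoubleCentralizer.ext _ _ _ _ (Prod.ext (ContinuousLinearMap.ext fun c => ?_) hsnd)
  have h1 : ∀ b, b * (d.fst c - d'.fst c) = 0 := fun b => by
    rw [mul_sub, ← d.central, ← d'.central, hsnd, sub_self]
  refine sub_eq_zero.1 (SectionAlgebra.ext fun x => ?_)
  have h2 := congrArg (fun e : SectionAlgebra A => e x) (h1 (star (d.fst c - d'.fst c)))
  exact (CStarRing.star_mul_self_eq_zero_iff ((d.fst c - d'.fst c) x)).1 h2

variable (A) in
/-- `C_c(X) · A` is dense in the section algebra. -/
theorem dense_compactMulSubalgebra [T2Space X] [LocallyCompactSpace X] :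
    Dense (compactMulSubalgebra A : Set (SectionAlgebra A)) := by
  refine Metric.dense_iff.2 fun a ε hε => ?_
  have h1 : ∀ᶠ x in cocompact X, ‖a x‖ < ε / 2 := a.2.2.eventually_lt_const (half_pos hε)
  obtain ⟨K, hK, hKa⟩ := mem_cocompact.1 h1
  obtain ⟨φ, hφ1, -, hφc, h01⟩ := exists_continuous_one_zero_of_isCompact hK isClosed_empty
    (disjoint_empty _)
  have hcs : HasCompactSupport fun u => (φ u : ℂ) :=
    HasCompactSupport.comp_left (g := fun t : ℝ => (t : ℂ)) hφc Complex.ofReal_zero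
  have hcont : Continuous fun u => (φ u : ℂ) := Complex.continuous_ofReal.comp φ.continuous
  have hsec : IsContSection fun x => (φ x : ℂ) • a x := continuous_iff_continuousAt.2 fun x =>
    Bundle.tendsto_smul (hcont.tendsto x) (a.isContSection.tendsto x)
  obtain ⟨b, hb⟩ := exists_sectionAlgebra_eq hsec hφc fun x hx => by
    rw [image_eq_zero_of_notMem_tsupport hx, Complex.ofReal_zero, zero_smul]
  refine ⟨b, ?_, ⟨_, a, hcont, hcs, hb⟩⟩
  rw [Metric.mem_ball, dist_eq_norm]
  refine lt_of_le_of_lt (SectionAlgebra.norm_le (half_pos hε).le fun x => ?_) (half_lt_self hε)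
  change ‖b x - a x‖ ≤ ε / 2
  rw [hb]
  by_cases hx : x ∈ K
  · have : φ x = 1 := hφ1 hx
    rw [this, Complex.ofReal_one, one_smul, sub_self, norm_zero]
    positivity
  · have h2 : (φ x : ℂ) • a x - a x = ((φ x - 1 : ℝ) : ℂ) • a x := by
      push_cast
      rw [sub_smul, one_smul]
    have h3 : |φ x - 1| ≤ 1 := abs_le.2 ⟨by linarith [(h01 x).1], by linarith [(h01 x).2]⟩
    rw [h2, norm_smul, Complex.norm_real, Real.norm_eq_abs]
    exact (mul_le_of_le_one_left (norm_nonneg _) h3).trans (show ‖a x‖ < ε / 2 from hKa hx).le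

end Multipliers

/-! ### The proper system and the inner product `⟨a, b⟩_D` -/

section ProperSystem

variable {G X : Type*} [TopologicalSpace G] [TopologicalSpace X] {𝓖 : TopGroupoid G X}
  {A : X → Type*} [∀ x, NonUnitalCStarAlgebra (A x)] [TopologicalSpace (TotalSpace ℂ A)]
  {S : GroupoidAction 𝓖 A} [IsUSCCStarBundle A] [T2Space G] [LocallyCompactSpace G]
  [SecondCountableTopology G] [MeasurableSpace G] [BorelSpace G] (haar : HaarSystem 𝓖)
  [T2Space X] [LocallyCompactSpace X]

namespace GroupoidAction

/-- Multiplication by the average `λ(a^* b)` is a multiplier `⟨a, b⟩_D`. -/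
theorem exists_isInnerD_isMultiplicationBy (hG : 𝓖.IsProper) {a b : SectionAlgebra A}
    (ha : a ∈ compactMulSubalgebra A) (hb : b ∈ compactMulSubalgebra A) :
    ∃ d : 𝓜(ℂ, SectionAlgebra A), S.IsInnerD haar (compactMulSubalgebra A) a b d ∧
      IsMultiplicationBy (S.averaging haar (star a * b : SectionAlgebra A)) d := by
  have hab : star a * b ∈ compactMulSubalgebra A := mul_mem (star_mem ha) hb
  obtain ⟨K, hK, h0⟩ := exists_isCompact_of_mem_compactMulSubalgebra hab
  have hac := (star a * b).isContSection
  have hint := integrable_averaging (S := S) haar hG hac hK h0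
  have hinv := averaging_range (S := S) haar hG hac hK h0
  obtain ⟨hgc, ⟨C, hC⟩, -, -⟩ := isInduced_averaging (S := S) haar hG hac hK h0
  obtain ⟨d, hd⟩ := exists_isMultiplicationBy hgc hC
  refine ⟨d, ⟨⟨?_, ?_⟩, ?_⟩, hd⟩
  · rintro c ⟨f, e, hf, hfc, hce⟩
    refine ⟨f, d.snd e, hf, hfc, fun u => ?_⟩
    rw [(hd _ u).2, (hd _ u).2, hce, smul_mul_assoc]
  · refine ⟨fun u => (S.averaging haar (star a * b : SectionAlgebra A) u : 𝓜(ℂ, A u)),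
      fun u c => ⟨(hd c u).1.symm, (hd c u).2.symm⟩, fun γ => ?_⟩
    have hinv' := hinv γ
    refine DoubleCentralizer.ext _ _ _ _ (Prod.ext (ContinuousLinearMap.ext fun c => ?_)
      (ContinuousLinearMap.ext fun c => ?_))
    · change S.α γ (S.averaging haar (star a * b : SectionAlgebra A) (𝓖.s γ) * (S.α γ).symm c) =
        S.averaging haar (star a * b : SectionAlgebra A) (𝓖.r γ) * c
      rw [hinv', _root_.map_mul]
      congr 1
      exact (S.α γ).apply_symm_apply c
    · change S.α γ ((S.α γ).symm c * S.averaging haar (star a * b : SectionAlgebra A) (𝓖.s γ)) =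
        c * S.averaging haar (star a * b : SectionAlgebra A) (𝓖.r γ)
      rw [hinv', _root_.map_mul]
      congr 1
      exact (S.α γ).apply_symm_apply c
  · intro c _ u
    have heq : ∀ᵐ γ ∂haar.μ u,
        onFibre 𝓖 (fun γ => c (𝓖.r γ) * S.α γ ((star a * b) (𝓖.s γ))) u γ =
        c u * onFibre 𝓖 (fun γ => S.α γ ((star a * b) (𝓖.s γ))) u γ := by
      filter_upwards [haar.ae_range_eq u] with γ hγ
      subst hγ
      rw [onFibre_eq, onFibre_eq, toFibre_self, toFibre_self]
    let L : A u →L[ℂ] A u := ContinuousLinearMap.mul ℂ (A u) (c u)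
    refine ⟨(L.integrable_comp (hint u)).congr (heq.mono fun _ h => h.symm), ?_⟩
    rw [(hd c u).2, integral_congr_ae heq]
    exact (L.integral_comp_comm (hint u)).symm

/-- By properness of `G`, the section `⟨a, b⟩_E` has compact support. -/
theorem isCompactSection_innerE (hG : 𝓖.IsProper) {a b : SectionAlgebra A}
    (ha : a ∈ compactMulSubalgebra A) (hb : b ∈ compactMulSubalgebra A) :
    IsCompactSection 𝓖 (S.innerE a b) := by
  obtain ⟨K, hK, hK0⟩ := exists_isCompact_of_mem_compactMulSubalgebra ha
  obtain ⟨L, hL, hL0⟩ := exists_isCompact_of_mem_compactMulSubalgebra hb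
  refine isCompactSection_of_isCompact ?_ (isCompact_preimage_of_isProper hG hK hL) fun γ hγ => ?_
  · exact continuous_iff_continuousAt.2 fun γ => Bundle.tendsto_mul
      ((a.isContSection.comp 𝓖.continuous_r).tendsto γ)
      ((continuous_map (S := S) b.isContSection.star).tendsto γ)
  · unfold innerE
    by_cases h : 𝓖.r γ ∈ K
    · rw [hL0 _ fun h' => hγ ⟨h, h'⟩, star_zero, map_zero, mul_zero]
    · rw [hK0 _ h, zero_mul]

/-- The system is proper with respect to `C_c(X) · A`. -/
theorem isProperWith_compactMulSubalgebra (hG : 𝓖.IsProper) :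
    S.IsProperWith haar (compactMulSubalgebra A) where
  dense := dense_compactMulSubalgebra A
  integrable a ha b hb := (isCompactSection_innerE hG ha hb).isIIntegrable haar
  existsUnique_innerD a ha b hb := by
    obtain ⟨d, hd, -⟩ := exists_isInnerD_isMultiplicationBy (S := S) haar hG ha hb
    refine ⟨d, hd, fun d' hd' => ?_⟩
    refine multiplier_eq_of_snd_eq (dense_compactMulSubalgebra A) fun c hc =>
      SectionAlgebra.ext fun u => ?_
    rw [(hd'.2 c hc u).2, (hd.2 c hc u).2]

end GroupoidAction

end ProperSystem

/-! ### Borel Hilbert bundles -/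

namespace BorelHilbertBundle

variable {X : Type*} [MeasurableSpace X] (H : BorelHilbertBundle X)

instance (x : X) : TopologicalSpace.SeparableSpace (H.fibre x) :=
  ⟨range fun c => H.ratComb c x, countable_range _, H.dense_ratComb x⟩

/-- Pettis' theorem for the fibres: a weakly measurable function into a fibre is strongly
measurable. -/
theorem stronglyMeasurable_of_measurable_inner {Y : Type*} [MeasurableSpace Y] {x : X}
    {g : Y → H.fibre x} (hg : ∀ n, Measurable fun y => (inner ℂ (H.seq n x) (g y) : ℂ)) :
    StronglyMeasurable g := by
  borelize (H.fibre x)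
  -- preimages of balls are measurable, and open sets are countable unions of balls
  have hball : ∀ (c : H.fibre x) (δ : ℝ), MeasurableSet (g ⁻¹' Metric.ball c δ) := fun c δ => by
    have h1 : (H.pullback (fun _ : Y => x) measurable_const).IsBorelSection fun y => g y - c :=
      fun n => by
        change Measurable fun y => (inner ℂ (H.seq n x) (g y - c) : ℂ)
        simp only [inner_sub_right]
        exact (hg n).sub_const _
    have h2 := h1.norm
    convert h2 (measurableSet_Iio (a := δ)) using 1
    ext y
    rw [mem_preimage, Metric.mem_ball, dist_eq_norm]
    exact Iff.rfl
  refine Measurable.stronglyMeasurable (measurable_of_isOpen fun O hO => ?_)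
  obtain ⟨T, hTc, hT⟩ := TopologicalSpace.isOpen_iUnion_countable
    (fun p : {p : H.fibre x × ℝ // Metric.ball p.1 p.2 ⊆ O} => Metric.ball p.1.1 p.1.2)
    fun _ => Metric.isOpen_ball
  have hO' : O = ⋃ p ∈ T, Metric.ball p.1.1 p.1.2 := by
    rw [hT]
    refine Subset.antisymm (fun z hz => ?_) (iUnion_subset fun p => p.2)
    obtain ⟨δ, hδ, hb⟩ := Metric.isOpen_iff.1 hO z hz
    exact mem_iUnion.2 ⟨⟨(z, δ), hb⟩, Metric.mem_ball_self hδ⟩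
  rw [hO', preimage_iUnion₂]
  exact MeasurableSet.biUnion hTc fun p _ => hball _ _

variable {H}

theorem inner_seq_toFibre {x u : X} (h : x = u) (n : ℕ) (e : H.fibre x) :
    (inner ℂ (H.seq n u) (toFibre u e) : ℂ) = inner ℂ (H.seq n x) e := by
  subst h; simp

theorem IsBorelSection.measurable_enorm {h : ∀ x, H.fibre x} (hh : H.IsBorelSection h) :
    Measurable fun x => ‖h x‖ₑ := by
  simpa only [ofReal_norm] using hh.norm.ennreal_ofReal

namespace L2

variable {μ : Measure X}

theorem mk_surjective : Function.Surjective (mk : H.PreL2 μ → H.L2 μ) :=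
  SeparationQuotient.surjective_mk

theorem mk_add (h k : H.PreL2 μ) : mk (h + k) = mk h + mk k := rfl

theorem mk_smul (c : ℂ) (h : H.PreL2 μ) : mk (c • h) = c • mk h := rfl

theorem norm_mk (h : H.PreL2 μ) : ‖mk h‖ = ‖h‖ := rfl

theorem norm_sq_eq (h : H.PreL2 μ) :
    ‖h‖ ^ 2 = (∫⁻ x, ‖h.toSection x‖ₑ ^ 2 ∂μ).toReal := by
  have h1 : ‖h‖ ^ 2 = RCLike.re (inner ℂ h h : ℂ) := norm_sq_eq_re_inner h
  have h2 : (inner ℂ h h : ℂ) = ∫ x, inner ℂ (h.toSection x) (h.toSection x) ∂μ := rfl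
  rw [h1, h2, ← integral_re (PreL2.integrable_inner h h), integral_eq_lintegral_of_nonneg_ae
    (ae_of_all _ fun x => inner_self_nonneg)
    (PreL2.integrable_inner h h).re.aestronglyMeasurable]
  congr 1
  refine lintegral_congr fun x => ?_
  rw [inner_self_eq_norm_sq, ENNReal.ofReal_pow (norm_nonneg _), ofReal_norm]

/-- Sections that agree almost everywhere have the same class. -/
theorem mk_eq_of_ae {h k : H.PreL2 μ} (hk : ∀ᵐ x ∂μ, h.toSection x = k.toSection x) :
    mk h = mk k := by
  rw [← sub_eq_zero, ← norm_eq_zero]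
  have h1 : mk h - mk k = mk (h - k) := rfl
  rw [h1, norm_mk, ← sq_eq_zero_iff, norm_sq_eq]
  have h2 : ∫⁻ x, ‖(h - k).toSection x‖ₑ ^ 2 ∂μ = 0 := by
    refine lintegral_eq_zero_of_ae_eq_zero ?_
    filter_upwards [hk] with x hx
    have : (h - k).toSection x = h.toSection x - k.toSection x := rfl
    simp [this, hx]
  rw [h2, ENNReal.toReal_zero]

/-- An additive and homogeneous bounded map on square integrable sections descends to `L²`. -/
theorem exists_clm (F : H.PreL2 μ → H.L2 μ) (hadd : ∀ h k, F (h + k) = F h + F k)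
    (hsmul : ∀ (c : ℂ) h, F (c • h) = c • F h) {C : ℝ} (hC : ∀ h, ‖F h‖ ≤ C * ‖h‖) :
    ∃ T : H.L2 μ →L[ℂ] H.L2 μ, (∀ h, T (mk h) = F h) ∧ ∀ x, ‖T x‖ ≤ C * ‖x‖ := by
  have hsub : ∀ h k, F (h - k) = F h - F k := fun h k => by
    have := hsmul (-1) k
    rw [sub_eq_add_neg, hadd, ← neg_one_smul ℂ k, this, neg_one_smul, sub_eq_add_neg]
  have hwd : ∀ h k : H.PreL2 μ, mk h = mk k → F h = F k := fun h k hk => by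
    have h0 : ‖h - k‖ = 0 := by
      rw [← norm_mk, show mk (h - k) = mk h - mk k from rfl, hk, sub_self, norm_zero]
    rw [← sub_eq_zero, ← hsub, ← norm_le_zero_iff]
    simpa [h0] using hC (h - k)
  let σ : H.L2 μ → H.PreL2 μ := Function.surjInv mk_surjective
  have hσ : ∀ x, mk (σ x) = x := Function.surjInv_eq mk_surjective
  have hbd : ∀ x, ‖F (σ x)‖ ≤ C * ‖x‖ := fun x => by
    have := hC (σ x)
    rwa [← norm_mk (σ x), hσ] at this
  refine ⟨LinearMap.mkContinuous
    { toFun := fun x => F (σ x)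
      map_add' := fun x y => by
        rw [← hadd]
        exact hwd _ _ (by rw [mk_add, hσ, hσ, hσ])
      map_smul' := fun c x => by
        rw [RingHom.id_apply, ← hsmul]
        exact hwd _ _ (by rw [mk_smul, hσ, hσ]) } C hbd, fun h => hwd _ _ (hσ _), hbd⟩

end L2

end BorelHilbertBundle

/-! ### Representations of the section algebra -/

namespace BundleRep

variable {X : Type*} [TopologicalSpace X] [MeasurableSpace X] [BorelSpace X]
  {A : X → Type*} [∀ x, NonUnitalCStarAlgebra (A x)] [TopologicalSpace (TotalSpace ℂ A)]
  [IsUSCCStarBundle A] (ρ : BundleRep A)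

theorem norm_rep_le (u : X) (a : A u) : ‖ρ.rep u a‖ ≤ ‖a‖ :=
  NonUnitalStarAlgHom.norm_apply_le (ρ.rep u) a

/-- The representation `π_u` as a continuous linear map. -/
noncomputable def repCLM (u : X) : A u →L[ℂ] (ρ.H.fibre u →L[ℂ] ρ.H.fibre u) :=
  LinearMap.mkContinuous (ρ.rep u : A u →ₗ[ℂ] (ρ.H.fibre u →L[ℂ] ρ.H.fibre u)) 1 fun a => by
    rw [one_mul]; exact ρ.norm_rep_le u a

theorem aestronglyMeasurable_rep {Y : Type*} [MeasurableSpace Y] {m : Measure Y} {u : X}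
    {a : Y → A u} {v : Y → ρ.H.fibre u} (ha : AEStronglyMeasurable a m)
    (hv : AEStronglyMeasurable v m) : AEStronglyMeasurable (fun y => ρ.rep u (a y) (v y)) m :=
  (ρ.repCLM u).aestronglyMeasurable_comp₂ ha hv

theorem norm_rep_apply_le (u : X) (a : A u) (v : ρ.H.fibre u) : ‖ρ.rep u a v‖ ≤ ‖a‖ * ‖v‖ :=
  ((ρ.rep u a).le_opNorm v).trans (by gcongr; exact ρ.norm_rep_le u a)

theorem enorm_rep_apply_le (u : X) (a : A u) (v : ρ.H.fibre u) :
    ‖ρ.rep u a v‖ₑ ≤ ‖a‖ₑ * ‖v‖ₑ := by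
  rw [← ofReal_norm, ← ofReal_norm, ← ofReal_norm, ← ENNReal.ofReal_mul (norm_nonneg _)]
  exact ENNReal.ofReal_le_ofReal (ρ.norm_rep_apply_le u a v)

theorem inner_rep (u : X) (a : A u) (v w : ρ.H.fibre u) :
    (inner ℂ v (ρ.rep u a w) : ℂ) = inner ℂ (ρ.rep u (star a) v) w := by
  rw [map_star, ContinuousLinearMap.star_eq_adjoint, ContinuousLinearMap.adjoint_inner_left]

/-- A continuous section of the algebra bundle along a map acts on Borel sections of the Hilbert
bundle along that map.  For values of continuous sections of `𝒜` this is part of the definition of a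
representation; the general case is a limit of these along countable Borel partitions. -/
theorem isBorelSection_rep [T2Space X] [LocallyCompactSpace X]
    [TopologicalSpace.SeparableSpace (SectionAlgebra A)] {Y : Type*} [TopologicalSpace Y]
    [MeasurableSpace Y] [OpensMeasurableSpace Y] {q : Y → X} (hq : Measurable q) {B : ∀ y, A (q y)}
    (hB : Continuous fun y => (⟨q y, B y⟩ : TotalSpace ℂ A)) {k : ∀ y, ρ.H.fibre (q y)}
    (hk : (ρ.H.pullback q hq).IsBorelSection k) :
    (ρ.H.pullback q hq).IsBorelSection fun y => ρ.rep (q y) (B y) (k y) := by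
  intro n
  change Measurable fun y => (inner ℂ (ρ.H.seq n (q y)) (ρ.rep (q y) (B y) (k y)) : ℂ)
  have hqc : Continuous q := (IsUSCCStarBundle.continuous_proj (A := A)).comp hB
  have hsec : ∀ a : SectionAlgebra A,
      Measurable fun y => (inner ℂ (ρ.H.seq n (q y)) (ρ.rep (q y) (a (q y)) (k y)) : ℂ) := by
    intro a
    have h1 : (ρ.H.pullback q hq).IsBorelSection
        fun y => ρ.rep (q y) ((star a) (q y)) (ρ.H.seq n (q y)) :=
      fun m => (ρ.borel (star a) m n).comp hq
    simp_rw [inner_rep]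
    exact h1.inner _ hk
  obtain ⟨a', ha'⟩ := exists_seq_sectionAlgebra_dense A
  obtain ⟨a, hac, had, hsec⟩ : ∃ a : ℕ → ∀ x, A x, (∀ j, IsContSection (a j)) ∧
      (∀ (x : X) (b : A x) (ε : ℝ), 0 < ε → ∃ n, ‖b - a n x‖ < ε) ∧ ∀ j,
      Measurable fun y => (inner ℂ (ρ.H.seq n (q y)) (ρ.rep (q y) (a j (q y)) (k y)) : ℂ) :=
    ⟨fun j => a' j, fun j => (a' j).isContSection, ha', fun j => hsec (a' j)⟩
  classical
  have hex : ∀ (i : ℕ) (y : Y), ∃ j, ‖B y - a j (q y)‖ < 1 / ((i : ℝ) + 1) := fun i y =>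
    had _ _ _ (by positivity)
  -- the Borel partition of `Y` by the first section that is `1 / (i + 1)`-close to `B`
  let J : ℕ → Y → ℕ := fun i y => Nat.find (hex i y)
  have hJ : ∀ i, Measurable (J i) := fun i => measurable_find _ fun j => by
    have hc : Continuous fun y => (⟨q y, B y - a j (q y)⟩ : TotalSpace ℂ A) :=
      continuous_iff_continuousAt.2 fun y => Bundle.tendsto_sub (hB.tendsto y)
        (((hac j).comp hqc).tendsto y)
    exact measurableSet_lt (Bundle.measurable_norm hc) measurable_const
  refine measurable_of_tendsto_metrizable (f := fun i y =>
    (inner ℂ (ρ.H.seq n (q y)) (ρ.rep (q y) (a (J i y) (q y)) (k y)) : ℂ)) (fun i => ?_) ?_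
  · have h1 : Measurable fun p : Y × ℕ =>
        (inner ℂ (ρ.H.seq n (q p.1)) (ρ.rep (q p.1) (a p.2 (q p.1)) (k p.1)) : ℂ) :=
      measurable_from_prod_countable_left hsec
    exact h1.comp (measurable_id.prodMk (hJ i))
  · refine tendsto_pi_nhds.2 fun y => tendsto_iff_norm_sub_tendsto_zero.2 ?_
    have hlim : Tendsto (fun i : ℕ => ‖ρ.H.seq n (q y)‖ * (1 / ((i : ℝ) + 1) * ‖k y‖)) atTop
        (𝓝 0) := by
      simpa using (tendsto_one_div_add_atTop_nhds_zero_nat.mul_const ‖k y‖).const_mul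
        ‖ρ.H.seq n (q y)‖
    refine squeeze_zero (fun _ => norm_nonneg _) (fun i => ?_) hlim
    have h1 : ‖B y - a (J i y) (q y)‖ < 1 / ((i : ℝ) + 1) := Nat.find_spec (hex i y)
    rw [← inner_sub_right, ← sub_apply, ← map_sub]
    refine (norm_inner_le_norm _ _).trans (mul_le_mul_of_nonneg_left ?_ (norm_nonneg _))
    refine (ρ.norm_rep_apply_le _ _ _).trans (mul_le_mul_of_nonneg_right ?_ (norm_nonneg _))
    rw [norm_sub_rev]
    exact h1.le

end BundleRep

/-! ### Schur's test on the range fibres -/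

/-- Cauchy–Schwarz for a weighted lower integral. -/
theorem sq_lintegral_mul_le {α : Type*} [MeasurableSpace α] (m : Measure α) {n k : α → ℝ≥0∞}
    (hn : Measurable n) (hk : Measurable k) :
    (∫⁻ x, n x * k x ∂m) ^ 2 ≤ (∫⁻ x, n x ∂m) * ∫⁻ x, n x * k x ^ 2 ∂m := by
  have hk2 : Measurable fun x => k x ^ 2 := hk.pow_const 2
  have h := ENNReal.lintegral_mul_le_Lp_mul_Lq (m.withDensity n) Real.HolderConjugate.two_two
    (f := fun _ => 1) (g := k) aemeasurable_const hk.aemeasurable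
  simp only [Pi.mul_apply, one_mul, ENNReal.one_rpow] at h
  rw [lintegral_withDensity_eq_lintegral_mul _ hn hk,
    lintegral_withDensity_eq_lintegral_mul _ hn measurable_const,
    lintegral_withDensity_eq_lintegral_mul _ hn (hk.pow_const _)] at h
  simp only [Pi.mul_apply, mul_one] at h
  calc _ ≤ _ := pow_le_pow_left' h 2
    _ = _ := by
      rw [mul_pow, ← ENNReal.rpow_natCast, ← ENNReal.rpow_natCast, ← ENNReal.rpow_mul,
        ← ENNReal.rpow_mul]
      norm_num

/-- A bounded integrable weight times a square integrable function is integrable. -/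
theorem lintegral_mul_lt_top_of_sq {α : Type*} [MeasurableSpace α] {m : Measure α} {n k : α → ℝ≥0∞}
    (hn : Measurable n) (hk : Measurable k) {C : ℝ≥0∞} (hC : C < ∞) (hnC : ∀ x, n x ≤ C)
    (hn1 : ∫⁻ x, n x ∂m < ∞) (hk2 : ∫⁻ x, k x ^ 2 ∂m < ∞) : ∫⁻ x, n x * k x ∂m < ∞ := by
  have h1 : ∫⁻ x, n x * k x ^ 2 ∂m < ∞ := by
    refine lt_of_le_of_lt (lintegral_mono fun x => mul_le_mul_left (hnC x) (k x ^ 2)) ?_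
    rw [lintegral_const_mul _ (hk.pow_const 2)]
    exact ENNReal.mul_lt_top hC hk2
  have h2 := (sq_lintegral_mul_le m hn hk).trans_lt (ENNReal.mul_lt_top hn1 h1)
  by_contra hc
  rw [not_lt_top_iff.1 hc] at h2
  simp at h2

namespace HaarSystem

variable {G X : Type*} [TopologicalSpace G] [T2Space G] [LocallyCompactSpace G]
  [SecondCountableTopology G] [MeasurableSpace G] [BorelSpace G] [TopologicalSpace X] [T2Space X]
  {𝓖 : TopGroupoid G X} (haar : HaarSystem 𝓖)

/-- Schur's test for the convolution kernel `(κ, ζ) ↦ n(κ⁻¹ζ)` on the range fibre over `u`. -/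
theorem lintegral_sq_convolution_le {n k : G → ℝ≥0∞} (hn : Measurable n) (hk : Measurable k)
    {M : ℝ≥0∞} (hM : ∀ v, ∫⁻ γ, n γ ∂haar.μ v ≤ M) (hM' : ∀ v, ∫⁻ γ, n (𝓖.inv γ) ∂haar.μ v ≤ M)
    (u : X) :
    ∫⁻ κ, (∫⁻ ζ, n (𝓖.cmul (𝓖.inv κ) ζ) * k ζ ∂haar.μ u) ^ 2 ∂haar.μ u ≤
      M ^ 2 * ∫⁻ ζ, k ζ ^ 2 ∂haar.μ u := by
  have hinv : Measurable 𝓖.inv := 𝓖.continuous_inv.measurable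
  have hmul : Measurable fun p : G × G => n (𝓖.cmul (𝓖.inv p.1) p.2) :=
    hn.comp (TopGroupoid.measurable_cmul.comp ((hinv.comp measurable_fst).prodMk measurable_snd))
  have hl : ∀ κ, Measurable fun ζ => n (𝓖.cmul (𝓖.inv κ) ζ) := fun κ =>
    hmul.comp measurable_prodMk_left
  have hr : ∀ ζ, Measurable fun κ => n (𝓖.cmul (𝓖.inv κ) ζ) := fun ζ =>
    hmul.comp measurable_prodMk_right
  have h1 : ∀ᵐ κ ∂haar.μ u, (∫⁻ ζ, n (𝓖.cmul (𝓖.inv κ) ζ) * k ζ ∂haar.μ u) ^ 2 ≤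
      M * ∫⁻ ζ, n (𝓖.cmul (𝓖.inv κ) ζ) * k ζ ^ 2 ∂haar.μ u := by
    filter_upwards [haar.ae_range_eq u] with κ hκ
    refine (sq_lintegral_mul_le _ (hl κ) hk).trans ?_
    gcongr
    have := haar.lintegral_cmul (𝓖.inv κ) hn
    rw [𝓖.s_inv, hκ] at this
    exact this.le.trans (hM _)
  have h2 : ∀ᵐ ζ ∂haar.μ u, ∫⁻ κ, n (𝓖.cmul (𝓖.inv κ) ζ) * k ζ ^ 2 ∂haar.μ u ≤ M * k ζ ^ 2 := by
    filter_upwards [haar.ae_range_eq u] with ζ hζ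
    rw [lintegral_mul_const _ (hr ζ)]
    gcongr
    have h3 := haar.lintegral_cmul (𝓖.inv ζ) (hn.comp hinv)
    rw [𝓖.s_inv, hζ] at h3
    refine (lintegral_congr_ae ?_).le.trans (h3.le.trans (hM' _))
    filter_upwards [haar.ae_range_eq u] with κ hκ
    have h4 : 𝓖.s ζ = 𝓖.r (𝓖.cmul (𝓖.inv ζ) κ) := by rw [TopGroupoid.r_cmul, 𝓖.r_inv]
    have h5 := TopGroupoid.inv_cmul_left h4
    rw [TopGroupoid.cmul_inv_cmul (hζ.trans hκ.symm)] at h5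
    rw [h5, Function.comp_apply]
  calc _ ≤ ∫⁻ κ, M * ∫⁻ ζ, n (𝓖.cmul (𝓖.inv κ) ζ) * k ζ ^ 2 ∂haar.μ u ∂haar.μ u :=
        lintegral_mono_ae h1
    _ = M * ∫⁻ ζ, ∫⁻ κ, n (𝓖.cmul (𝓖.inv κ) ζ) * k ζ ^ 2 ∂haar.μ u ∂haar.μ u := by
        have hm : Measurable fun p : G × G => n (𝓖.cmul (𝓖.inv p.1) p.2) * k p.2 ^ 2 :=
          hmul.mul ((hk.comp measurable_snd).pow_const 2)
        rw [lintegral_const_mul _ hm.lintegral_prod_right',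
          lintegral_lintegral_swap hm.aemeasurable]
    _ ≤ M * ∫⁻ ζ, M * k ζ ^ 2 ∂haar.μ u := by
        exact mul_le_mul_right (lintegral_mono_ae h2) M
    _ = _ := by rw [lintegral_const_mul _ (hk.pow_const 2), ← mul_assoc, sq M]

end HaarSystem

/-! ### The regular representations -/

section Regular

variable {G X : Type*} [TopologicalSpace G] [T2Space G] [LocallyCompactSpace G]
  [SecondCountableTopology G] [MeasurableSpace G] [BorelSpace G]
  [TopologicalSpace X] [T2Space X] [LocallyCompactSpace X]
  [MeasurableSpace X] [BorelSpace X] {𝓖 : TopGroupoid G X}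
  {A : X → Type*} [∀ x, NonUnitalCStarAlgebra (A x)] [TopologicalSpace (TotalSpace ℂ A)]
  [IsUSCCStarBundle A] [TopologicalSpace.SeparableSpace (SectionAlgebra A)]

namespace BundleRep

variable (haar : HaarSystem 𝓖) (ρ : BundleRep A)

/-- The section `ζ ↦ h(ζ⁻¹)` on the range fibre over `u`, for a section `h` of the Hilbert bundle
pulled back along the source map. -/
noncomputable def invSection (𝓖 : TopGroupoid G X) (h : ∀ γ, ρ.H.fibre (𝓖.s γ)) (u : X) (ζ : G) :
    ρ.H.fibre u :=
  toFibre u (h (𝓖.inv ζ))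

variable {ρ} {h : ∀ γ, ρ.H.fibre (𝓖.s γ)}

theorem enorm_invSection {u : X} {ζ : G} (hζ : 𝓖.r ζ = u) :
    ‖ρ.invSection 𝓖 h u ζ‖ₑ = ‖h (𝓖.inv ζ)‖ₑ := by
  rw [← ofReal_norm, ← ofReal_norm, invSection, norm_toFibre ((𝓖.s_inv ζ).trans hζ)]

theorem stronglyMeasurable_invSection (hh : (ρ.sourceBundle 𝓖).IsBorelSection h) (u : X) :
    StronglyMeasurable (ρ.invSection 𝓖 h u) := by
  classical
  refine ρ.H.stronglyMeasurable_of_measurable_inner fun n => ?_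
  have h1 : (fun ζ => (inner ℂ (ρ.H.seq n u) (ρ.invSection 𝓖 h u ζ) : ℂ)) =
      {ζ | 𝓖.r ζ = u}.indicator
        fun ζ => (inner ℂ (ρ.H.seq n (𝓖.s (𝓖.inv ζ))) (h (𝓖.inv ζ)) : ℂ) := by
    funext ζ
    by_cases hζ : 𝓖.r ζ = u
    · rw [indicator_of_mem (show ζ ∈ {ζ | 𝓖.r ζ = u} from hζ), invSection,
        BorelHilbertBundle.inner_seq_toFibre ((𝓖.s_inv ζ).trans hζ)]
    · rw [indicator_of_notMem (show ζ ∉ {ζ | 𝓖.r ζ = u} from hζ), invSection,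
        toFibre_of_ne (fun h => hζ ((𝓖.s_inv ζ).symm.trans h)), inner_zero_right]
  rw [h1]
  exact ((hh n).comp 𝓖.continuous_inv.measurable).indicator
    (isClosed_singleton.preimage 𝓖.continuous_r).measurableSet

end BundleRep

namespace GroupoidAction

variable (haar : HaarSystem 𝓖) (S : GroupoidAction 𝓖 A) (ρ : BundleRep A)

/-- The kernel `(γ, ζ) ↦ α_γ⁻¹(f(γζ)) ∈ A(u)`, for `s γ = u = r ζ`. -/
noncomputable def kernelAt (f : ∀ γ, A (𝓖.r γ)) (u : X) (γ ζ : G) : A u :=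
  toFibre u (S.act (𝓖.inv γ) ⟨_, f (𝓖.cmul γ ζ)⟩).snd

/-- `∫ π_u(α_γ⁻¹(f(γζ))) h(ζ⁻¹) dλ^u(ζ)`, the value at `γ` of `Ind π (f) h` for `s γ = u`. -/
noncomputable def regularAt (f : ∀ γ, A (𝓖.r γ)) (h : ∀ γ, ρ.H.fibre (𝓖.s γ)) (u : X) (γ : G) :
    ρ.H.fibre u :=
  ∫ ζ, ρ.rep u (S.kernelAt f u γ ζ) (ρ.invSection 𝓖 h u ζ) ∂haar.μ u

/-- The section `Ind π (f) h`. -/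
noncomputable def regularSection (f : ∀ γ, A (𝓖.r γ)) (h : ∀ γ, ρ.H.fibre (𝓖.s γ)) (γ : G) :
    ρ.H.fibre (𝓖.s γ) :=
  S.regularAt haar ρ f h (𝓖.s γ) γ

variable {S ρ} {f : ∀ γ, A (𝓖.r γ)} {h : ∀ γ, ρ.H.fibre (𝓖.s γ)}

theorem toFibre_regularSection {u : X} {γ : G} (hγ : 𝓖.s γ = u) :
    toFibre u (S.regularSection haar ρ f h γ) = S.regularAt haar ρ f h u γ := by
  subst hγ
  rw [toFibre_self]
  rfl

theorem mk_kernelAt {u : X} {γ : G} (ζ : G) (hγ : 𝓖.s γ = u) :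
    (⟨u, S.kernelAt f u γ ζ⟩ : TotalSpace ℂ A) = S.act (𝓖.inv γ) ⟨_, f (𝓖.cmul γ ζ)⟩ :=
  mk_toFibre ((𝓖.r_inv γ).trans hγ) _

theorem norm_kernelAt {u : X} {γ : G} (ζ : G) (hγ : 𝓖.s γ = u) :
    ‖S.kernelAt f u γ ζ‖ = ‖f (𝓖.cmul γ ζ)‖ := by
  have hp : (S.act (𝓖.inv γ) ⟨_, f (𝓖.cmul γ ζ)⟩).proj = u := (𝓖.r_inv γ).trans hγ
  exact (norm_toFibre hp _).trans (norm_act (TopGroupoid.r_cmul.trans (𝓖.s_inv γ).symm))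

theorem enorm_kernelAt {u : X} {γ : G} (ζ : G) (hγ : 𝓖.s γ = u) :
    ‖S.kernelAt f u γ ζ‖ₑ = ‖f (𝓖.cmul γ ζ)‖ₑ := by
  rw [← ofReal_norm, ← ofReal_norm, norm_kernelAt ζ hγ]

/-- The kernel is a continuous section over any space of composable pairs. -/
theorem continuous_kernelAt {Y : Type*} [TopologicalSpace Y] {q : Y → X} {g z : Y → G}
    (hf : Continuous fun γ => (⟨𝓖.r γ, f γ⟩ : TotalSpace ℂ A)) (hg : Continuous g)
    (hz : Continuous z) (hgq : ∀ y, 𝓖.s (g y) = q y) (hzq : ∀ y, 𝓖.r (z y) = q y) :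
    Continuous fun y => (⟨q y, S.kernelAt f (q y) (g y) (z y)⟩ : TotalSpace ℂ A) := by
  simp_rw [fun y => mk_kernelAt (S := S) (f := f) (z y) (hgq y)]
  refine continuous_act' (𝓖.continuous_inv.comp hg) (hf.comp
    (TopGroupoid.continuous_cmul hg hz fun y => (hgq y).trans (hzq y).symm)) fun y => ?_
  exact TopGroupoid.r_cmul.trans (𝓖.s_inv _).symm

theorem aestronglyMeasurable_kernelAt {u : X} {γ : G}
    (hf : Continuous fun γ => (⟨𝓖.r γ, f γ⟩ : TotalSpace ℂ A)) (hγ : 𝓖.s γ = u) :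
    AEStronglyMeasurable (S.kernelAt f u γ) (haar.μ u) := by
  have hs : MeasurableSet {ζ | 𝓖.r ζ = u} :=
    (isClosed_singleton.preimage 𝓖.continuous_r).measurableSet
  have hc : ContinuousOn (S.kernelAt f u γ) {ζ | 𝓖.r ζ = u} := by
    rw [continuousOn_iff_continuous_domRestrict]
    have h1 := continuous_kernelAt (S := S) (Y := {ζ | 𝓖.r ζ = u}) (q := fun _ => u)
      (g := fun _ => γ) (z := fun ζ => ζ.1) hf continuous_const continuous_subtype_val (fun _ => hγ)
      fun ζ => ζ.2
    exact continuous_iff_continuousAt.2 fun ζ => Bundle.tendsto_fibre_iff.1 (h1.tendsto ζ)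
  have := hc.aestronglyMeasurable (μ := haar.μ u) hs
  rwa [Measure.restrict_eq_self_of_ae_mem (s := {ζ | 𝓖.r ζ = u}) (haar.ae_range_eq u)] at this

theorem aestronglyMeasurable_integrand {u : X} {γ : G}
    (hf : Continuous fun γ => (⟨𝓖.r γ, f γ⟩ : TotalSpace ℂ A))
    (hh : (ρ.sourceBundle 𝓖).IsBorelSection h) (hγ : 𝓖.s γ = u) :
    AEStronglyMeasurable
      (fun ζ => ρ.rep u (S.kernelAt f u γ ζ) (ρ.invSection 𝓖 h u ζ)) (haar.μ u) :=
  ρ.aestronglyMeasurable_rep (aestronglyMeasurable_kernelAt haar hf hγ)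
    (BundleRep.stronglyMeasurable_invSection hh u).aestronglyMeasurable

/-- The substitution `η = γζ` in the integrand of the regular representation. -/
theorem regularIntegrand_cmul {γ ζ : G} (hζ : 𝓖.r ζ = 𝓖.s γ) :
    S.regularIntegrand ρ f h γ (𝓖.cmul γ ζ) =
      ρ.rep (𝓖.s γ) (S.kernelAt f (𝓖.s γ) γ ζ) (ρ.invSection 𝓖 h (𝓖.s γ) ζ) := by
  have hη : 𝓖.r (𝓖.cmul γ ζ) = 𝓖.r γ := TopGroupoid.r_cmul
  rw [regularIntegrand, dif_pos hη]
  congr 1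
  · rw [symm_eq_toFibre, mk_fibreCast, kernelAt]
  · rw [fibreCast_eq_toFibre, BundleRep.invSection]
    have h1 : ∀ γ₁ γ₂ : G, γ₁ = γ₂ → toFibre (𝓖.s γ) (h γ₁) = toFibre (𝓖.s γ) (h γ₂) := by
      rintro _ _ rfl; rfl
    refine h1 _ _ ?_
    rw [← TopGroupoid.cmul_eq, TopGroupoid.inv_cmul_left hζ.symm]

theorem integrable_regularIntegrand_iff
    (hf : Continuous fun γ => (⟨𝓖.r γ, f γ⟩ : TotalSpace ℂ A))
    (hh : (ρ.sourceBundle 𝓖).IsBorelSection h) (γ : G) :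
    Integrable (S.regularIntegrand ρ f h γ) (haar.μ (𝓖.r γ)) ↔
      Integrable (fun ζ => ρ.rep (𝓖.s γ) (S.kernelAt f (𝓖.s γ) γ ζ)
        (ρ.invSection 𝓖 h (𝓖.s γ) ζ)) (haar.μ (𝓖.s γ)) :=
  haar.integrable_translate (aestronglyMeasurable_integrand haar hf hh rfl)
    fun _ hη => regularIntegrand_cmul hη

theorem integral_regularIntegrand
    (hf : Continuous fun γ => (⟨𝓖.r γ, f γ⟩ : TotalSpace ℂ A))
    (hh : (ρ.sourceBundle 𝓖).IsBorelSection h) (γ : G) :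
    ∫ η, S.regularIntegrand ρ f h γ η ∂haar.μ (𝓖.r γ) = S.regularSection haar ρ f h γ :=
  haar.integral_translate (aestronglyMeasurable_integrand haar hf hh rfl)
    fun _ hη => regularIntegrand_cmul hη

/-- `Ind π (f) h` is a Borel section. -/
theorem isBorelSection_regularSection
    (hf : Continuous fun γ => (⟨𝓖.r γ, f γ⟩ : TotalSpace ℂ A))
    (hh : (ρ.sourceBundle 𝓖).IsBorelSection h) :
    (ρ.sourceBundle 𝓖).IsBorelSection (S.regularSection haar ρ f h) := by
  classical
  -- the integrand is a Borel section over the space `C` of composable pairs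
  let C : Set (G × G) := {p | 𝓖.s p.1 = 𝓖.r p.2}
  have hC : MeasurableSet C := TopGroupoid.isClosed_composable.measurableSet
  let q : C → X := fun p => 𝓖.s p.1.1
  have hqc : Continuous q := 𝓖.continuous_s.comp (continuous_fst.comp continuous_subtype_val)
  have hk : (ρ.H.pullback q hqc.measurable).IsBorelSection
      fun p => ρ.invSection 𝓖 h (q p) p.1.2 := fun n => by
    change Measurable fun p : C => (inner ℂ (ρ.H.seq n (q p)) (toFibre (q p) (h (𝓖.inv p.1.2))) : ℂ)
    have h1 : ∀ p : C, (inner ℂ (ρ.H.seq n (q p)) (toFibre (q p) (h (𝓖.inv p.1.2))) : ℂ) =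
        inner ℂ (ρ.H.seq n (𝓖.s (𝓖.inv p.1.2))) (h (𝓖.inv p.1.2)) := fun p =>
      BorelHilbertBundle.inner_seq_toFibre ((𝓖.s_inv _).trans p.2.symm) n _
    simp_rw [h1]
    exact (hh n).comp (𝓖.continuous_inv.measurable.comp
      (measurable_snd.comp measurable_subtype_coe))
  have hsec := ρ.isBorelSection_rep hqc.measurable
    (B := fun p : C => S.kernelAt f (q p) p.1.1 p.1.2)
    (continuous_kernelAt hf (continuous_fst.comp continuous_subtype_val)
      (continuous_snd.comp continuous_subtype_val) (fun _ => rfl) fun p => p.2.symm) hk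
  let κ : ProbabilityTheory.Kernel G G := haar.kernel.comap 𝓖.s 𝓖.continuous_s.measurable
  have hκ : ∀ γ, κ γ = haar.μ (𝓖.s γ) := fun γ => rfl
  have hint : MeasurableSet {γ | Integrable (fun ζ => ρ.rep (𝓖.s γ) (S.kernelAt f (𝓖.s γ) γ ζ)
      (ρ.invSection 𝓖 h (𝓖.s γ) ζ)) (haar.μ (𝓖.s γ))} := by
    have h1 : Measurable fun p : G × G => if hp : p ∈ C then
        ‖ρ.rep (q ⟨p, hp⟩) (S.kernelAt f (q ⟨p, hp⟩) p.1 p.2)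
          (ρ.invSection 𝓖 h (q ⟨p, hp⟩) p.2)‖ₑ else 0 :=
      Measurable.dite (s := C) hsec.measurable_enorm (measurable_const (a := (0 : ℝ≥0∞))) hC
    have h2 := h1.lintegral_kernel_prod_right' (κ := κ)
    convert measurableSet_lt h2 (measurable_const (a := (∞ : ℝ≥0∞))) using 1
    ext γ
    change Integrable _ _ ↔ _ < (∞ : ℝ≥0∞)
    rw [Integrable, and_iff_right (aestronglyMeasurable_integrand haar hf hh rfl),
      hasFiniteIntegral_iff_enorm, hκ]
    refine iff_of_eq (congrArg (fun t : ℝ≥0∞ => t < ∞) (lintegral_congr_ae ?_))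
    filter_upwards [haar.ae_range_eq (𝓖.s γ)] with ζ hζ
    rw [dif_pos (show (γ, ζ) ∈ C from hζ.symm)]
  intro n
  have h1 : Measurable fun p : G × G => if hp : p ∈ C then
      (inner ℂ (ρ.H.seq n (q ⟨p, hp⟩)) (ρ.rep (q ⟨p, hp⟩) (S.kernelAt f (q ⟨p, hp⟩) p.1 p.2)
        (ρ.invSection 𝓖 h (q ⟨p, hp⟩) p.2)) : ℂ) else 0 :=
    Measurable.dite (s := C) (hsec n) (measurable_const (a := (0 : ℂ))) hC
  -- where the integrand is not integrable, the value of the section is zero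
  have h2 := (h1.stronglyMeasurable.integral_kernel_prod_right' (κ := κ)).measurable.indicator hint
  convert h2 using 1
  funext γ
  change (inner ℂ (ρ.H.seq n (𝓖.s γ)) (∫ ζ, ρ.rep (𝓖.s γ) (S.kernelAt f (𝓖.s γ) γ ζ)
      (ρ.invSection 𝓖 h (𝓖.s γ) ζ) ∂haar.μ (𝓖.s γ)) : ℂ) = _
  by_cases hγ : Integrable (fun ζ => ρ.rep (𝓖.s γ) (S.kernelAt f (𝓖.s γ) γ ζ)
      (ρ.invSection 𝓖 h (𝓖.s γ) ζ)) (haar.μ (𝓖.s γ))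
  · rw [indicator_of_mem (by exact hγ), ← integral_inner hγ, hκ]
    refine integral_congr_ae ?_
    filter_upwards [haar.ae_range_eq (𝓖.s γ)] with ζ hζ
    rw [dif_pos (show (γ, ζ) ∈ C from hζ.symm)]
  · rw [indicator_of_notMem (by exact hγ), integral_undef hγ, inner_zero_right]

end GroupoidAction

end Regular

/-! ### The operators of the regular representations -/

section RegularOperator

variable {G X : Type*} [TopologicalSpace G] [T2Space G] [LocallyCompactSpace G]
  [SecondCountableTopology G] [MeasurableSpace G] [BorelSpace G]
  [TopologicalSpace X] [T2Space X] [LocallyCompactSpace X]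
  [MeasurableSpace X] [BorelSpace X] {𝓖 : TopGroupoid G X}
  {A : X → Type*} [∀ x, NonUnitalCStarAlgebra (A x)] [TopologicalSpace (TotalSpace ℂ A)]
  [IsUSCCStarBundle A] [TopologicalSpace.SeparableSpace (SectionAlgebra A)]

namespace BundleRep.Sections

variable {haar : HaarSystem 𝓖} {ρ : BundleRep A}

theorem isBorelSection (h : ρ.Sections haar) : (ρ.sourceBundle 𝓖).IsBorelSection h.toSection :=
  h.2.1

theorem lintegral_lt_top (h : ρ.Sections haar) :
    ∫⁻ γ, ‖h.toSection γ‖ₑ ^ 2 ∂haar.nuInv ρ.μ < ∞ := h.2.2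

/-- The square integrable section with given underlying Borel section. -/
def ofBorel (k : ∀ γ, ρ.H.fibre (𝓖.s γ)) (hk : (ρ.sourceBundle 𝓖).IsBorelSection k)
    (hk2 : ∫⁻ γ, ‖k γ‖ₑ ^ 2 ∂haar.nuInv ρ.μ < ∞) : ρ.Sections haar := ⟨k, hk, hk2⟩

end BundleRep.Sections

namespace GroupoidAction

variable (haar : HaarSystem 𝓖) {S : GroupoidAction 𝓖 A} {ρ : BundleRep A}
  {f : ∀ γ, A (𝓖.r γ)} {h : ∀ γ, ρ.H.fibre (𝓖.s γ)}

/-- The integral of the norms of the integrand of `Ind π (f) h`, at `γ` with `s γ = u`. -/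
noncomputable def normIntegral (f : ∀ γ, A (𝓖.r γ)) (h : ∀ γ, ρ.H.fibre (𝓖.s γ)) (u : X) (γ : G) :
    ℝ≥0∞ :=
  ∫⁻ ζ, ‖f (𝓖.cmul γ ζ)‖ₑ * ‖h (𝓖.inv ζ)‖ₑ ∂haar.μ u

theorem lintegral_enorm_integrand_le {u : X} {γ : G} (hγ : 𝓖.s γ = u) :
    ∫⁻ ζ, ‖ρ.rep u (S.kernelAt f u γ ζ) (ρ.invSection 𝓖 h u ζ)‖ₑ ∂haar.μ u ≤
      normIntegral haar f h u γ := by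
  refine lintegral_mono_ae ?_
  filter_upwards [haar.ae_range_eq u] with ζ hζ
  rw [← enorm_kernelAt (S := S) ζ hγ, ← BundleRep.enorm_invSection hζ]
  exact ρ.enorm_rep_apply_le _ _ _

theorem enorm_regularSection_le (γ : G) :
    ‖S.regularSection haar ρ f h γ‖ₑ ≤ normIntegral haar f h (𝓖.s γ) γ :=
  (enorm_integral_le_lintegral_enorm _).trans (lintegral_enorm_integrand_le haar rfl)

theorem integrable_integrand (hf : Continuous fun γ => (⟨𝓖.r γ, f γ⟩ : TotalSpace ℂ A))
    (hh : (ρ.sourceBundle 𝓖).IsBorelSection h) {u : X} {γ : G} (hγ : 𝓖.s γ = u)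
    (hlt : normIntegral haar f h u γ < ∞) :
    Integrable (fun ζ => ρ.rep u (S.kernelAt f u γ ζ) (ρ.invSection 𝓖 h u ζ)) (haar.μ u) :=
  ⟨aestronglyMeasurable_integrand haar hf hh hγ,
    hasFiniteIntegral_iff_enorm.2 ((lintegral_enorm_integrand_le haar hγ).trans_lt hlt)⟩

theorem measurable_enorm_section (hf : Continuous fun γ => (⟨𝓖.r γ, f γ⟩ : TotalSpace ℂ A)) :
    Measurable fun γ => ‖f γ‖ₑ := by
  simpa only [ofReal_norm] using (Bundle.measurable_norm hf).ennreal_ofReal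

theorem measurable_normIntegral (hf : Continuous fun γ => (⟨𝓖.r γ, f γ⟩ : TotalSpace ℂ A))
    (hh : (ρ.sourceBundle 𝓖).IsBorelSection h) :
    Measurable fun γ => normIntegral haar f h (𝓖.s γ) γ := by
  let κ : ProbabilityTheory.Kernel G G := haar.kernel.comap 𝓖.s 𝓖.continuous_s.measurable
  have h1 : Measurable fun p : G × G => ‖f (𝓖.cmul p.1 p.2)‖ₑ * ‖h (𝓖.inv p.2)‖ₑ :=
    ((measurable_enorm_section hf).comp TopGroupoid.measurable_cmul).mul
      (hh.measurable_enorm.comp (𝓖.continuous_inv.measurable.comp measurable_snd))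
  exact h1.lintegral_kernel_prod_right' (κ := κ)

/-- Schur's test, on the range fibre over a single unit. -/
theorem lintegral_normIntegral_sq_le (hf : Continuous fun γ => (⟨𝓖.r γ, f γ⟩ : TotalSpace ℂ A))
    (hh : (ρ.sourceBundle 𝓖).IsBorelSection h) {M : ℝ≥0∞}
    (hM : ∀ v, ∫⁻ γ, ‖f γ‖ₑ ∂haar.μ v ≤ M) (hM' : ∀ v, ∫⁻ γ, ‖f γ‖ₑ ∂haar.coMeasure v ≤ M) (u : X) :
    ∫⁻ κ, normIntegral haar f h u (𝓖.inv κ) ^ 2 ∂haar.μ u ≤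
      M ^ 2 * ∫⁻ ζ, ‖h (𝓖.inv ζ)‖ₑ ^ 2 ∂haar.μ u := by
  have hfm := measurable_enorm_section hf
  refine haar.lintegral_sq_convolution_le hfm
    (hh.measurable_enorm.comp 𝓖.continuous_inv.measurable) hM (fun v => ?_) u
  rw [← haar.lintegral_coMeasure v hfm]
  exact hM' v

theorem lintegral_nuInv_normIntegral_sq_le
    (hf : Continuous fun γ => (⟨𝓖.r γ, f γ⟩ : TotalSpace ℂ A))
    (hh : (ρ.sourceBundle 𝓖).IsBorelSection h) {M : ℝ≥0∞}
    (hM : ∀ v, ∫⁻ γ, ‖f γ‖ₑ ∂haar.μ v ≤ M) (hM' : ∀ v, ∫⁻ γ, ‖f γ‖ₑ ∂haar.coMeasure v ≤ M) :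
    ∫⁻ γ, normIntegral haar f h (𝓖.s γ) γ ^ 2 ∂haar.nuInv ρ.μ ≤
      M ^ 2 * ∫⁻ γ, ‖h γ‖ₑ ^ 2 ∂haar.nuInv ρ.μ := by
  have hm : Measurable fun γ => ‖h γ‖ₑ ^ 2 := hh.measurable_enorm.pow_const 2
  have hmi : Measurable fun u => ∫⁻ γ, ‖h (𝓖.inv γ)‖ₑ ^ 2 ∂haar.μ u :=
    (hm.comp 𝓖.continuous_inv.measurable).lintegral_kernel (κ := haar.kernel)
  rw [haar.lintegral_nuInv _ ((measurable_normIntegral haar hf hh).pow_const 2),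
    haar.lintegral_nuInv _ hm, ← lintegral_const_mul _ hmi]
  refine lintegral_mono fun u => le_trans (le_of_eq (lintegral_congr_ae ?_))
    (lintegral_normIntegral_sq_le haar hf hh hM hM' u)
  filter_upwards [haar.ae_range_eq u] with κ hκ
  rw [𝓖.s_inv, hκ]

/-- A finite bound for the `I`-norm of a compactly supported continuous section. -/
theorem _root_.IsCompactSection.exists_bound (hf : IsCompactSection 𝓖 f) :
    ∃ M : ℝ≥0∞, M < ∞ ∧ (∀ v, ∫⁻ γ, ‖f γ‖ₑ ∂haar.μ v ≤ M) ∧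
      ∀ v, ∫⁻ γ, ‖f γ‖ₑ ∂haar.coMeasure v ≤ M :=
  ⟨_, (hf.isIIntegrable haar).2,
    fun v => (le_iSup (fun v => ∫⁻ γ, ‖f γ‖ₑ ∂haar.μ v) v).trans (le_max_right _ _),
    fun v => (le_iSup (fun v => ∫⁻ γ, ‖f γ‖ₑ ∂haar.coMeasure v) v).trans (le_max_left _ _)⟩

theorem lintegral_regularSection_lt_top (hf : IsCompactSection 𝓖 f) (h : ρ.Sections haar) :
    ∫⁻ γ, ‖S.regularSection haar ρ f h.toSection γ‖ₑ ^ 2 ∂haar.nuInv ρ.μ < ∞ := by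
  obtain ⟨M, hMt, hM, hM'⟩ := hf.exists_bound haar
  refine lt_of_le_of_lt ?_ (ENNReal.mul_lt_top (ENNReal.pow_lt_top hMt (n := 2))
    (BundleRep.Sections.lintegral_lt_top h))
  exact (lintegral_mono fun γ => pow_le_pow_left' (enorm_regularSection_le haar γ) 2).trans
    (lintegral_nuInv_normIntegral_sq_le haar hf.1 (BundleRep.Sections.isBorelSection h) hM hM')

/-- `Ind π (f) h` as a square integrable section. -/
noncomputable def regularL2 (S : GroupoidAction 𝓖 A) (hf : IsCompactSection 𝓖 f)
    (h : ρ.Sections haar) : ρ.Sections haar :=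
  .ofBorel (S.regularSection haar ρ f h.toSection)
    (isBorelSection_regularSection haar hf.1 (BundleRep.Sections.isBorelSection h))
    (lintegral_regularSection_lt_top haar hf h)

theorem toSection_regularL2 (hf : IsCompactSection 𝓖 f) (h : ρ.Sections haar) :
    (S.regularL2 haar hf h).toSection = S.regularSection haar ρ f h.toSection := rfl

theorem ae_normIntegral_lt_top (hf : IsCompactSection 𝓖 f) (h : ρ.Sections haar) :
    ∀ᵐ γ ∂haar.nuInv ρ.μ, normIntegral haar f h.toSection (𝓖.s γ) γ < ∞ := by
  obtain ⟨M, hMt, hM, hM'⟩ := hf.exists_bound haar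
  have hb := BundleRep.Sections.isBorelSection h
  have hlt := (lintegral_nuInv_normIntegral_sq_le haar hf.1 hb hM hM').trans_lt
    (ENNReal.mul_lt_top (ENNReal.pow_lt_top hMt (n := 2)) (BundleRep.Sections.lintegral_lt_top h))
  filter_upwards [ae_lt_top ((measurable_normIntegral haar hf.1 hb).pow_const 2) hlt.ne] with γ hγ
  by_contra hc
  rw [not_lt_top_iff.1 hc] at hγ
  simp at hγ

theorem ae_integrable_integrand (hf : IsCompactSection 𝓖 f) (h : ρ.Sections haar) :
    ∀ᵐ γ ∂haar.nuInv ρ.μ, Integrable (fun ζ => ρ.rep (𝓖.s γ) (S.kernelAt f (𝓖.s γ) γ ζ)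
      (ρ.invSection 𝓖 h.toSection (𝓖.s γ) ζ)) (haar.μ (𝓖.s γ)) := by
  filter_upwards [ae_normIntegral_lt_top haar hf h] with γ hγ
  exact integrable_integrand haar hf.1 (BundleRep.Sections.isBorelSection h) rfl hγ

/-- The operator `Ind π (f)` is characterized by its values on classes of sections. -/
theorem isInducedOperator_iff (hf : IsCompactSection 𝓖 f) {T : ρ.L2 haar →L[ℂ] ρ.L2 haar} :
    S.IsInducedOperator haar ρ f T ↔ ∀ h : ρ.Sections haar,
      T (BorelHilbertBundle.L2.mk h) = BorelHilbertBundle.L2.mk (S.regularL2 haar hf h) := by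
  refine ⟨fun hT h => ?_, fun hT h => ⟨_, hT h, ?_⟩⟩
  · obtain ⟨k, hk, hae⟩ := hT h
    rw [hk]
    refine BorelHilbertBundle.L2.mk_eq_of_ae ?_
    filter_upwards [hae] with γ hγ
    rw [hγ.2, integral_regularIntegrand haar hf.1 (BundleRep.Sections.isBorelSection h) γ,
      toSection_regularL2]
  · filter_upwards [ae_integrable_integrand (S := S) haar hf h] with γ hγ
    have hb := BundleRep.Sections.isBorelSection h
    exact ⟨(integrable_regularIntegrand_iff haar hf.1 hb γ).2 hγ,
      (integral_regularIntegrand haar hf.1 hb γ).symm⟩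

theorem invSection_add (h k : ρ.Sections haar) (u : X) (ζ : G) :
    ρ.invSection 𝓖 (h + k).toSection u ζ =
      ρ.invSection 𝓖 h.toSection u ζ + ρ.invSection 𝓖 k.toSection u ζ :=
  toFibre_add u _ _

theorem invSection_smul (c : ℂ) (h : ρ.Sections haar) (u : X) (ζ : G) :
    ρ.invSection 𝓖 (c • h).toSection u ζ = c • ρ.invSection 𝓖 h.toSection u ζ :=
  toFibre_smul u c _

/-- The operators `Ind π (f)` exist, with norms bounded independently of `π`. -/
theorem exists_isInducedOperator (hf : IsCompactSection 𝓖 f) : ∃ C : ℝ, 0 ≤ C ∧ ∀ ρ : BundleRep A,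
    ∃ T : ρ.L2 haar →L[ℂ] ρ.L2 haar, S.IsInducedOperator haar ρ f T ∧ ‖T‖ ≤ C := by
  obtain ⟨M, hMt, hM, hM'⟩ := hf.exists_bound haar
  refine ⟨M.toReal, ENNReal.toReal_nonneg, fun ρ => ?_⟩
  let F : ρ.Sections haar → ρ.L2 haar := fun h =>
    BorelHilbertBundle.L2.mk (S.regularL2 haar hf h)
  have hadd : ∀ h k, F (h + k) = F h + F k := fun h k => by
    change _ = BorelHilbertBundle.L2.mk (S.regularL2 haar hf h + S.regularL2 haar hf k)
    refine BorelHilbertBundle.L2.mk_eq_of_ae ?_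
    filter_upwards [ae_integrable_integrand (S := S) haar hf h,
      ae_integrable_integrand (S := S) haar hf k] with γ hγ hγ'
    change S.regularSection haar ρ f (h + k).toSection γ =
      S.regularSection haar ρ f h.toSection γ + S.regularSection haar ρ f k.toSection γ
    simp_rw [regularSection, regularAt, invSection_add, map_add]
    exact integral_add hγ hγ'
  have hsmul : ∀ (c : ℂ) h, F (c • h) = c • F h := fun c h => by
    change _ = BorelHilbertBundle.L2.mk (c • S.regularL2 haar hf h)
    refine BorelHilbertBundle.L2.mk_eq_of_ae (ae_of_all _ fun γ => ?_)
    change S.regularSection haar ρ f (c • h).toSection γ =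
      c • S.regularSection haar ρ f h.toSection γ
    simp_rw [regularSection, regularAt, invSection_smul, map_smul]
    exact integral_smul c _
  have hbound : ∀ h, ‖F h‖ ≤ M.toReal * ‖h‖ := fun h => by
    rw [BorelHilbertBundle.L2.norm_mk, ← abs_of_nonneg (norm_nonneg (S.regularL2 haar hf h)),
      ← abs_of_nonneg (mul_nonneg (ENNReal.toReal_nonneg (a := M)) (norm_nonneg h)), ← sq_le_sq,
      mul_pow, BorelHilbertBundle.L2.norm_sq_eq, BorelHilbertBundle.L2.norm_sq_eq,
      ← ENNReal.toReal_pow, ← ENNReal.toReal_mul]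
    refine ENNReal.toReal_mono (ENNReal.mul_lt_top (ENNReal.pow_lt_top hMt (n := 2))
      (BundleRep.Sections.lintegral_lt_top h)).ne ?_
    exact (lintegral_mono fun γ => pow_le_pow_left' (enorm_regularSection_le haar γ) 2).trans
      (lintegral_nuInv_normIntegral_sq_le haar hf.1 (BundleRep.Sections.isBorelSection h) hM hM')
  obtain ⟨T, hT, hTn⟩ := BorelHilbertBundle.L2.exists_clm F hadd hsmul hbound
  exact ⟨T, (isInducedOperator_iff haar hf).2 hT, T.opNorm_le_bound ENNReal.toReal_nonneg hTn⟩

/-- The family of the operators `Ind π (f)` is bounded, so it defines an element of the product of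
the operator algebras. -/
theorem existsUnique_isRegularImage (hf : IsCompactSection 𝓖 f) :
    ∃! T, S.IsRegularImage haar f T := by
  obtain ⟨C, hC0, hC⟩ := exists_isInducedOperator (S := S) haar hf
  choose T hT hTC using hC
  refine ⟨⟨T, memℓp_infty ⟨C, by rintro _ ⟨ρ, rfl⟩; exact hTC ρ⟩⟩, hT, fun T' hT' => ?_⟩
  refine lp.ext (funext fun ρ => ContinuousLinearMap.ext fun x => ?_)
  obtain ⟨h, rfl⟩ := BorelHilbertBundle.L2.mk_surjective x
  exact ((isInducedOperator_iff haar hf).1 (hT' ρ) h).trans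
    ((isInducedOperator_iff haar hf).1 (hT ρ) h).symm

end GroupoidAction

end RegularOperator

/-! ### Products with the operators of the sections `⟨a, b⟩_E` -/

section Products

/-- Moving the value of a section along the base gives the value of the section. -/
theorem toFibre_section {X : Type*} {E : X → Type*} [∀ x, Zero (E x)] (a : ∀ x, E x) {x u : X}
    (h : x = u) : toFibre u (a x) = a u := by
  subst h; simp

variable {G X : Type*} [TopologicalSpace G] [T2Space G] [LocallyCompactSpace G]
  [SecondCountableTopology G] [MeasurableSpace G] [BorelSpace G]
  [TopologicalSpace X] [T2Space X] [LocallyCompactSpace X]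
  [MeasurableSpace X] [BorelSpace X] {𝓖 : TopGroupoid G X}
  {A : X → Type*} [∀ x, NonUnitalCStarAlgebra (A x)] [TopologicalSpace (TotalSpace ℂ A)]
  [IsUSCCStarBundle A] [TopologicalSpace.SeparableSpace (SectionAlgebra A)]

theorem Bundle.continuous_mul {Y : Type*} [TopologicalSpace Y] {q : Y → X} {B C : ∀ y, A (q y)}
    (hB : Continuous fun y => (⟨q y, B y⟩ : TotalSpace ℂ A))
    (hC : Continuous fun y => (⟨q y, C y⟩ : TotalSpace ℂ A)) :
    Continuous fun y => (⟨q y, B y * C y⟩ : TotalSpace ℂ A) :=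
  continuous_iff_continuousAt.2 fun y => tendsto_mul (hB.tendsto y) (hC.tendsto y)

namespace GroupoidAction

variable (haar : HaarSystem 𝓖) {S : GroupoidAction 𝓖 A} {ρ : BundleRep A}
  {f : ∀ γ, A (𝓖.r γ)} {h : ∀ γ, ρ.H.fibre (𝓖.s γ)}

theorem kernelAt_eq_symm (f : ∀ γ, A (𝓖.r γ)) (γ ζ : G) :
    S.kernelAt f (𝓖.s γ) γ ζ = (S.α γ).symm (toFibre (𝓖.r γ) (f (𝓖.cmul γ ζ))) := by
  rw [symm_eq_toFibre, mk_toFibre TopGroupoid.r_cmul, kernelAt]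

/-- `∫ α_γ⁻¹(f(γζ)) dλ^{s γ}(ζ) = α_γ⁻¹(∫ f dλ^{r γ})`. -/
theorem integral_kernelAt (hf : IsCompactSection 𝓖 f) (γ : G) :
    Integrable (S.kernelAt f (𝓖.s γ) γ) (haar.μ (𝓖.s γ)) ∧
      ∫ ζ, S.kernelAt f (𝓖.s γ) γ ζ ∂haar.μ (𝓖.s γ) =
        (S.α γ).symm (∫ η, onFibre 𝓖 f (𝓖.r γ) η ∂haar.μ (𝓖.r γ)) := by
  have hm := HaarSystem.measurable_cmul_left (𝓖 := 𝓖) γ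
  have hint : Integrable (onFibre 𝓖 f (𝓖.r γ)) (haar.μ (𝓖.r γ)) :=
    integrable_onFibre haar hf.1 hf.2 fun γ hγ _ => IsCompactSection.eq_zero hγ
  have h1 : ∀ ζ, S.α γ (S.kernelAt f (𝓖.s γ) γ ζ) = onFibre 𝓖 f (𝓖.r γ) (𝓖.cmul γ ζ) := fun ζ => by
    rw [kernelAt_eq_symm]
    exact (S.α γ).apply_symm_apply _
  rw [← haar.map_cmul γ] at hint
  have hint' := (integrable_map_measure hint.aestronglyMeasurable hm.aemeasurable).1 hint
  have hK : Integrable (S.kernelAt f (𝓖.s γ) γ) (haar.μ (𝓖.s γ)) := by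
    refine hint'.mono (aestronglyMeasurable_kernelAt haar hf.1 rfl) (ae_of_all _ fun ζ => ?_)
    rw [Function.comp_apply, ← h1, norm_map]
  refine ⟨hK, (S.α γ).injective ?_⟩
  have h2 : S.α γ ((S.α γ).symm (∫ η, onFibre 𝓖 f (𝓖.r γ) η ∂haar.μ (𝓖.r γ))) = _ :=
    (S.α γ).apply_symm_apply _
  change S.α γ _ = S.α γ ((S.α γ).symm _)
  rw [h2, ← clm_apply, ← ContinuousLinearMap.integral_comp_comm _ hK, ← haar.map_cmul γ,
    integral_map hm.aemeasurable hint.aestronglyMeasurable]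
  exact integral_congr_ae (ae_of_all _ h1)

/-- The kernel of a pointwise product with `η ↦ α_η(a(s η))` splits off a factor that does not
depend on `γ`. -/
theorem kernelAt_mul_map (f : ∀ γ, A (𝓖.r γ)) (a : ∀ x, A x) {γ ζ : G} (hζ : 𝓖.r ζ = 𝓖.s γ) :
    S.kernelAt (fun η => f η * S.α η (a (𝓖.s η))) (𝓖.s γ) γ ζ =
      S.kernelAt f (𝓖.s γ) γ ζ * onFibre 𝓖 (fun ζ => S.α ζ (a (𝓖.s ζ))) (𝓖.s γ) ζ := by
  rw [kernelAt_eq_symm, kernelAt_eq_symm, toFibre_mul, S.toFibre_map_cmul hζ.symm, onFibre_eq,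
    _root_.map_mul]
  congr 1
  exact (S.α γ).symm_apply_apply _

/-- The vector `∫ π_u(α_ζ(b(s ζ)^*)) h(ζ⁻¹) dλ^u(ζ)` paired with `h` by the section `b`. -/
noncomputable def pairing (S : GroupoidAction 𝓖 A) (ρ : BundleRep A) (b : ∀ x, A x)
    (h : ∀ γ, ρ.H.fibre (𝓖.s γ)) (u : X) : ρ.H.fibre u :=
  ∫ ζ, ρ.rep u (onFibre 𝓖 (fun ζ => S.α ζ (star (b (𝓖.s ζ)))) u ζ)
    (ρ.invSection 𝓖 h u ζ) ∂haar.μ u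

section Pairing

variable {b : ∀ x, A x} {K : Set X}

/-- The section `ζ ↦ α_ζ(b(s ζ))` is a bounded integrable weight on each range fibre. -/
theorem lintegral_mul_lt_top_of_compact (hG : 𝓖.IsProper) (hb : IsContSection b) (hK : IsCompact K)
    (h0 : ∀ x ∉ K, b x = 0) {k : G → ℝ≥0∞} (hk : Measurable k) {u : X}
    (hk2 : ∫⁻ ζ, k ζ ^ 2 ∂haar.μ u < ∞) :
    ∫⁻ ζ, ‖onFibre 𝓖 (fun ζ => S.α ζ (b (𝓖.s ζ))) u ζ‖ₑ * k ζ ∂haar.μ u < ∞ := by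
  obtain ⟨M, hM, hle⟩ := Bundle.exists_norm_le_of_isCompact hb hK
  have hbd : ∀ x, ‖b x‖ ≤ M := fun x => by
    by_cases hx : x ∈ K
    · exact hle x hx
    · simpa [h0 x hx] using hM
  have heq : ∀ᵐ ζ ∂haar.μ u, ‖onFibre 𝓖 (fun ζ => S.α ζ (b (𝓖.s ζ))) u ζ‖ₑ =
      ‖S.α ζ (b (𝓖.s ζ))‖ₑ := by
    filter_upwards [haar.ae_range_eq u] with ζ hζ
    rw [onFibre_eq, ← ofReal_norm, norm_toFibre hζ, ofReal_norm]
  have hfin := hasFiniteIntegral_iff_enorm.1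
    (integrable_averaging (S := S) haar hG hb hK h0 u).hasFiniteIntegral
  rw [lintegral_congr_ae heq] at hfin
  rw [lintegral_congr_ae (heq.mono fun ζ h => by rw [h])]
  refine lintegral_mul_lt_top_of_sq (measurable_enorm_section (continuous_map hb)) hk
    (ENNReal.ofReal_lt_top (r := M)) (fun ζ => ?_) hfin hk2
  rw [← ofReal_norm, norm_map]
  exact ENNReal.ofReal_le_ofReal (hbd _)

theorem measurable_enorm_inv (hh : (ρ.sourceBundle 𝓖).IsBorelSection h) :
    Measurable fun ζ => ‖h (𝓖.inv ζ)‖ₑ :=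
  hh.measurable_enorm.comp 𝓖.continuous_inv.measurable

theorem integrable_pairing (hG : 𝓖.IsProper) (hb : IsContSection b) (hK : IsCompact K)
    (h0 : ∀ x ∉ K, b x = 0) (hh : (ρ.sourceBundle 𝓖).IsBorelSection h) {u : X}
    (hu : ∫⁻ ζ, ‖h (𝓖.inv ζ)‖ₑ ^ 2 ∂haar.μ u < ∞) :
    Integrable (fun ζ => ρ.rep u (onFibre 𝓖 (fun ζ => S.α ζ (star (b (𝓖.s ζ)))) u ζ)
      (ρ.invSection 𝓖 h u ζ)) (haar.μ u) := by
  have h0' : ∀ x ∉ K, star (b x) = 0 := fun x hx => by rw [h0 x hx, star_zero]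
  refine ⟨ρ.aestronglyMeasurable_rep
    (integrable_averaging (S := S) haar hG hb.star hK h0' u).aestronglyMeasurable
    (BundleRep.stronglyMeasurable_invSection hh u).aestronglyMeasurable,
    hasFiniteIntegral_iff_enorm.2 ?_⟩
  refine lt_of_le_of_lt (lintegral_mono_ae ?_)
    (lintegral_mul_lt_top_of_compact (S := S) haar hG hb.star hK h0' (measurable_enorm_inv hh) hu)
  filter_upwards [haar.ae_range_eq u] with ζ hζ
  rw [← BundleRep.enorm_invSection hζ]
  exact ρ.enorm_rep_apply_le _ _ _

/-- The kernel of `⟨a, b⟩_E` is a product of a function of `γ` and a function of `ζ`, so that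
`Ind π (⟨a, b⟩_E)` has rank one over each unit. -/
theorem regularSection_innerE (hG : 𝓖.IsProper) (a : SectionAlgebra A) {b : SectionAlgebra A}
    (hb : b ∈ compactMulSubalgebra A) (hh : (ρ.sourceBundle 𝓖).IsBorelSection h) {γ : G}
    (hu : ∫⁻ ζ, ‖h (𝓖.inv ζ)‖ₑ ^ 2 ∂haar.μ (𝓖.s γ) < ∞) :
    S.regularSection haar ρ (S.innerE a b) h γ =
      ρ.rep (𝓖.s γ) ((S.α γ).symm (a (𝓖.r γ))) (S.pairing haar ρ b h (𝓖.s γ)) := by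
  obtain ⟨K, hK, h0⟩ := exists_isCompact_of_mem_compactMulSubalgebra hb
  have hint := integrable_pairing (S := S) haar hG b.isContSection hK h0 hh hu
  rw [pairing, ← ContinuousLinearMap.integral_comp_comm _ hint]
  refine integral_congr_ae ?_
  filter_upwards [haar.ae_range_eq (𝓖.s γ)] with ζ hζ
  have h1 : S.kernelAt (S.innerE a b) (𝓖.s γ) γ ζ = _ :=
    kernelAt_mul_map (fun η => a (𝓖.r η)) (fun x => star (b x)) hζ
  rw [h1, kernelAt_eq_symm, toFibre_section (fun x => a x) TopGroupoid.r_cmul, _root_.map_mul]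
  rfl

/-- The value of `Ind π (⟨a, b⟩_E) h` at an inverse `ζ⁻¹`. -/
theorem regularAt_innerE (hG : 𝓖.IsProper) (a : SectionAlgebra A) {b : SectionAlgebra A}
    (hb : b ∈ compactMulSubalgebra A) (hh : (ρ.sourceBundle 𝓖).IsBorelSection h) {u : X}
    (hu : ∫⁻ ζ, ‖h (𝓖.inv ζ)‖ₑ ^ 2 ∂haar.μ u < ∞) {ζ : G} (hζ : 𝓖.r ζ = u) :
    S.regularAt haar ρ (S.innerE a b) h u (𝓖.inv ζ) =
      ρ.rep u (onFibre 𝓖 (fun ζ => S.α ζ (a (𝓖.s ζ))) u ζ) (S.pairing haar ρ b h u) := by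
  obtain rfl : 𝓖.s (𝓖.inv ζ) = u := (𝓖.s_inv ζ).trans hζ
  refine (regularSection_innerE (S := S) haar hG a hb hh hu).trans ?_
  congr 2
  rw [symm_eq_toFibre, onFibre_eq, TopGroupoid.inv_inv]
  have h1 : ∀ x, x = 𝓖.s ζ → S.act ζ ⟨x, a x⟩ = ⟨_, S.α ζ (a (𝓖.s ζ))⟩ := by
    rintro _ rfl
    exact act_mk _
  rw [h1 _ (𝓖.r_inv ζ)]

end Pairing

/-- A section that is square integrable for `ν⁻¹` is square integrable on almost every fibre. -/
theorem ae_lintegral_inv_lt_top (h : ρ.Sections haar) :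
    ∀ᵐ γ ∂haar.nuInv ρ.μ, ∫⁻ ζ, ‖h.toSection (𝓖.inv ζ)‖ₑ ^ 2 ∂haar.μ (𝓖.s γ) < ∞ := by
  have hm := (BundleRep.Sections.isBorelSection h).measurable_enorm.pow_const 2
  have h1 := BundleRep.Sections.lintegral_lt_top h
  rw [haar.lintegral_nuInv _ hm] at h1
  exact haar.ae_nuInv_of_ae (p := fun u => ∫⁻ ζ, ‖h.toSection (𝓖.inv ζ)‖ₑ ^ 2 ∂haar.μ u < ∞)
    (ae_lt_top ((hm.comp 𝓖.continuous_inv.measurable).lintegral_kernel (κ := haar.kernel)) h1.ne)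

theorem isCompactSection_mul_map (hf : IsCompactSection 𝓖 f) {a : ∀ x, A x} (ha : IsContSection a) :
    IsCompactSection 𝓖 fun η => f η * S.α η (a (𝓖.s η)) :=
  isCompactSection_of_isCompact (Bundle.continuous_mul hf.1 (continuous_map ha)) hf.2 fun γ hγ => by
    rw [IsCompactSection.eq_zero hγ, zero_mul]

/-- The integral of a compactly supported section of `r^*𝒜` along the range fibres belongs to
`C_c(X) · A`. -/
theorem exists_mem_eq_integral (hf : IsCompactSection 𝓖 f) :
    ∃ c ∈ compactMulSubalgebra A, ∀ u, c u = ∫ γ, onFibre 𝓖 f u γ ∂haar.μ u := by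
  refine exists_mem_compactMulSubalgebra (isContSection_integral haar hf)
    (hf.2.image 𝓖.continuous_r) fun u hu => integral_eq_zero_of_ae ?_
  filter_upwards [haar.ae_range_eq u] with γ hγ
  rw [onFibre_eq, IsCompactSection.eq_zero fun h => hu ⟨γ, h, hγ⟩, toFibre_zero]
  rfl

theorem invSection_regularSection {u : X} {ζ : G} (hζ : 𝓖.r ζ = u) :
    ρ.invSection 𝓖 (S.regularSection haar ρ f h) u ζ = S.regularAt haar ρ f h u (𝓖.inv ζ) :=
  toFibre_regularSection haar ((𝓖.s_inv ζ).trans hζ)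

/-- `Ind π (f) Ind π (⟨a, b⟩_E) = Ind π (⟨c, b⟩_E)` for `c(u) = ∫ f(η) α_η(a(s η)) dλ^u(η)`. -/
theorem regularSection_regularSection_innerE (hG : 𝓖.IsProper) (hf : IsCompactSection 𝓖 f)
    (a c : SectionAlgebra A) {b : SectionAlgebra A} (hb : b ∈ compactMulSubalgebra A)
    (hc : ∀ u, c u = ∫ γ, onFibre 𝓖 (fun η => f η * S.α η (a (𝓖.s η))) u γ ∂haar.μ u)
    (hh : (ρ.sourceBundle 𝓖).IsBorelSection h) {γ : G}
    (hu : ∫⁻ ζ, ‖h (𝓖.inv ζ)‖ₑ ^ 2 ∂haar.μ (𝓖.s γ) < ∞) :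
    S.regularSection haar ρ f (S.regularSection haar ρ (S.innerE a b) h) γ =
      S.regularSection haar ρ (S.innerE c b) h γ := by
  rw [regularSection_innerE haar hG c hb hh hu, hc]
  obtain ⟨hint, hval⟩ :=
    integral_kernelAt (S := S) haar (isCompactSection_mul_map (S := S) hf a.isContSection) γ
  let L : A (𝓖.s γ) →L[ℂ] ρ.H.fibre (𝓖.s γ) :=
    (ρ.repCLM (𝓖.s γ)).flip (S.pairing haar ρ b h (𝓖.s γ))
  change _ = L _
  rw [← hval, ← L.integral_comp_comm hint]
  refine integral_congr_ae ?_
  filter_upwards [haar.ae_range_eq (𝓖.s γ)] with ζ hζ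
  have h1 := kernelAt_mul_map (S := S) f (fun x => a x) hζ
  rw [invSection_regularSection haar hζ, regularAt_innerE haar hG a hb hh hu hζ, h1]
  change _ = ρ.rep _ (_ * _) _
  rw [_root_.map_mul]
  rfl

/-- `f * ⟨a, b⟩_E = ⟨f · a, b⟩_E`, where `(f · a)(u) = ∫ f(η) α_η(a(s η)) dλ^u(η)`. -/
theorem exists_mul_innerE (hG : 𝓖.IsProper) (hf : IsCompactSection 𝓖 f) {a b : SectionAlgebra A}
    (ha : a ∈ compactMulSubalgebra A) (hb : b ∈ compactMulSubalgebra A) :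
    ∃ c ∈ compactMulSubalgebra A, ∀ T T' : RegularOperators haar A, S.IsRegularImage haar f T →
      S.IsRegularImage haar (S.innerE a b) T' → S.IsRegularImage haar (S.innerE c b) (T * T') := by
  obtain ⟨c, hc, hcF⟩ :=
    exists_mem_eq_integral haar (isCompactSection_mul_map (S := S) hf a.isContSection)
  refine ⟨c, hc, fun T T' hT hT' ρ => (isInducedOperator_iff haar
    (isCompactSection_innerE hG hc hb)).2 fun h => ?_⟩
  have hE := isCompactSection_innerE (S := S) hG ha hb
  change T ρ (T' ρ (BorelHilbertBundle.L2.mk h)) = _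
  rw [(isInducedOperator_iff haar hE).1 (hT' ρ), (isInducedOperator_iff haar hf).1 (hT ρ)]
  refine BorelHilbertBundle.L2.mk_eq_of_ae ?_
  filter_upwards [ae_lintegral_inv_lt_top haar h] with γ hu
  exact regularSection_regularSection_innerE haar hG hf a c hb hcF
    (BundleRep.Sections.isBorelSection h) hu

/-- The section `ζ ↦ α_ζ(b(s ζ)^* f(ζ⁻¹))`, whose integrals over the range fibres define the
section `c^*` with `⟨a, b⟩_E * f = ⟨a, c⟩_E`. -/
noncomputable def pairKernel (S : GroupoidAction 𝓖 A) (b : ∀ x, A x) (f : ∀ γ, A (𝓖.r γ)) (ζ : G) :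
    A (𝓖.r ζ) :=
  S.α ζ (star (b (𝓖.s ζ))) * S.α ζ (toFibre (𝓖.s ζ) (f (𝓖.inv ζ)))

theorem isCompactSection_pairKernel (hf : IsCompactSection 𝓖 f) {b : ∀ x, A x}
    (hb : IsContSection b) : IsCompactSection 𝓖 (S.pairKernel b f) := by
  refine isCompactSection_of_isCompact (Bundle.continuous_mul (continuous_map hb.star) ?_)
    (hf.2.image 𝓖.continuous_inv) fun γ hγ => ?_
  · exact continuous_act' continuous_id (hf.1.comp 𝓖.continuous_inv) fun γ => 𝓖.r_inv γ
  · have h0 : f (𝓖.inv γ) = 0 := IsCompactSection.eq_zero fun h =>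
      hγ ⟨_, h, TopGroupoid.inv_inv⟩
    rw [pairKernel, h0, toFibre_zero, _root_.map_zero, mul_zero]

/-- The substitution `ζ = ξσ` in the kernel of `⟨a, b⟩_E * f`. -/
theorem mul_kernelAt_cmul (b : ∀ x, A x) (f : ∀ γ, A (𝓖.r γ)) {ξ σ : G} (hσ : 𝓖.r σ = 𝓖.s ξ) :
    onFibre 𝓖 (fun ζ => S.α ζ (star (b (𝓖.s ζ)))) (𝓖.r ξ) (𝓖.cmul ξ σ) *
        S.kernelAt f (𝓖.r ξ) (𝓖.inv (𝓖.cmul ξ σ)) ξ =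
      S.clm ξ (onFibre 𝓖 (S.pairKernel b f) (𝓖.s ξ) σ) := by
  have h1 : S.kernelAt f (𝓖.r ξ) (𝓖.inv (𝓖.cmul ξ σ)) ξ =
      S.α ξ (toFibre (𝓖.s ξ) (S.α σ (toFibre (𝓖.s σ) (f (𝓖.inv σ))))) := by
    have hp : ∀ γ : G, γ = 𝓖.inv σ →
        S.act (𝓖.cmul ξ σ) ⟨_, f γ⟩ = S.act ξ (S.act σ ⟨_, f (𝓖.inv σ)⟩) := by
      rintro _ rfl
      exact act_cmul hσ.symm (𝓖.r_inv σ)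
    rw [kernelAt, TopGroupoid.inv_inv, hp _ (TopGroupoid.inv_cmul_left hσ.symm), toFibre_act]
    rfl
  rw [onFibre_eq, S.toFibre_map_cmul hσ.symm fun x => star (b x), h1, onFibre_eq, pairKernel,
    toFibre_mul, clm_apply, _root_.map_mul]

theorem aestronglyMeasurable_kernelAt_prod
    (hf : Continuous fun γ => (⟨𝓖.r γ, f γ⟩ : TotalSpace ℂ A)) (u : X) :
    AEStronglyMeasurable (fun p : G × G => S.kernelAt f u (𝓖.inv p.1) p.2)
      ((haar.μ u).prod (haar.μ u)) := by
  let D : Set (G × G) := {p | 𝓖.r p.1 = u ∧ 𝓖.r p.2 = u}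
  have hD : MeasurableSet D :=
    ((isClosed_singleton.preimage (𝓖.continuous_r.comp continuous_fst)).inter
      (isClosed_singleton.preimage (𝓖.continuous_r.comp continuous_snd))).measurableSet
  have hc : ContinuousOn (fun p : G × G => S.kernelAt f u (𝓖.inv p.1) p.2) D := by
    rw [continuousOn_iff_continuous_domRestrict]
    have h1 := continuous_kernelAt (S := S) (Y := D) (q := fun _ => u)
      (g := fun p => 𝓖.inv p.1.1) (z := fun p => p.1.2) hf
      (𝓖.continuous_inv.comp (continuous_fst.comp continuous_subtype_val))
      (continuous_snd.comp continuous_subtype_val) (fun p => (𝓖.s_inv _).trans p.2.1) fun p => p.2.2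
    exact continuous_iff_continuousAt.2 fun ζ => Bundle.tendsto_fibre_iff.1 (h1.tendsto ζ)
  have := hc.aestronglyMeasurable (μ := (haar.μ u).prod (haar.μ u)) hD
  rwa [Measure.restrict_eq_self_of_ae_mem] at this
  filter_upwards [Measure.quasiMeasurePreserving_fst.ae (haar.ae_range_eq u),
    Measure.quasiMeasurePreserving_snd.ae (haar.ae_range_eq u)] with p h1 h2
  exact ⟨h1, h2⟩

/-- The integrals of norms defining `Ind π (f) h` are square integrable on the fibres on which `h`
is square integrable. -/
theorem lintegral_inv_normIntegral_lt_top (hf : IsCompactSection 𝓖 f)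
    (hh : (ρ.sourceBundle 𝓖).IsBorelSection h) {u : X}
    (hu : ∫⁻ ζ, ‖h (𝓖.inv ζ)‖ₑ ^ 2 ∂haar.μ u < ∞) :
    ∫⁻ ζ, normIntegral haar f h u (𝓖.inv ζ) ^ 2 ∂haar.μ u < ∞ := by
  obtain ⟨M, hMt, hM, hM'⟩ := hf.exists_bound haar
  exact (lintegral_normIntegral_sq_le haar hf.1 hh hM hM' u).trans_lt
    (ENNReal.mul_lt_top (ENNReal.pow_lt_top hMt (n := 2)) hu)

/-- Pairing `Ind π (f) h` by `b` amounts to pairing `h` by `c`, where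
`c(u)^* = ∫ α_ζ(b(s ζ)^* f(ζ⁻¹)) dλ^u(ζ)`. -/
theorem pairing_regularSection (hG : 𝓖.IsProper) (hf : IsCompactSection 𝓖 f) {b c : ∀ x, A x}
    {K : Set X} (hb : IsContSection b) (hK : IsCompact K) (h0 : ∀ x ∉ K, b x = 0)
    (hc : ∀ u, star (c u) = ∫ γ, onFibre 𝓖 (S.pairKernel b f) u γ ∂haar.μ u)
    (hh : (ρ.sourceBundle 𝓖).IsBorelSection h) {u : X}
    (hu : ∫⁻ ζ, ‖h (𝓖.inv ζ)‖ₑ ^ 2 ∂haar.μ u < ∞) :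
    S.pairing haar ρ b (S.regularSection haar ρ f h) u = S.pairing haar ρ c h u := by
  set m := haar.μ u with hm
  let β : G → A u := onFibre 𝓖 (fun ζ => S.α ζ (star (b (𝓖.s ζ)))) u
  let k : G → G → A u := fun ζ ξ => S.kernelAt f u (𝓖.inv ζ) ξ
  let v : G → ρ.H.fibre u := ρ.invSection 𝓖 h u
  let W : G → G → ρ.H.fibre u := fun ζ ξ => ρ.rep u (β ζ * k ζ ξ) (v ξ)
  have h0' : ∀ x ∉ K, star (b x) = 0 := fun x hx => by rw [h0 x hx, star_zero]
  have hβ : AEStronglyMeasurable β m :=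
    (integrable_averaging (S := S) haar hG hb.star hK h0' u).aestronglyMeasurable
  have hN : Measurable fun ζ => normIntegral haar f h (𝓖.s (𝓖.inv ζ)) (𝓖.inv ζ) :=
    (measurable_normIntegral haar hf.1 hh).comp 𝓖.continuous_inv.measurable
  have hNeq : ∀ᵐ ζ ∂m, normIntegral haar f h (𝓖.s (𝓖.inv ζ)) (𝓖.inv ζ) =
      normIntegral haar f h u (𝓖.inv ζ) := by
    filter_upwards [haar.ae_range_eq u] with ζ hζ
    rw [𝓖.s_inv, hζ]
  have hmul : ∀ x y : A u, ‖x * y‖ₑ ≤ ‖x‖ₑ * ‖y‖ₑ := fun x y => by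
    simpa only [enorm_eq_nnnorm, ← ENNReal.coe_mul, ENNReal.coe_le_coe] using nnnorm_mul_le x y
  have hsq : ∫⁻ ζ, normIntegral haar f h (𝓖.s (𝓖.inv ζ)) (𝓖.inv ζ) ^ 2 ∂m < ∞ := by
    rw [lintegral_congr_ae (hNeq.mono fun ζ h => by rw [h])]
    exact lintegral_inv_normIntegral_lt_top haar hf hh hu
  have hWm : AEStronglyMeasurable (Function.uncurry W) (m.prod m) :=
    ρ.aestronglyMeasurable_rep
      (hβ.comp_fst.mul (aestronglyMeasurable_kernelAt_prod haar hf.1 u))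
      (BundleRep.stronglyMeasurable_invSection hh u).aestronglyMeasurable.comp_snd
  have hWint : Integrable (Function.uncurry W) (m.prod m) := by
    refine ⟨hWm, hasFiniteIntegral_iff_enorm.2 ?_⟩
    rw [lintegral_prod _ hWm.enorm]
    refine lt_of_le_of_lt (lintegral_mono_ae ?_)
      (lintegral_mul_lt_top_of_compact (S := S) haar hG hb.star hK h0' hN hsq)
    filter_upwards [haar.ae_range_eq u, hNeq] with ζ hζ hζN
    rw [hζN, normIntegral, ← lintegral_const_mul' _ _ enorm_ne_top]
    refine lintegral_mono_ae ?_
    filter_upwards [haar.ae_range_eq u] with ξ hξ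
    rw [← enorm_kernelAt (S := S) ξ ((𝓖.s_inv ζ).trans hζ), ← BundleRep.enorm_invSection hξ,
      ← mul_assoc]
    exact (ρ.enorm_rep_apply_le _ _ _).trans (mul_le_mul_left (hmul _ _) _)
  have hfin : ∀ᵐ ζ ∂m, normIntegral haar f h u (𝓖.inv ζ) < ∞ := by
    filter_upwards [ae_lt_top (hN.pow_const 2) hsq.ne, hNeq] with ζ hζ hζN
    rw [hζN] at hζ
    by_contra hc
    rw [not_lt_top_iff.1 hc] at hζ
    simp at hζ
  -- exchange the integrals, then substitute `ζ = ξσ` in the inner one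
  calc S.pairing haar ρ b (S.regularSection haar ρ f h) u
      = ∫ ζ, ∫ ξ, W ζ ξ ∂m ∂m := by
        refine integral_congr_ae ?_
        filter_upwards [haar.ae_range_eq u, hfin] with ζ hζ hζN
        rw [invSection_regularSection haar hζ, regularAt, ← ContinuousLinearMap.integral_comp_comm _
          (integrable_integrand haar hf.1 hh ((𝓖.s_inv ζ).trans hζ) hζN)]
        refine integral_congr_ae (ae_of_all _ fun ξ => ?_)
        change _ = ρ.rep u (β ζ * k ζ ξ) (v ξ)
        rw [_root_.map_mul]
        rfl
    _ = ∫ ξ, ∫ ζ, W ζ ξ ∂m ∂m := integral_integral_swap hWint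
    _ = S.pairing haar ρ c h u := by
        refine integral_congr_ae ?_
        filter_upwards [haar.ae_range_eq u] with ξ hξ
        obtain rfl := hξ
        have hF := isCompactSection_pairKernel (S := S) hf hb
        have hD := integrable_onFibre (u := 𝓖.s ξ) haar hF.1 hF.2
          fun γ hγ _ => IsCompactSection.eq_zero hγ
        have hD' := (S.clm ξ).integrable_comp hD
        have htr : ∀ σ, 𝓖.r σ = 𝓖.s ξ → β (𝓖.cmul ξ σ) * k (𝓖.cmul ξ σ) ξ =
            S.clm ξ (onFibre 𝓖 (S.pairKernel b f) (𝓖.s ξ) σ) := fun σ hσ => mul_kernelAt_cmul b f hσ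
        have hint : Integrable (fun ζ => β ζ * k ζ ξ) m :=
          (haar.integrable_translate hD'.aestronglyMeasurable htr).2 hD'
        have hval : ∫ ζ, β ζ * k ζ ξ ∂m = S.α ξ (star (c (𝓖.s ξ))) := by
          rw [hc, ← clm_apply, ← (S.clm ξ).integral_comp_comm hD]
          exact haar.integral_translate hD'.aestronglyMeasurable htr
        let L : A (𝓖.r ξ) →L[ℂ] ρ.H.fibre (𝓖.r ξ) := (ρ.repCLM (𝓖.r ξ)).flip (v ξ)
        change ∫ ζ, L (β ζ * k ζ ξ) ∂m = L (toFibre (𝓖.r ξ) (S.α ξ (star (c (𝓖.s ξ)))))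
        rw [L.integral_comp_comm hint, hval, toFibre_self]

/-- `⟨a, b⟩_E * f = ⟨a, c⟩_E`, where `c(u)^* = ∫ α_ζ(b(s ζ)^* f(ζ⁻¹)) dλ^u(ζ)`. -/
theorem exists_innerE_mul (hG : 𝓖.IsProper) (hf : IsCompactSection 𝓖 f) {a b : SectionAlgebra A}
    (ha : a ∈ compactMulSubalgebra A) (hb : b ∈ compactMulSubalgebra A) :
    ∃ c ∈ compactMulSubalgebra A, ∀ T T' : RegularOperators haar A, S.IsRegularImage haar f T →
      S.IsRegularImage haar (S.innerE a b) T' → S.IsRegularImage haar (S.innerE a c) (T' * T) := by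
  obtain ⟨g, hg, hgF⟩ := exists_mem_eq_integral haar
    (isCompactSection_pairKernel (S := S) hf b.isContSection)
  have hc : star g ∈ compactMulSubalgebra A := star_mem hg
  refine ⟨star g, hc, fun T T' hT hT' ρ => (isInducedOperator_iff haar
    (isCompactSection_innerE hG ha hc)).2 fun h => ?_⟩
  have hE := isCompactSection_innerE (S := S) hG ha hb
  change T' ρ (T ρ (BorelHilbertBundle.L2.mk h)) = _
  rw [(isInducedOperator_iff haar hf).1 (hT ρ), (isInducedOperator_iff haar hE).1 (hT' ρ)]
  refine BorelHilbertBundle.L2.mk_eq_of_ae ?_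
  have hh := BundleRep.Sections.isBorelSection h
  obtain ⟨K, hK, h0⟩ := exists_isCompact_of_mem_compactMulSubalgebra hb
  filter_upwards [ae_lintegral_inv_lt_top haar h,
    ae_lintegral_inv_lt_top haar (S.regularL2 haar hf h)] with γ hu hu'
  have h1 := regularSection_innerE (S := S) haar hG a hb
    (BundleRep.Sections.isBorelSection (S.regularL2 haar hf h)) hu'
  have h2 := regularSection_innerE (S := S) haar hG a hc hh hu
  have h3 := pairing_regularSection (S := S) (c := fun x => star (g x)) haar hG hf
    b.isContSection hK h0 (fun u => (star_star (g u)).trans (hgF u)) hh hu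
  exact h1.trans ((congrArg (ρ.rep _ _) h3).trans h2.symm)

end GroupoidAction

end Products

/-! ### The ideal `E` -/

section Ideal

variable {G X : Type*} [TopologicalSpace G] [T2Space G] [LocallyCompactSpace G]
  [SecondCountableTopology G] [MeasurableSpace G] [BorelSpace G]
  [TopologicalSpace X] [T2Space X] [LocallyCompactSpace X]
  [MeasurableSpace X] [BorelSpace X] {𝓖 : TopGroupoid G X}
  {A : X → Type*} [∀ x, NonUnitalCStarAlgebra (A x)] [TopologicalSpace (TotalSpace ℂ A)]
  [IsUSCCStarBundle A] [TopologicalSpace.SeparableSpace (SectionAlgebra A)]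

theorem IsCompactSection.add {f g : ∀ γ, A (𝓖.r γ)} (hf : IsCompactSection 𝓖 f)
    (hg : IsCompactSection 𝓖 g) : IsCompactSection 𝓖 fun γ => f γ + g γ := by
  refine isCompactSection_of_isCompact (continuous_iff_continuousAt.2 fun γ =>
    Bundle.tendsto_add (hf.1.tendsto γ) (hg.1.tendsto γ)) (hf.2.union hg.2) fun γ hγ => ?_
  rw [IsCompactSection.eq_zero fun h => hγ (Or.inl h),
    IsCompactSection.eq_zero fun h => hγ (Or.inr h), add_zero]

theorem IsCompactSection.smul {f : ∀ γ, A (𝓖.r γ)} (c : ℂ) (hf : IsCompactSection 𝓖 f) :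
    IsCompactSection 𝓖 fun γ => c • f γ := by
  refine isCompactSection_of_isCompact (continuous_iff_continuousAt.2 fun γ =>
    Bundle.tendsto_smul tendsto_const_nhds (hf.1.tendsto γ)) hf.2 fun γ hγ => ?_
  rw [IsCompactSection.eq_zero hγ, smul_zero]

namespace GroupoidAction

variable (haar : HaarSystem 𝓖) {S : GroupoidAction 𝓖 A}

theorem IsRegularImage.add {f g : ∀ γ, A (𝓖.r γ)} (hf : IsCompactSection 𝓖 f)
    (hg : IsCompactSection 𝓖 g) {T T' : RegularOperators haar A} (hT : S.IsRegularImage haar f T)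
    (hT' : S.IsRegularImage haar g T') :
    S.IsRegularImage haar (fun γ => f γ + g γ) (T + T') := fun ρ => by
  refine (isInducedOperator_iff haar (hf.add hg)).2 fun h => ?_
  change T ρ _ + T' ρ _ = _
  rw [(isInducedOperator_iff haar hf).1 (hT ρ), (isInducedOperator_iff haar hg).1 (hT' ρ),
    ← BorelHilbertBundle.L2.mk_add]
  refine BorelHilbertBundle.L2.mk_eq_of_ae ?_
  filter_upwards [ae_integrable_integrand (S := S) haar hf h,
    ae_integrable_integrand (S := S) haar hg h] with γ hγ hγ'
  refine (integral_add hγ hγ').symm.trans (integral_congr_ae (ae_of_all _ fun ζ => ?_))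
  change _ = ρ.rep _ (S.kernelAt (fun γ => f γ + g γ) _ _ _) _
  rw [kernelAt_eq_symm (fun γ => f γ + g γ), toFibre_add, _root_.map_add, ← kernelAt_eq_symm,
    ← kernelAt_eq_symm, _root_.map_add]
  rfl

set_option synthInstance.maxHeartbeats 400000 in
theorem IsRegularImage.smul {f : ∀ γ, A (𝓖.r γ)} (c : ℂ) (hf : IsCompactSection 𝓖 f)
    {T : RegularOperators haar A} (hT : S.IsRegularImage haar f T) :
    S.IsRegularImage haar (fun γ => c • f γ) (c • T) := fun ρ => by
  refine (isInducedOperator_iff haar (hf.smul c)).2 fun h => ?_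
  change c • T ρ _ = _
  rw [(isInducedOperator_iff haar hf).1 (hT ρ), ← BorelHilbertBundle.L2.mk_smul]
  refine BorelHilbertBundle.L2.mk_eq_of_ae (ae_of_all _ fun γ => ?_)
  refine (integral_smul (G := ρ.H.fibre (𝓖.s γ)) c _).symm.trans
    (integral_congr_ae (ae_of_all _ fun ζ => ?_))
  change _ = ρ.rep _ (S.kernelAt (fun γ => c • f γ) _ _ _) _
  rw [kernelAt_eq_symm (fun γ => c • f γ), toFibre_smul, _root_.map_smul, ← kernelAt_eq_symm,
    _root_.map_smul]
  rfl

variable (S) in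
set_option synthInstance.maxHeartbeats 400000 in
/-- The image of `Γ_c(G, r^*𝒜)` under the product of all regular representations. -/
def regularImage : Submodule ℂ (RegularOperators haar A) where
  carrier := {T | ∃ f, IsCompactSection 𝓖 f ∧ S.IsRegularImage haar f T}
  zero_mem' := by
    have h0 : IsCompactSection 𝓖 fun γ => (0 : A (𝓖.r γ)) :=
      isCompactSection_of_isCompact ((IsContSection.zero (A := A)).comp 𝓖.continuous_r)
        isCompact_empty fun _ _ => rfl
    obtain ⟨T, hT, -⟩ := existsUnique_isRegularImage (S := S) haar h0
    have := IsRegularImage.smul haar 0 h0 hT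
    rw [zero_smul] at this
    exact ⟨_, h0.smul 0, this⟩
  add_mem' := fun ⟨_, hf, hT⟩ ⟨_, hg, hT'⟩ => ⟨_, hf.add hg, IsRegularImage.add haar hf hg hT hT'⟩
  smul_mem' := fun c _ ⟨_, hf, hT⟩ => ⟨_, hf.smul c, IsRegularImage.smul haar c hf hT⟩

theorem exists_mem_reducedCrossedProduct_innerE (hG : 𝓖.IsProper) {a b : SectionAlgebra A}
    (ha : a ∈ compactMulSubalgebra A) (hb : b ∈ compactMulSubalgebra A) :
    ∃ T ∈ S.reducedCrossedProduct haar, S.IsRegularImage haar (S.innerE a b) T := by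
  have hE := isCompactSection_innerE (S := S) hG ha hb
  obtain ⟨T, hT, -⟩ := existsUnique_isRegularImage (S := S) haar hE
  exact ⟨T, subset_closure ⟨_, hE, hT⟩, hT⟩

/-- `E` is contained in the reduced crossed product, because the image of `Γ_c(G, r^*𝒜)` is a linear
subspace. -/
theorem mem_reducedCrossedProduct_of_mem_closedSpanInnerE (hG : 𝓖.IsProper)
    {y : RegularOperators haar A} (hy : y ∈ S.closedSpanInnerE haar (compactMulSubalgebra A)) :
    y ∈ S.reducedCrossedProduct haar := by
  have h1 : Submodule.span ℂ {T | ∃ a ∈ compactMulSubalgebra A, ∃ b ∈ compactMulSubalgebra A,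
      S.IsRegularImage haar (S.innerE a b) T} ≤ S.regularImage haar := by
    refine Submodule.span_le.2 ?_
    rintro T ⟨a, ha, b, hb, hT⟩
    exact ⟨_, isCompactSection_innerE hG ha hb, hT⟩
  exact closure_mono h1 hy

theorem RegularOperators.ext {T T' : RegularOperators haar A} (h : ∀ ρ, T ρ = T' ρ) : T = T' :=
  lp.ext (funext h)

set_option synthInstance.maxHeartbeats 400000 in
/-- Left multiplication preserves a linear span if it maps the generators into it. -/
theorem RegularOperators.mul_mem_span {Y : Set (RegularOperators haar A)}
    {T : RegularOperators haar A} (hT : ∀ y ∈ Y, T * y ∈ Submodule.span ℂ Y) :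
    ∀ y ∈ Submodule.span ℂ Y, T * y ∈ Submodule.span ℂ Y := by
  intro y hy
  induction hy using Submodule.span_induction with
  | mem y hy => exact hT y hy
  | zero =>
    have h : T * 0 = 0 := RegularOperators.ext haar fun ρ => mul_zero (T ρ)
    rw [h]
    exact Submodule.zero_mem _
  | add y z _ _ hy hz =>
    have h : T * (y + z) = T * y + T * z :=
      RegularOperators.ext haar fun ρ => mul_add (T ρ) (y ρ) (z ρ)
    rw [h]
    exact Submodule.add_mem _ hy hz
  | smul c y _ hy =>
    have h : T * c • y = c • (T * y) :=
      RegularOperators.ext haar fun ρ => ContinuousLinearMap.comp_smul (T ρ) c (y ρ)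
    rw [h]
    exact Submodule.smul_mem _ c hy

set_option synthInstance.maxHeartbeats 400000 in
/-- Right multiplication preserves a linear span if it maps the generators into it. -/
theorem RegularOperators.mem_span_mul {Y : Set (RegularOperators haar A)}
    {T : RegularOperators haar A} (hT : ∀ y ∈ Y, y * T ∈ Submodule.span ℂ Y) :
    ∀ y ∈ Submodule.span ℂ Y, y * T ∈ Submodule.span ℂ Y := by
  intro y hy
  induction hy using Submodule.span_induction with
  | mem y hy => exact hT y hy
  | zero =>
    have h : 0 * T = 0 := RegularOperators.ext haar fun ρ => zero_mul (T ρ)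
    rw [h]
    exact Submodule.zero_mem _
  | add y z _ _ hy hz =>
    have h : (y + z) * T = y * T + z * T :=
      RegularOperators.ext haar fun ρ => add_mul (y ρ) (z ρ) (T ρ)
    rw [h]
    exact Submodule.add_mem _ hy hz
  | smul c y _ hy =>
    have h : c • y * T = c • (y * T) :=
      RegularOperators.ext haar fun ρ => ContinuousLinearMap.smul_comp c (y ρ) (T ρ)
    rw [h]
    exact Submodule.smul_mem _ c hy

/-- `E` is a two-sided ideal of the reduced crossed product. -/
theorem mul_mem_closedSpanInnerE (hG : 𝓖.IsProper) {x y : RegularOperators haar A}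
    (hx : x ∈ S.reducedCrossedProduct haar)
    (hy : y ∈ S.closedSpanInnerE haar (compactMulSubalgebra A)) :
    x * y ∈ S.closedSpanInnerE haar (compactMulSubalgebra A) ∧
      y * x ∈ S.closedSpanInnerE haar (compactMulSubalgebra A) := by
  constructor
  · refine map_mem_closure₂ continuous_mul hx hy ?_
    rintro T ⟨f, hf, hT⟩
    refine RegularOperators.mul_mem_span haar ?_
    rintro T' ⟨a, ha, b, hb, hT'⟩
    obtain ⟨c, hc, hcT⟩ := exists_mul_innerE (S := S) haar hG hf ha hb
    exact Submodule.subset_span ⟨c, hc, b, hb, hcT T T' hT hT'⟩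
  · refine map_mem_closure₂ continuous_mul hy hx fun y hy => ?_
    rintro T ⟨f, hf, hT⟩
    refine RegularOperators.mem_span_mul haar ?_ y hy
    rintro T' ⟨a, ha, b, hb, hT'⟩
    obtain ⟨c, hc, hcT⟩ := exists_innerE_mul (S := S) haar hG hf ha hb
    exact Submodule.subset_span ⟨a, ha, c, hc, hcT T T' hT hT'⟩

end GroupoidAction

end Ideal

theorem mainTheorem6 {G X : Type*}
    [TopologicalSpace G] [T2Space G] [LocallyCompactSpace G] [SecondCountableTopology G]
    [MeasurableSpace G] [BorelSpace G]
    [TopologicalSpace X] [T2Space X] [LocallyCompactSpace X] [SecondCountableTopology X]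
    [MeasurableSpace X] [BorelSpace X]
    (𝓖 : TopGroupoid G X) (hG : 𝓖.IsProper) (haar : HaarSystem 𝓖)
    (A : X → Type*) [∀ x, NonUnitalCStarAlgebra (A x)] [TopologicalSpace (TotalSpace ℂ A)]
    [IsUSCCStarBundle A] [TopologicalSpace.SeparableSpace (SectionAlgebra A)]
    (S : GroupoidAction 𝓖 A) :
    -- the system is proper with respect to `A₀ = C_c(X) · A`
    S.IsProperWith haar (compactMulSubalgebra A) ∧
    -- the averaging map is well defined on `A₀` and takes values in the induced algebra
    (∀ a ∈ compactMulSubalgebra A,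
      (∀ u, Integrable (onFibre 𝓖 (fun γ => S.α γ (a (𝓖.s γ))) u) (haar.μ u)) ∧
      S.IsInduced (S.averaging haar a)) ∧
    -- the inner product `⟨a, b⟩_D` is multiplication by `λ(a^* b)`
    (∀ a ∈ compactMulSubalgebra A, ∀ b ∈ compactMulSubalgebra A,
      ∃ d : 𝓜(ℂ, SectionAlgebra A), S.IsInnerD haar (compactMulSubalgebra A) a b d ∧
        IsMultiplicationBy (S.averaging haar (star a * b : SectionAlgebra A)) d) ∧
    -- `Γ_c(G, r^*𝒜)` is represented by the regular representations, and each `⟨a, b⟩_E` defines an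
    -- element of the reduced crossed product
    (∀ f : ∀ γ, A (𝓖.r γ), IsCompactSection 𝓖 f → ∃! T, S.IsRegularImage haar f T) ∧
    (∀ a ∈ compactMulSubalgebra A, ∀ b ∈ compactMulSubalgebra A,
      ∃ T ∈ S.reducedCrossedProduct haar, S.IsRegularImage haar (S.innerE a b) T) ∧
    -- `E` is a two-sided ideal of the reduced crossed product
    (∀ y ∈ S.closedSpanInnerE haar (compactMulSubalgebra A), y ∈ S.reducedCrossedProduct haar) ∧
    (∀ x ∈ S.reducedCrossedProduct haar, ∀ y ∈ S.closedSpanInnerE haar (compactMulSubalgebra A),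
      x * y ∈ S.closedSpanInnerE haar (compactMulSubalgebra A) ∧
      y * x ∈ S.closedSpanInnerE haar (compactMulSubalgebra A)) := by
  refine ⟨GroupoidAction.isProperWith_compactMulSubalgebra haar hG, fun a ha => ?_,
    fun a ha b hb => GroupoidAction.exists_isInnerD_isMultiplicationBy haar hG ha hb,
    fun f hf => GroupoidAction.existsUnique_isRegularImage haar hf,
    fun a ha b hb => GroupoidAction.exists_mem_reducedCrossedProduct_innerE haar hG ha hb,
    fun y hy => GroupoidAction.mem_reducedCrossedProduct_of_mem_closedSpanInnerE haar hG hy,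
    fun x hx y hy => GroupoidAction.mul_mem_closedSpanInnerE haar hG hx hy⟩
  obtain ⟨K, hK, h0⟩ := exists_isCompact_of_mem_compactMulSubalgebra ha
  exact ⟨GroupoidAction.integrable_averaging haar hG a.isContSection hK h0,
    GroupoidAction.isInduced_averaging haar hG a.isContSection hK h0⟩
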